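/- **Setting.** Let $\mathcal M=(E,\mathcal I)$ be a finite matroid, $A$ a set of $m$ agents, and write $\bot$ for "no element". A feasible assignment is a map $M\colon A\to E\cup\{\bot\}$ such that no element of $E$ is assigned to two agents and the set of assigned elements is in $\mathcal I$. Given nonnegative weight functions $w_a\colon E\to\mathbb R_+$ (with $w_a(\bot)=0$), $\mathrm{OPT}(w)$ is the maximum of $\sum_{a\in A} w_a(M(a))$ over all feasible assignments. In the online problem, the agents arrive one by one; each arriving agent $a$ reveals $w_a$, and $M(a)$ must be fixed irrevocably before the next arrival, so that the final assignment is feasible. For an integer $k\ge 1$, a *$k$-directed certifier* of $\mathcal M$ is a digraph with node set $\mathcal N=\{(I,e): I\in\mathcal I,\ e\in I\}$ (the certificates) and arc set $\mathcal B\subseteq\mathcal N\times\mathcal N$ ($c$ *blocks* $d$ if $(c,d)\in\mathcal B$) such that 1. any two certificates $(I,e),(J,e)$ of the same element block each other; 2. if $(I_1,e_1),\dots,(I_t,e_t)$ are certificates and $(I_i,e_i)$ does not block $(I_j,e_j)$ for all $i<j$, then $\{e_1,\dots,e_t\}\in\mathcal I$; 3. for all $I,J\in\mathcal I$ and $f\in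 J$, at most $k$ elements $e\in I$ are such that $(I,e)$ blocks $(J,f)$. **Theorem.** Let $\mathcal M$ be a matroid that admits a $k$-directed certifier. For the online combinatorial assignment problem in $\mathcal M$ the following holds. (a) *Prophet IID model* (the weight functions are independent with a common law $\mathcal D$; the arrival order is arbitrary): there is an algorithm that always constructs a feasible assignment, of expected weight at least $\frac{1-e^{-k}}{k}\,\mathbb E[\mathrm{OPT}]$. It uses $\mathcal D$ only through independent samples. (b) *Single-sample prophet-secretary model* (agent $a$ has its own law $\mathcal D_a$, the weight functions are independent, the arrival order is uniformly random, and the algorithm only has one independent sample of each $\mathcal D_a$): there is an algorithm that always constructs a feasible assignment, of expected weight at least $\frac{1}{k+1}\,\mathbb E[\mathrm{OPT}]$. (c) *Secretary model* (the weight functions are arbitrary and fixed, the arrival order is uniformly random): there is an algorithm that always constructs a feasible assignment, of expected weight at least $k^{-k/(k-1)}\,\mathrm{OPT}$ if $k\ge 2$, and at least $\frac1e\,\mathrm{OPT}$ if $k=1$. All these algorithms run in polynomial time: each is one randomized real-RAM program, the same for all matroids, certifiers and instances, which accesses $\mathcal M$ through an independence oracle and the certifier through an oracle that tells whether one certificate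 blocks another, and whose total number of steps is at most a fixed polynomial in $|E|+m$ in every run. -/

import Mathlib

open scoped NNReal ENNReal

namespace OnlineAssignment

/-! ## Assignments, optimal value, directed certifiers

The ground set is `Fin n`, the agents are `Fin m`; `none` plays the role of the symbol `⊥`. -/

/-- A weight profile: a nonnegative weight function over the elements for every agent. -/
abbrev Profile (n m : ℕ) := Fin m → Fin n → ℝ≥0

/-- An assignment gives every agent an element or nothing. -/
abbrev Assignment (n m : ℕ) := Fin m → Option (Fin n)

/-- No element is given to two agents, and the assigned elements form an independent set. -/
def Feasible {n m : ℕ} (M : Matroid (Fin n)) (A : Assignment n m) : Prop :=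
  (∀ a a' : Fin m, a ≠ a' → A a = A a' → A a = none) ∧ M.Indep {e | ∃ a, A a = some e}

/-- The weight of an element or of `⊥` (which has weight zero). -/
def weightOf {n : ℕ} (w : Fin n → ℝ≥0) : Option (Fin n) → ℝ≥0
  | none => 0
  | some e => w e

/-- Total weight of an assignment. -/
def value {n m : ℕ} (w : Profile n m) (A : Assignment n m) : ℝ≥0 :=
  ∑ a, weightOf (w a) (A a)

open Classical in
/-- The maximum weight of a feasible assignment. -/
noncomputable def opt {n m : ℕ} (M : Matroid (Fin n)) (w : Profile n m) : ℝ≥0 :=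
  (Finset.univ.filter fun A : Assignment n m => Feasible M A).sup (value w)

/-- A pair consisting of a set of elements and an element. -/
abbrev Pair (n : ℕ) := Finset (Fin n) × Fin n

/-- The certificates of a directed certifier: pairs `(I, e)` with `I` independent, `e ∈ I`. -/
def IsCertificate {n : ℕ} (M : Matroid (Fin n)) (c : Pair n) : Prop :=
  M.Indep (c.1 : Set (Fin n)) ∧ c.2 ∈ c.1

open Classical in
/-- `B` is the arc relation of a `k`-directed certifier of the matroid; its certificates are the
pairs `(I, e)` with `I` independent and `e ∈ I`. -/
structure IsDirectedCertifier {n : ℕ} (M : Matroid (Fin n)) (k : ℕ)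
    (B : Pair n → Pair n → Prop) : Prop where
  /-- Arcs join certificates. -/
  arcs : ∀ c d, B c d → IsCertificate M c ∧ IsCertificate M d
  /-- Certificates of the same element block each other. -/
  same : ∀ c d, IsCertificate M c → IsCertificate M d → c.2 = d.2 → B c d
  /-- The elements of a sequence of certificates, none of which blocks a later one, form an
  independent set. -/
  certification : ∀ l : List (Pair n), (∀ c ∈ l, IsCertificate M c) →
    l.Pairwise (fun c d => ¬ B c d) → M.Indep {e | ∃ c ∈ l, c.2 = e}
  /-- Among the certificates built on one independent set, at most `k` block a given one. -/
  directed : ∀ (I : Finset (Fin n)) (d : Pair n), M.Indep (I : Set (Fin n)) →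
    IsCertificate M d → (I.filter fun e => B (I, e) d).card ≤ k

/-! ## A real RAM with oracles

Programs are finite texts built from assignments, conditionals and counted loops. They work on
finitely many named two-dimensional arrays of natural numbers and of real numbers. The available
operations are addition, truncated subtraction and comparison of natural numbers, the four
arithmetic operations and comparison of real numbers, conversion of a natural number to a real
number (not back), a read-only random tape of real numbers, and two oracles: independence of a set,
and blocking of certificates. There is no other access to the matroid, to the certifier or to the
distributions. Restricting loops to counted ones only makes the existence of a program a stronger
claim. -/

/-- What a program can see while it handles one arriving agent. -/
structure View (n : ℕ) where
  /-- number of agents -/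
  numAgents : ℕ
  /-- parameter of the certifier -/
  param : ℕ
  /-- independence oracle -/
  indep : Finset (Fin n) → Prop
  /-- blocking oracle -/
  blocks : Pair n → Pair n → Prop
  /-- the weight functions sampled in advance -/
  samples : ℕ → Fin n → ℝ≥0
  /-- random tape -/
  coins : ℕ → unitInterval
  /-- number of agents that arrived before -/
  round : ℕ
  /-- identity of the arriving agent -/
  agent : ℕ
  /-- weight function revealed by the arriving agent -/
  weight : Fin n → ℝ≥0

/-- The memory: the entry `(i, j)` of the array with name `x` is `nat x i j` or `real x i j`. -/
structure Store where
  nat : ℕ → ℕ → ℕ → ℕ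
  real : ℕ → ℕ → ℕ → ℝ

/-- The initial memory. -/
def Store.zero : Store := ⟨fun _ _ _ => 0, fun _ _ _ => 0⟩

/-- Write a natural number. -/
def Store.setNat (s : Store) (x i j v : ℕ) : Store :=
  { s with nat := fun x' i' j' => if x' = x ∧ i' = i ∧ j' = j then v else s.nat x' i' j' }

/-- Write a real number. -/
def Store.setReal (s : Store) (x i j : ℕ) (v : ℝ) : Store :=
  { s with real := fun x' i' j' => if x' = x ∧ i' = i ∧ j' = j then v else s.real x' i' j' }

/-- The set of elements whose entry in row `i` of the array `x` is nonzero. -/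
def Store.row (s : Store) (n x i : ℕ) : Finset (Fin n) :=
  Finset.univ.filter fun e => s.nat x i e ≠ 0

/-- The two types of values. -/
inductive Ty
  | nat
  | real

/-- Values of a type. -/
abbrev Ty.Val : Ty → Type
  | .nat => ℕ
  | .real => ℝ

/-- Expressions. -/
inductive Exp : Ty → Type
  | lit (c : ℕ) : Exp .nat
  | readNat (x : ℕ) (i j : Exp .nat) : Exp .nat
  | add (a b : Exp .nat) : Exp .nat
  | sub (a b : Exp .nat) : Exp .nat
  /-- `1` if `a ≤ b`, else `0` -/
  | le (a b : Exp .nat) : Exp .nat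
  /-- `1` if `u ≤ v`, else `0` -/
  | leReal (u v : Exp .real) : Exp .nat
  | numElements : Exp .nat
  | numAgents : Exp .nat
  | param : Exp .nat
  | round : Exp .nat
  | agent : Exp .nat
  /-- `1` if the set in row `i` of the array `x` is independent, else `0` -/
  | indep (x : ℕ) (i : Exp .nat) : Exp .nat
  /-- `1` if the set in row `i` of `x` with the element `e` blocks the set in row `j` of `y`
  with the element `f`, else `0` -/
  | blocks (x : ℕ) (i e : Exp .nat) (y : ℕ) (j f : Exp .nat) : Exp .nat
  | readReal (x : ℕ) (i j : Exp .nat) : Exp .real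
  | cast (a : Exp .nat) : Exp .real
  | addReal (u v : Exp .real) : Exp .real
  | subReal (u v : Exp .real) : Exp .real
  | mulReal (u v : Exp .real) : Exp .real
  | divReal (u v : Exp .real) : Exp .real
  /-- weight of the element `e` for the arriving agent -/
  | weight (e : Exp .nat) : Exp .real
  /-- weight of the element `e` in the sample number `i` -/
  | sample (i e : Exp .nat) : Exp .real
  /-- entry number `i` of the random tape -/
  | coin (i : Exp .nat) : Exp .real

open Classical in
/-- Value of an expression. -/
noncomputable def Exp.eval {n : ℕ} (V : View n) (s : Store) : {t : Ty} → Exp t → t.Val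
  | _, .lit c => c
  | _, .readNat x i j => s.nat x (i.eval V s) (j.eval V s)
  | _, .add a b => (a.eval V s : ℕ) + b.eval V s
  | _, .sub a b => (a.eval V s : ℕ) - b.eval V s
  | _, .le a b => if (a.eval V s : ℕ) ≤ b.eval V s then 1 else 0
  | _, .leReal u v => if (u.eval V s : ℝ) ≤ v.eval V s then 1 else 0
  | _, .numElements => n
  | _, .numAgents => V.numAgents
  | _, .param => V.param
  | _, .round => V.round
  | _, .agent => V.agent
  | _, .indep x i => if V.indep (s.row n x (i.eval V s)) then 1 else 0
  | _, .blocks x i e y j f =>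
      if ∃ (e' f' : Fin n), (e' : ℕ) = e.eval V s ∧ (f' : ℕ) = f.eval V s ∧
        V.blocks (s.row n x (i.eval V s), e') (s.row n y (j.eval V s), f') then 1 else 0
  | _, .readReal x i j => s.real x (i.eval V s) (j.eval V s)
  | _, .cast a => ((a.eval V s : ℕ) : ℝ)
  | _, .addReal u v => (u.eval V s : ℝ) + v.eval V s
  | _, .subReal u v => (u.eval V s : ℝ) - v.eval V s
  | _, .mulReal u v => (u.eval V s : ℝ) * v.eval V s
  | _, .divReal u v => (u.eval V s : ℝ) / v.eval V s
  | _, .weight e => if h : (e.eval V s : ℕ) < n then (V.weight ⟨e.eval V s, h⟩ : ℝ) else 0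
  | _, .sample i e =>
      if h : (e.eval V s : ℕ) < n then (V.samples (i.eval V s) ⟨e.eval V s, h⟩ : ℝ) else 0
  | _, .coin i => (V.coins (i.eval V s) : ℝ)

/-- Programs. -/
inductive Prog
  | skip
  | setNat (x : ℕ) (i j : Exp .nat) (a : Exp .nat)
  | setReal (x : ℕ) (i j : Exp .nat) (u : Exp .real)
  | seq (p q : Prog)
  /-- run `p` if the value of `a` is nonzero, else run `q` -/
  | ite (a : Exp .nat) (p q : Prog)
  /-- for `i = 0, …, a - 1` (`a` is evaluated once): write `i` to the entry `(0, 0)` of the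
  array `x`, then run `p` -/
  | loop (x : ℕ) (a : Exp .nat) (p : Prog)

/-- `iterate f c s` applies `f 0`, …, `f (c - 1)` to `s` in this order. -/
def iterate (f : ℕ → Store → Store) : ℕ → Store → Store
  | 0, s => s
  | c + 1, s => f c (iterate f c s)

/-- The memory after the execution of a program. -/
noncomputable def Prog.exec {n : ℕ} (V : View n) : Prog → Store → Store
  | .skip, s => s
  | .setNat x i j a, s => s.setNat x (i.eval V s) (j.eval V s) (a.eval V s)
  | .setReal x i j u, s => s.setReal x (i.eval V s) (j.eval V s) (u.eval V s)
  | .seq p q, s => q.exec V (p.exec V s)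
  | .ite a p q, s => if (a.eval V s : ℕ) ≠ 0 then p.exec V s else q.exec V s
  | .loop x a p, s => iterate (fun i s' => p.exec V (s'.setNat x 0 0 i)) (a.eval V s) s

/-- The number of steps of an execution. The evaluation of an expression is part of the step that
uses it: it takes a number of operations that depends on the program text only. -/
noncomputable def Prog.steps {n : ℕ} (V : View n) : Prog → Store → ℕ
  | .skip, _ => 1
  | .setNat _ _ _ _, _ => 1
  | .setReal _ _ _ _, _ => 1
  | .seq p q, s => p.steps V s + q.steps V (p.exec V s)
  | .ite a p q, s => 1 + if (a.eval V s : ℕ) ≠ 0 then p.steps V s else q.steps V s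
  | .loop x a p, s => 1 + ∑ c ∈ Finset.range (a.eval V s),
      (1 + p.steps V
        ((iterate (fun i s' => p.exec V (s'.setNat x 0 0 i)) c s).setNat x 0 0 c))

/-! ## Online execution

The program is executed once for every arriving agent, on a memory that persists between the
arrivals. During each execution it sees the weight function of the arriving agent only (besides the
data that are known in advance), and when the execution ends, the decision about this agent is read
off the memory once and for all. -/

/-- All data that determine a run. -/
structure Scenario (n m : ℕ) where
  /-- the matroid -/
  M : Matroid (Fin n)
  /-- parameter of the certifier -/
  k : ℕ
  /-- blocking relation of the certifier -/
  B : Pair n → Pair n → Prop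
  /-- `order t` is the agent that arrives in round `t` -/
  order : Equiv.Perm (Fin m)
  /-- the weights revealed by the agents -/
  weights : Profile n m
  /-- the weight functions sampled in advance -/
  samples : ℕ → Fin n → ℝ≥0
  /-- random tape -/
  coins : ℕ → unitInterval

namespace Scenario

variable {n m : ℕ} (S : Scenario n m) (P : Prog)

/-- What the program sees in round `t`. -/
def view (t : Fin m) : View n where
  numAgents := m
  param := S.k
  indep := fun I => S.M.Indep (I : Set (Fin n))
  blocks := S.B
  samples := S.samples
  coins := S.coins
  round := t
  agent := S.order t
  weight := S.weights (S.order t)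

/-- The memory after the first `t` rounds. -/
noncomputable def storeAfter : ℕ → Store
  | 0 => Store.zero
  | t + 1 => if h : t < m then P.exec (S.view ⟨t, h⟩) (storeAfter t) else storeAfter t

/-- The decision in round `t`, read off one entry of the memory at the end of the round: the value
`e + 1` with `e < n` means that the arriving agent gets `e`; any other value means `⊥`. -/
noncomputable def decision (t : Fin m) : Option (Fin n) :=
  let v := (S.storeAfter P (t + 1)).nat 0 0 0
  if h : v ≠ 0 ∧ v - 1 < n then some ⟨v - 1, h.2⟩ else none

/-- The assignment that the run constructs. -/
noncomputable def result : Assignment n m := fun a => S.decision P (S.order.symm a)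

/-- The total weight that the run collects. -/
noncomputable def collected : ℝ≥0 := value S.weights (S.result P)

/-- The total number of steps over all rounds. -/
noncomputable def totalSteps : ℕ := ∑ t : Fin m, P.steps (S.view t) (S.storeAfter P t)

/-- The run constructs a feasible assignment, and its running time is at most the polynomial `q`
in the number of elements plus the number of agents. -/
def RunsWithin (q : Polynomial ℕ) : Prop :=
  Feasible S.M (S.result P) ∧ S.totalSteps P ≤ q.eval (n + m)

end Scenario

/-! ## The three online models -/

open MeasureTheory

/-- The law of the random tape: independent uniform numbers in `[0, 1]`. -/
noncomputable def coinLaw : Measure (ℕ → unitInterval) :=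
  Measure.infinitePi fun _ : ℕ => (volume : Measure unitInterval)

/-- The sample sequence that holds one sample per agent, the sample of agent `a` at place `a`. -/
def samplePerAgent {n m : ℕ} (s : Profile n m) (i : ℕ) : Fin n → ℝ≥0 :=
  if h : i < m then s ⟨i, h⟩ else 0

/-- Prophet IID model: independent weights with the common law `D`, an arbitrary fixed order, and
a sequence of independent samples of `D`. The program is `γ`-competitive: in every run it
constructs a feasible assignment in time `q`, and the expected weight of this assignment is at
least `γ` times the expected optimum. -/
def CompetitiveIID {n : ℕ} (M : Matroid (Fin n)) (k : ℕ) (B : Pair n → Pair n → Prop) (m : ℕ)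
    (P : Prog) (q : Polynomial ℕ) (γ : ℝ) : Prop :=
  ∀ order : Equiv.Perm (Fin m),
    (∀ (r : Profile n m) (s : ℕ → Fin n → ℝ≥0) (ω : ℕ → unitInterval),
      (Scenario.mk M k B order r s ω).RunsWithin P q) ∧
    ∀ (D : Measure (Fin n → ℝ≥0)) [IsProbabilityMeasure D],
      ENNReal.ofReal γ * ∫⁻ r, (opt M r : ℝ≥0∞) ∂(Measure.pi fun _ : Fin m => D) ≤
        ∫⁻ z : (Profile n m × (ℕ → Fin n → ℝ≥0)) × (ℕ → unitInterval),
          ((Scenario.mk M k B order z.1.1 z.1.2 z.2).collected P : ℝ≥0∞)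
          ∂(((Measure.pi fun _ : Fin m => D).prod
            (Measure.infinitePi fun _ : ℕ => D)).prod coinLaw)

/-- Single-sample prophet-secretary model: agent `a` has its own law `D a`, the agents arrive in
uniformly random order, and one independent sample per agent is known in advance. -/
def CompetitiveProphetSecretary {n : ℕ} (M : Matroid (Fin n)) (k : ℕ)
    (B : Pair n → Pair n → Prop) (m : ℕ) (P : Prog) (q : Polynomial ℕ) (γ : ℝ) : Prop :=
  (∀ (order : Equiv.Perm (Fin m)) (r s : Profile n m) (ω : ℕ → unitInterval),
    (Scenario.mk M k B order r (samplePerAgent s) ω).RunsWithin P q) ∧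
  ∀ (D : Fin m → Measure (Fin n → ℝ≥0)) [∀ a, IsProbabilityMeasure (D a)],
    ENNReal.ofReal γ * ∫⁻ r, (opt M r : ℝ≥0∞) ∂(Measure.pi D) ≤
      (m.factorial : ℝ≥0∞)⁻¹ * ∑ order : Equiv.Perm (Fin m),
        ∫⁻ z : (Profile n m × Profile n m) × (ℕ → unitInterval),
          ((Scenario.mk M k B order z.1.1 (samplePerAgent z.1.2) z.2).collected P : ℝ≥0∞)
          ∂(((Measure.pi D).prod (Measure.pi D)).prod coinLaw)

/-- Secretary model: arbitrary fixed weights, uniformly random order, no samples. -/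
def CompetitiveSecretary {n : ℕ} (M : Matroid (Fin n)) (k : ℕ) (B : Pair n → Pair n → Prop)
    (m : ℕ) (P : Prog) (q : Polynomial ℕ) (γ : ℝ) : Prop :=
  ∀ w : Profile n m,
    (∀ (order : Equiv.Perm (Fin m)) (ω : ℕ → unitInterval),
      (Scenario.mk M k B order w (fun _ => 0) ω).RunsWithin P q) ∧
    ENNReal.ofReal γ * (opt M w : ℝ≥0∞) ≤
      (m.factorial : ℝ≥0∞)⁻¹ * ∑ order : Equiv.Perm (Fin m),
        ∫⁻ ω, ((Scenario.mk M k B order w (fun _ => 0) ω).collected P : ℝ≥0∞) ∂coinLaw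

/-- The competitive ratio in the secretary model. -/
noncomputable def secretaryRatio (k : ℕ) : ℝ :=
  if k = 1 then (Real.exp 1)⁻¹ else (k : ℝ) ^ (-((k : ℝ) / ((k : ℝ) - 1)))

end OnlineAssignment

/-!
The three algorithms share one scheme. In round `t` an offline assignment problem with `m` agents is
solved to optimality, in which the agent that arrives is one of the agents. If `I` is the set of all
elements given away in this solution and `e` is the element of the arriving agent, then `(I, e)` is the
tentative certificate of the round, and `e` is accepted unless an earlier tentative certificate blocks
`(I, e)`, whether the earlier element was accepted or not. The accepted certificates do not block later
accepted ones, and certificates of the same element block each other, so the second property of a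
certifier makes the result feasible in every run (`Plan.feasible`).

The guarantees rest on an averaging argument (`prod_mul_sum_le`, `Plan.prod_mul_sum_offer_le`). The
solution of a round depends on the profile but not on the agent that arrives. Hence, given the profile
of round `r` and all that matters in the later rounds, the arriving agent of round `r` is uniformly
distributed on a set of some size `q`, and by directedness at most `k` of its members have an element
whose certificate blocks the one of round `t`. So the certificate of round `t` passes round `r` with
conditional probability at least `(q - k) / q`, and these factors multiply. The models differ in `q`
and in the expected value of the offline problems:

* IID: the arriving agent takes a random position among fresh samples, `q = m` in every round, and every
  offline problem is distributed as the original one. The sum over the rounds is geometric.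
* Prophet-secretary: agents that have not arrived are represented by their samples. For the analysis of
  round `t`, the weights and the samples of the agents arriving after round `t` are exchanged, which
  preserves the measure (`measurePreserving_exchange`). Then the agents that have arrived up to round
  `r` and the ones that arrive after round `t` are on an equal footing, and `q = m - t + r`.
* Secretary: only the agents that have arrived have nonzero weights, so `q = r + 1`; the offline problem
  of round `t` has expected value at least `(t + 1) / m` times the optimum (`sum_opt_arrived_ge`).
  The first `N` rounds are only observed. The machine picks the `N` with the best guaranteed weight
  `observeGain`. To see that this is large enough for every `m`, the best `N` is compared with a binomial
  one. The expected gain `G` is then a polynomial in the success probability `p` (`mixedGain`) that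
  satisfies the differential inequality `G' ≤ (k / p) G - m`, whence `G ≥ m p ^ k ∫ x ^ (-k)` with the
  integral from `p` to `1`; the optimal `p` gives the stated ratio.

The programs have to solve the offline problem in polynomial time with an independence oracle only. They
do so by a primal-dual method: agents enter one by one, and an agent that is looking for an element moves
along shortest sequences of tight exchanges, while prices and utilities change when no such sequence
exists. To give an agent nothing is represented by one of `m` additional free elements of weight zero,
so that every agent can be served. The invariant `Market.Valid` contains optimality, and an integer
potential bounds the number of steps independently of the weights (`Market.Valid.raise`,
`Market.Valid.advance`, `value_solve`). The theorem `exec_solve` shows that the program `solveProg`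
computes exactly this solution. Running times are bounded syntactically by polynomials
(`Prog.stepBound`), and the runs are measurable functions of the random data because every operation of
the machine is (`Prog.measurable_exec`).
-/

open scoped NNReal ENNReal

namespace OnlineAssignment
/-! ### Exchanges in a matroid -/

/-- In the set `H ∪ {f, f₂}`, let `e` be able to replace `f` and `e₂` be able to replace `f₂`. If `e`
cannot replace `f₂`, then both exchanges can be carried out together: `e` and `f` have the same span
over `H`, so that `f` may be replaced by `e` after the second exchange. -/
theorem indep_exchange_two {α : Type*} {N : Matroid α} (hE : N.E = Set.univ) {H : Set α}
    {f f₂ e e₂ : α} (h1 : N.Indep (insert e (insert f₂ H))) (h2 : N.Indep (insert e₂ (insert f H)))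
    (h3 : ¬ N.Indep (insert e (insert f H))) (hef₂ : e ∉ insert f₂ H) (he₂f : e₂ ∉ insert f H) :
    N.Indep (insert e₂ (insert e H)) := by
  have hf₂ : N.Indep (insert f₂ H) := h1.subset (Set.subset_insert _ _)
  have hf : N.Indep (insert f H) := h2.subset (Set.subset_insert _ _)
  have hH : N.Indep H := hf.subset (Set.subset_insert _ _)
  have he : e ∉ N.closure (insert f₂ H) := by
    have := (hf₂.insert_indep_iff_of_notMem hef₂).1 h1
    exact this.2
  have heH : e ∉ N.closure H := fun h => he (N.closure_subset_closure (Set.subset_insert _ _) h)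
  have hecl : e ∈ N.closure (insert f H) := by
    by_contra hc
    exact h3 ((hf.insert_indep_iff).2 (Or.inl ⟨by simp [hE], hc⟩))
  have hcl : N.closure (insert e H) = N.closure (insert f H) :=
    (N.closure_insert_congr ⟨hecl, heH⟩)
  have he₂ : e₂ ∉ N.closure (insert f H) := ((hf.insert_indep_iff_of_notMem he₂f).1 h2).2
  have heI : N.Indep (insert e H) := h1.subset (Set.insert_subset_insert (Set.subset_insert _ _))
  exact (heI.insert_indep_iff).2 (Or.inl ⟨by simp [hE], hcl ▸ he₂⟩)

/-- An exchange that stays within the span of an independent set does not affect the elements that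
can be added to this set. -/
theorem indep_insert_exchange {α : Type*} {N : Matroid α} (hE : N.E = Set.univ) {H : Set α}
    {f e e₂ : α} (h1 : N.Indep (insert e H)) (h2 : N.Indep (insert e₂ (insert f H)))
    (h3 : ¬ N.Indep (insert e (insert f H))) (heH : e ∉ H) (he₂f : e₂ ∉ insert f H) :
    N.Indep (insert e₂ (insert e H)) := by
  have hf : N.Indep (insert f H) := h2.subset (Set.subset_insert _ _)
  have hH : N.Indep H := hf.subset (Set.subset_insert _ _)
  have heH : e ∉ N.closure H := ((hH.insert_indep_iff_of_notMem heH).1 h1).2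
  have hecl : e ∈ N.closure (insert f H) := by
    by_contra hc
    exact h3 ((hf.insert_indep_iff).2 (Or.inl ⟨by simp [hE], hc⟩))
  have hcl : N.closure (insert e H) = N.closure (insert f H) :=
    (N.closure_insert_congr ⟨hecl, heH⟩)
  have he₂ : e₂ ∉ N.closure (insert f H) := ((hf.insert_indep_iff_of_notMem he₂f).1 h2).2
  exact (h1.insert_indep_iff).2 (Or.inl ⟨by simp [hE], hcl ▸ he₂⟩)

/-- An independent set that cannot be improved by adding or exchanging one element has maximum
weight among the independent subsets of `G`. For the proof, `J` is moved towards `I`: each element of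
`J` outside of `I` is dropped or replaced by an element of `I` that has at least the same weight. -/
theorem sum_le_of_local_max {α : Type*} [DecidableEq α] {N : Matroid α} (hE : N.E = Set.univ)
    (p : α → ℝ) {G I : Finset α} (hI : N.Indep (I : Set α)) (hpos : ∀ e ∈ I, 0 ≤ p e)
    (hadd : ∀ e ∈ G, e ∉ I → N.Indep (insert e (I : Set α)) → p e ≤ 0)
    (hexch : ∀ e ∈ G, e ∉ I → ¬ N.Indep (insert e (I : Set α)) → ∀ f ∈ I,
      N.Indep (insert e ((I : Set α) \ {f})) → p e ≤ p f)
    (J : Finset α) (hJG : J ⊆ G) (hJ : N.Indep (J : Set α)) : ∑ e ∈ J, p e ≤ ∑ e ∈ I, p e := by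
  suffices H : ∀ c, ∀ J : Finset α, (J \ I).card = c → J ⊆ G ∪ I → N.Indep (J : Set α) →
      ∑ e ∈ J, p e ≤ ∑ e ∈ I, p e from
    H _ J rfl (hJG.trans Finset.subset_union_left) hJ
  clear! J
  intro c
  induction c with
  | zero =>
    intro J hc _ _
    have : J ⊆ I := by simpa [Finset.sdiff_eq_empty_iff_subset] using hc
    exact Finset.sum_le_sum_of_subset_of_nonneg this fun e he _ => hpos e he
  | succ c ih =>
    intro J hc hJG hJ
    obtain ⟨e, he⟩ : (J \ I).Nonempty := by rw [← Finset.card_pos]; omega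
    obtain ⟨heJ, heI⟩ := Finset.mem_sdiff.1 he
    have heG : e ∈ G := by
      have := hJG heJ
      simpa [heI] using this
    have hJe : N.Indep ((J.erase e : Finset α) : Set α) :=
      hJ.subset (by simp)
    have hcard : ((J.erase e) \ I).card = c := by
      rw [Finset.erase_sdiff_comm, Finset.card_erase_of_mem he]; omega
    have hsum : ∑ x ∈ J.erase e, p x + p e = ∑ x ∈ J, p x := Finset.sum_erase_add _ _ heJ
    by_cases hIe : N.Indep (insert e (I : Set α))
    · have := ih (J.erase e) hcard ((Finset.erase_subset _ _).trans hJG) hJe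
      have := hadd e heG heI hIe
      linarith
    -- some element of the fundamental circuit of `e` lies outside the span of `J - e`
    have hecl : e ∈ N.closure (I : Set α) := by
      by_contra hcon
      exact hIe ((hI.insert_indep_iff).2 (Or.inl ⟨by simp [hE], hcon⟩))
    have heI' : e ∉ (I : Set α) := by simpa using heI
    have hC : N.IsCircuit (N.fundCircuit e I) := hI.fundCircuit_isCircuit hecl heI'
    have heC : e ∈ N.fundCircuit e I := N.mem_fundCircuit e I
    have hclC : e ∈ N.closure (N.fundCircuit e I \ {e}) := hC.mem_closure_sdiff_singleton_of_mem heC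
    obtain ⟨f, hfC, hfcl⟩ : ∃ f ∈ N.fundCircuit e I \ {e},
        f ∉ N.closure ((J.erase e : Finset α) : Set α) := by
      by_contra! hcon
      have h1 : e ∈ N.closure ((J.erase e : Finset α) : Set α) :=
        N.closure_subset_closure_of_subset_closure hcon hclC
      rw [Finset.coe_erase] at h1
      exact (hJ.notMem_closure_sdiff_of_mem (by simpa using heJ)) h1
    have hfI : f ∈ (I : Set α) := by
      have := N.fundCircuit_subset_insert e I hfC.1
      exact this.resolve_left hfC.2
    have hfI' : f ∈ I := by simpa using hfI
    have hfJ : f ∉ J.erase e := fun h =>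
      hfcl (N.mem_closure_of_mem (Finset.mem_coe.2 h) (by simp [hE]))
    have hexI : N.Indep (insert e ((I : Set α) \ {f})) := by
      have := (hI.mem_fundCircuit_iff hecl heI').1 hfC.1
      refine this.subset ?_
      rintro x (rfl | ⟨hx, hxf⟩)
      · exact ⟨Set.mem_insert _ _, fun h => hfC.2 (by simpa using h.symm)⟩
      · exact ⟨Set.mem_insert_of_mem _ hx, hxf⟩
    have hle := hexch e heG heI hIe f hfI' hexI
    have hJf : N.Indep ((insert f (J.erase e) : Finset α) : Set α) := by
      rw [Finset.coe_insert]
      exact (hJe.insert_indep_iff).2 (Or.inl ⟨by simp [hE], hfcl⟩)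
    have := ih (insert f (J.erase e)) (by
        rw [Finset.insert_sdiff_of_mem _ hfI', hcard]) (by
        intro x hx
        rcases Finset.mem_insert.1 hx with rfl | hx
        · exact Finset.mem_union_right _ hfI'
        · exact hJG (Finset.mem_of_mem_erase hx)) hJf
    rw [Finset.sum_insert hfJ] at this
    linarith

/-- The matroid on all natural numbers that extends a matroid on `Fin n` by free elements. -/
noncomputable def freeExtension {n : ℕ} (M : Matroid (Fin n)) : Matroid ℕ :=
  (M.map Fin.val Fin.val_injective.injOn).disjointSum (Matroid.freeOn {i | n ≤ i})
    (Set.disjoint_left.2 (by rintro _ ⟨x, -, rfl⟩ h; exact absurd x.2 (Nat.not_lt.2 h)))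

theorem freeExtension_ground {n : ℕ} (M : Matroid (Fin n)) (hM : M.E = Set.univ) :
    (freeExtension M).E = Set.univ := by
  rw [freeExtension, Matroid.disjointSum_ground_eq, Matroid.map_ground, hM, Set.eq_univ_iff_forall]
  intro i
  by_cases h : i < n
  · exact Or.inl ⟨⟨i, h⟩, trivial, rfl⟩
  · exact Or.inr (by simpa using h)

theorem freeExtension_indep_iff {n : ℕ} (M : Matroid (Fin n)) (hM : M.E = Set.univ) (S : Set ℕ) :
    (freeExtension M).Indep S ↔ M.Indep {e | (e : ℕ) ∈ S} := by
  have hS : S ⊆ (freeExtension M).E := by rw [freeExtension_ground M hM]; exact Set.subset_univ S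
  rw [freeExtension, Matroid.disjointSum_ground_eq] at hS
  rw [freeExtension, Matroid.disjointSum_indep_iff]
  have : S ∩ (M.map Fin.val Fin.val_injective.injOn).E = Fin.val '' {e : Fin n | (e : ℕ) ∈ S} := by
    ext i
    simp only [Matroid.map_ground, hM, Set.image_univ, Set.mem_inter_iff, Set.mem_range,
      Set.mem_image, Set.mem_ofPred_eq]
    constructor
    · rintro ⟨h, y, rfl⟩; exact ⟨y, h, rfl⟩
    · rintro ⟨y, h, rfl⟩; exact ⟨h, y, rfl⟩
  rw [this, Matroid.map_image_indep_iff (by rw [hM]; exact Set.subset_univ _)]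
  exact ⟨fun h => h.1, fun h => ⟨h, Matroid.freeOn_indep_iff.2 Set.inter_subset_right, hS⟩⟩

/-! ### The primal-dual method for optimal assignments -/

/-- The data of an offline assignment problem, in the form in which a program holds them: agents and
elements are natural numbers. The elements are the numbers below `size`, `Ind` is
the independence predicate and `wt a e` is the weight of the element `e` for the agent `a`. -/
structure Market where
  size : ℕ
  Ind : Finset ℕ → Prop
  wt : ℕ → ℕ → ℝ

/-- A state of the primal-dual method. The element `e` is held by the agent `own e - 1`, and by
nobody if `own e = 0`. The index `size` is not an element: its owner is the agent that is presently
looking for an element. The dual variables are the utilities of the agents and the prices of the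
elements. -/
@[ext]
structure Ledger where
  own : ℕ → ℕ
  util : ℕ → ℝ
  price : ℕ → ℝ

namespace Market

variable (D : Market) (σ : Ledger)

/-- The indices that have an owner, including the index `size` of the searching agent. -/
def held : Finset ℕ := (Finset.range (D.size + 1)).filter fun e => σ.own e ≠ 0

/-- The elements that have an owner. -/
def items : Finset ℕ := (Finset.range D.size).filter fun e => σ.own e ≠ 0

/-- The owner of `f` can be displaced in favour of a new owner of `e`. -/
def Exch (e f : ℕ) : Prop :=
  σ.own f ≠ 0 ∧ (σ.own e = 0 ∨ e = f) ∧ D.Ind (insert e ((D.held σ).erase f))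

/-- The distance from tightness of the move in which the owner of `f` makes room for a new owner
of `e` and turns to the element `e₂`. -/
def slack (e f e₂ : ℕ) : ℝ :=
  (σ.price f + σ.util (σ.own f - 1) + σ.price e₂) - (σ.price e + D.wt (σ.own f - 1) e₂)

/-- A tight move. Slacks are never negative in the course of the method. -/
def Edge (e f e₂ : ℕ) : Prop := D.Exch σ e f ∧ D.slack σ e f e₂ ≤ 0

/-- An element without owner that can be given away without displacing anybody. -/
def Addable (e : ℕ) : Prop := σ.own e = 0 ∧ D.Ind (insert e (D.held σ))

/-- From `e`, an addable element can be reached by at most `l` tight moves. -/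
def Reach : ℕ → ℕ → Prop
  | 0, e => D.Addable σ e
  | l + 1, e => Reach l e ∨
      ∃ f < D.size + 1, ∃ e₂ < D.size, D.Edge σ e f e₂ ∧ Reach l e₂

/-- Reachability by any number of moves; `size + 1` moves always suffice. -/
abbrev Reached (e : ℕ) : Prop := D.Reach σ (D.size + 1) e

open Classical in
/-- The least number of moves by which the searching agent reaches an addable element, counting the
numbers of moves that do not suffice. -/
noncomputable def level : ℕ :=
  ((Finset.range (D.size + 1)).filter fun l => ¬ D.Reach σ l D.size).card

end Market

open Classical in
/-- The successor of the last index below the bound that satisfies `Q`, and `0` if there is none. -/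
noncomputable def lastSat (Q : ℕ → Prop) : ℕ → ℕ
  | 0 => 0
  | c + 1 => if Q c then c + 1 else lastSat Q c

theorem lastSat_spec {Q : ℕ → Prop} {c : ℕ} (h : lastSat Q c ≠ 0) :
    lastSat Q c - 1 < c ∧ Q (lastSat Q c - 1) := by
  induction c with
  | zero => simp [lastSat] at h
  | succ c ih =>
    by_cases hc : Q c
    · simp [lastSat, hc]
    · simp only [lastSat, hc, if_false] at h ⊢
      exact ⟨(ih h).1.trans (Nat.lt_succ_self c), (ih h).2⟩

theorem lastSat_ne_zero {Q : ℕ → Prop} {c i : ℕ} (hi : i < c) (hQ : Q i) : lastSat Q c ≠ 0 := by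
  induction c with
  | zero => omega
  | succ c ih =>
    by_cases hc : Q c
    · simp [lastSat, hc]
    · simp only [lastSat, hc, if_false]
      have : i ≠ c := by rintro rfl; exact hc hQ
      exact ih (by omega)

namespace Market

variable (D : Market) (σ : Ledger)

/-- The element that the searching agent takes: the first one of a shortest sequence of moves. -/
noncomputable def taken : ℕ :=
  lastSat (fun e => D.Reach σ (D.level σ - 1) e ∧ D.Edge σ D.size D.size e) D.size - 1

/-- The successor of the index whose owner is displaced, and `0` if nobody is displaced. -/
noncomputable def displaced : ℕ :=
  if D.level σ < 2 then 0 else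
    lastSat (fun f => ∃ e₃ < D.size, D.Edge σ (D.taken σ) f e₃ ∧ D.Reach σ (D.level σ - 2) e₃)
      (D.size + 1)

/-- The searching agent takes an element, and the displaced agent becomes the searching one. -/
noncomputable def advance : Ledger where
  own :=
    let x := if D.displaced σ ≠ 0 then σ.own (D.displaced σ - 1) else 0
    let own₁ := if D.displaced σ ≠ 0 then Function.update σ.own (D.displaced σ - 1) 0 else σ.own
    Function.update (Function.update own₁ (D.taken σ) (own₁ D.size)) D.size x
  util := σ.util
  price := σ.price

/-- The smallest slack of a move into the set of reached elements. -/
noncomputable def gap : ℝ :=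
  sInf {v | ∃ e < D.size + 1, ∃ f < D.size + 1, ∃ e₂ < D.size,
    ¬ D.Reached σ e ∧ D.Exch σ e f ∧ D.Reached σ e₂ ∧ v = D.slack σ e f e₂}

open Classical in
/-- The prices of the elements that are not reached rise by the gap, and the utilities of their owners
drop by the gap. -/
noncomputable def raise : Ledger where
  own := σ.own
  util := fun a => if ∃ f < D.size + 1, σ.own f = a + 1 ∧ ¬ D.Reached σ f
    then σ.util a - D.gap σ else σ.util a
  price := fun e => if e < D.size + 1 ∧ ¬ D.Reached σ e then σ.price e + D.gap σ else σ.price e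

open Classical in
/-- One step of the primal-dual method: nothing is left to do if no agent is searching; if an addable
element can be reached, then the search proceeds along a shortest sequence of moves; otherwise the
dual variables change until a new move becomes tight. -/
noncomputable def step : Ledger :=
  if σ.own D.size = 0 then σ else if D.Reached σ D.size then D.advance σ else D.raise σ

/-- The initial state: no owners, zero prices, and utilities that dominate all weights. -/
noncomputable def start : Ledger :=
  ⟨fun _ => 0, fun a => ∑ e ∈ Finset.range D.size, D.wt a e, fun _ => 0⟩

/-- The agent `j` starts to look for an element. -/
def enter (j : ℕ) : Ledger := { σ with own := Function.update σ.own D.size (j + 1) }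

/-- The state after the first `j` agents have been served. The number of steps per agent bounds the
potential. -/
noncomputable def serve : ℕ → Ledger
  | 0 => D.start
  | j + 1 => (D.step)^[2 * D.size + 4] (D.enter (serve j) j)

/-- The invariants of the primal-dual method after `j` agents have been admitted, `m` being the
total number of agents: the dual solution is feasible, the assignment is tight for it, and the
elements given away have maximum price among all independent sets. -/
structure Valid (m j : ℕ) : Prop where
  inj : ∀ e < D.size + 1, ∀ f < D.size + 1, σ.own e ≠ 0 → σ.own e = σ.own f → e = f
  le : ∀ e < D.size + 1, σ.own e ≤ j
  cover : ∀ a < j, ∃ e < D.size + 1, σ.own e = a + 1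
  ind : D.Ind (D.items σ)
  dual : ∀ a < m, ∀ e < D.size, D.wt a e ≤ σ.util a + σ.price e
  tight : ∀ e < D.size, σ.own e ≠ 0 →
    σ.util (σ.own e - 1) + σ.price e ≤ D.wt (σ.own e - 1) e
  nonneg : ∀ e < D.size, 0 ≤ σ.price e
  best : ∀ J ⊆ Finset.range D.size, D.Ind J → ∑ e ∈ J, σ.price e ≤ ∑ e ∈ D.items σ, σ.price e

/-- The independent sets of a market are those of a matroid on the natural numbers in which all
numbers from `n` on are free; `m` of them are elements of the market, where they stand for the
possibility to give nothing to an agent. -/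
structure IsFree (N : Matroid ℕ) (n m : ℕ) : Prop where
  ground : N.E = Set.univ
  ind_iff : ∀ S : Finset ℕ, D.Ind S ↔ N.Indep (S : Set ℕ)
  free : ∀ e, n ≤ e → ∀ S, D.Ind S → D.Ind (insert e S)
  size_eq : D.size = n + m

end Market

/-- The potential that decreases with every step of the primal-dual method. While an addable element
can be reached, it is the number of moves that are needed; otherwise it counts the indices that are
not reached, and it exceeds every number of moves. -/
noncomputable def Market.potential (D : Market) (σ : Ledger) : ℕ :=
  open Classical in
  if σ.own D.size = 0 then 0 else if D.Reached σ D.size then D.level σ else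
    (D.size + 2) + (D.size + 1 - ((Finset.range (D.size + 1)).filter (D.Reached σ)).card)

section
variable {D : Market} {σ : Ledger} {N : Matroid ℕ} {n m j : ℕ}

namespace Market

theorem Reach.mono {l l' : ℕ} (h : l ≤ l') {e : ℕ} (hr : D.Reach σ l e) : D.Reach σ l' e := by
  induction h with
  | refl => exact hr
  | step _ ih => exact Or.inl ih

/-- The reached sets grow by at least one element per round until they are stable. -/
theorem reached_of_reach {l e : ℕ} (he : e < D.size + 1) (hr : D.Reach σ l e) : D.Reached σ e := by
  classical
  let R : ℕ → Finset ℕ := fun l => (Finset.range (D.size + 1)).filter (D.Reach σ l)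
  have hsub : ∀ l, R l ⊆ R (l + 1) := fun l x hx => by
    simp only [R, Finset.mem_filter] at hx ⊢
    exact ⟨hx.1, Or.inl hx.2⟩
  have hstab : ∀ l, R l = R (l + 1) → ∀ l', R l = R (l + l') := by
    intro l hl l'
    induction l' with
    | zero => rfl
    | succ l' ih =>
      rw [hl]
      ext x
      have key : ∀ y < D.size, D.Reach σ l y ↔ D.Reach σ (l + l') y := fun y hy => by
        have := congrArg (y ∈ ·) ih
        simpa [R, Nat.lt_succ_of_lt hy] using this
      simp only [R, Finset.mem_filter, and_congr_right_iff]
      intro hx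
      have hx0 : D.Reach σ l x ↔ D.Reach σ (l + l') x := by
        have := congrArg (x ∈ ·) ih
        simpa [R, Finset.mem_range.1 hx] using this
      change (D.Reach σ l x ∨ _) ↔ (D.Reach σ (l + l') x ∨ _)
      rw [hx0]
      refine or_congr Iff.rfl ?_
      constructor
      · rintro ⟨f, hf, e₂, he₂, h, hr⟩; exact ⟨f, hf, e₂, he₂, h, (key _ he₂).1 hr⟩
      · rintro ⟨f, hf, e₂, he₂, h, hr⟩; exact ⟨f, hf, e₂, he₂, h, (key _ he₂).2 hr⟩
  have hcard : ∀ l, (∃ i ≤ l, R i = R (i + 1)) ∨ l + 1 ≤ (R (l + 1)).card := by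
    intro l
    induction l with
    | zero =>
      by_cases h : R 0 = R 1
      · exact Or.inl ⟨0, le_rfl, h⟩
      · right
        have := Finset.card_lt_card ((hsub 0).ssubset_of_ne h)
        simp only [zero_add] at this ⊢
        omega
    | succ l ih =>
      rcases ih with ⟨i, hi, h⟩ | h
      · exact Or.inl ⟨i, by omega, h⟩
      · by_cases h' : R (l + 1) = R (l + 1 + 1)
        · exact Or.inl ⟨l + 1, le_rfl, h'⟩
        · right
          have := Finset.card_lt_card ((hsub (l + 1)).ssubset_of_ne h')
          omega
  have hmem : e ∈ R l := Finset.mem_filter.2 ⟨Finset.mem_range.2 he, hr⟩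
  suffices h : e ∈ R (D.size + 1) from (Finset.mem_filter.1 h).2
  rcases hcard D.size with ⟨i, hi, h⟩ | h
  · have hiR : R i ⊆ R (D.size + 1) := fun x hx => by
      rw [hstab i h (D.size + 1 - i)] at hx
      rwa [Nat.add_sub_cancel' (by omega)] at hx
    rcases le_total l i with hl | hl
    · exact hiR (by
        simp only [R, Finset.mem_filter] at hmem ⊢
        exact ⟨hmem.1, hmem.2.mono hl⟩)
    · apply hiR
      rw [hstab i h (l - i), Nat.add_sub_cancel' hl]
      exact hmem
  · have : R (D.size + 1) = Finset.range (D.size + 1) :=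
      Finset.eq_of_subset_of_card_le (Finset.filter_subset _ _) (by simpa using h)
    rw [this]
    exact Finset.mem_range.2 he

theorem level_spec (h : D.Reached σ D.size) :
    D.level σ ≤ D.size + 1 ∧ ∀ l, D.Reach σ l D.size ↔ D.level σ ≤ l := by
  classical
  have hex : ∃ l, D.Reach σ l D.size := ⟨_, h⟩
  obtain ⟨d, hle, hiff⟩ : ∃ d ≤ D.size + 1, ∀ l, D.Reach σ l D.size ↔ d ≤ l :=
    ⟨Nat.find hex, Nat.find_le h,
      fun l => ⟨fun hl => Nat.find_le hl, fun hl => (Nat.find_spec hex).mono hl⟩⟩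
  have : D.level σ = d := by
    have : (Finset.range (D.size + 1)).filter (fun l => ¬ D.Reach σ l D.size)
        = Finset.range d := by
      ext l
      simp only [Finset.mem_filter, Finset.mem_range, hiff]
      omega
    rw [level, this, Finset.card_range]
  rw [this]
  exact ⟨hle, hiff⟩

theorem IsFree.mono (hD : D.IsFree N n m) {S T : Finset ℕ} (h : S ⊆ T) (hT : D.Ind T) : D.Ind S :=
  (hD.ind_iff S).2 (((hD.ind_iff T).1 hT).subset (by exact_mod_cast h))

theorem IsFree.insert_iff (hD : D.IsFree N n m) {e : ℕ} (he : n ≤ e) (S : Finset ℕ) :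
    D.Ind (insert e S) ↔ D.Ind S :=
  ⟨hD.mono (Finset.subset_insert _ _), hD.free e he S⟩

/-- The index of the searching agent does not matter for independence. -/
theorem IsFree.held_erase_iff (hD : D.IsFree N n m) (e f : ℕ) :
    D.Ind (insert e ((D.held σ).erase f)) ↔ D.Ind (insert e ((D.items σ).erase f)) := by
  have hn : n ≤ D.size := by rw [hD.size_eq]; omega
  rw [← hD.insert_iff hn, ← hD.insert_iff hn (insert e ((D.items σ).erase f))]
  suffices h : insert D.size (insert e ((D.held σ).erase f))
      = insert D.size (insert e ((D.items σ).erase f)) by rw [h]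
  ext x
  simp only [held, items, Finset.mem_insert, Finset.mem_erase, Finset.mem_filter,
    Finset.mem_range]
  by_cases hx : x = D.size
  · exact iff_of_true (Or.inl hx) (Or.inl hx)
  · have : x < D.size + 1 ↔ x < D.size := by omega
    rw [this]

theorem IsFree.held_iff (hD : D.IsFree N n m) (e : ℕ) :
    D.Ind (insert e (D.held σ)) ↔ D.Ind (insert e (D.items σ)) := by
  have h1 : (D.held σ).erase (D.size + 1) = D.held σ :=
    Finset.erase_eq_of_notMem (by simp [held])
  have h2 : (D.items σ).erase (D.size + 1) = D.items σ :=
    Finset.erase_eq_of_notMem (by simp [items])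
  have := hD.held_erase_iff (σ := σ) e (D.size + 1)
  rwa [h1, h2] at this

/-- The searching agent holds no element, so that displacing it frees nothing. -/
theorem IsFree.exch_size (hD : D.IsFree N n m) {e : ℕ} (he : e < D.size)
    (h : D.Exch σ e D.size) : D.Addable σ e := by
  refine ⟨h.2.1.resolve_right he.ne, ?_⟩
  have h2 := h.2.2
  rw [hD.held_erase_iff] at h2
  rw [hD.held_iff]
  rwa [Finset.erase_eq_of_notMem (by simp [items])] at h2

theorem mem_items {e : ℕ} : e ∈ D.items σ ↔ e < D.size ∧ σ.own e ≠ 0 := by simp [items]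

theorem IsFree.exch_self (hD : D.IsFree N n m) (hv : D.Valid σ m j) {f : ℕ} (hf : f < D.size + 1)
    (h : σ.own f ≠ 0) : D.Exch σ f f := by
  refine ⟨h, Or.inr rfl, ?_⟩
  rw [Finset.insert_erase (by simp [held, hf, h])]
  have hn : n ≤ D.size := by rw [hD.size_eq]; omega
  refine hD.mono ?_ (hD.free D.size hn _ hv.ind)
  intro x hx
  simp only [held, Finset.mem_filter, Finset.mem_range] at hx
  simp only [Finset.mem_insert, mem_items]
  have := hx.2
  omega

theorem Valid.price_addable (hv : D.Valid σ m j) (hD : D.IsFree N n m) {e : ℕ} (he : e < D.size)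
    (h : D.Addable σ e) : σ.price e = 0 := by
  have h2 := (hD.held_iff e).1 h.2
  have hnot : e ∉ D.items σ := by simp [mem_items, h.1]
  have := hv.best (insert e (D.items σ)) (by
    intro x hx
    rcases Finset.mem_insert.1 hx with rfl | hx
    · exact Finset.mem_range.2 he
    · exact Finset.mem_range.2 (mem_items.1 hx).1) h2
  rw [Finset.sum_insert hnot] at this
  have := hv.nonneg e he
  linarith

theorem Valid.price_exch (hv : D.Valid σ m j) (hD : D.IsFree N n m) {e f : ℕ} (he : e < D.size)
    (hf : f < D.size) (h : D.Exch σ e f) : σ.price e ≤ σ.price f := by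
  rcases h.2.1 with h0 | rfl
  · have h2 := (hD.held_erase_iff e f).1 h.2.2
    have hfm : f ∈ D.items σ := mem_items.2 ⟨hf, h.1⟩
    have hnot : e ∉ (D.items σ).erase f := by simp [mem_items, h0]
    have := hv.best (insert e ((D.items σ).erase f)) (by
      intro x hx
      rcases Finset.mem_insert.1 hx with rfl | hx
      · exact Finset.mem_range.2 he
      · exact Finset.mem_range.2 (mem_items.1 (Finset.mem_of_mem_erase hx)).1) h2
    rw [Finset.sum_insert hnot] at this
    have h3 := Finset.sum_erase_add _ σ.price hfm
    linarith
  · exact le_rfl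

theorem Valid.dual_own (hv : D.Valid σ m j) (hj : j ≤ m) {f e : ℕ} (hf : f < D.size + 1)
    (h : σ.own f ≠ 0) (he : e < D.size) :
    D.wt (σ.own f - 1) e ≤ σ.util (σ.own f - 1) + σ.price e := by
  have := hv.le f hf
  exact hv.dual _ (by omega) e he

/-- The two parts of the slack of a move, the exchange and the new demand, are both
nonnegative; if the move is tight, then so are the parts. -/
theorem Valid.edge_spec (hv : D.Valid σ m j) (hD : D.IsFree N n m) (hj : j ≤ m) {e f e₂ : ℕ}
    (he : e < D.size + 1) (hf : f < D.size + 1) (he₂ : e₂ < D.size) (hadd : ¬ D.Addable σ e)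
    (h : D.Edge σ e f e₂) :
    (e = f ∨ e < D.size ∧ f < D.size) ∧ σ.price e = σ.price f ∧
      σ.util (σ.own f - 1) + σ.price e₂ = D.wt (σ.own f - 1) e₂ := by
  have hd := hv.dual_own hj hf h.1.1 he₂
  have hs := h.2
  rw [slack] at hs
  have hc : e = f ∨ e < D.size ∧ f < D.size := by
    by_cases hef : e = f
    · exact Or.inl hef
    right
    have h0 := h.1.2.1.resolve_right hef
    have hes : e < D.size := by
      by_contra hcon
      have hn : n ≤ D.size := by rw [hD.size_eq]; omega
      refine hadd ⟨h0, (hD.held_iff e).2 (hD.free e (by omega) _ hv.ind)⟩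
    refine ⟨hes, ?_⟩
    by_contra hcon
    have : f = D.size := by omega
    subst this
    exact hadd (hD.exch_size hes h.1)
  have hle : σ.price e ≤ σ.price f := by
    rcases hc with rfl | ⟨h1, h2⟩
    · exact le_rfl
    · exact hv.price_exch hD h1 h2 h.1
  exact ⟨hc, by linarith, by linarith⟩

/-- A held element is reached through its own owner. -/
theorem reach_held {l f : ℕ} (h : σ.own f ≠ 0) (hr : D.Reach σ l f) :
    ∃ l' < l, ∃ e₂ < D.size, D.Edge σ f f e₂ ∧ D.Reach σ l' e₂ := by
  induction l with
  | zero => exact absurd hr.1 h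
  | succ l ih =>
    rcases hr with hr | ⟨f', hf', e₂, he₂, hE, hr⟩
    · obtain ⟨l', hl', x⟩ := ih hr
      exact ⟨l', by omega, x⟩
    · have := hE.1.2.1.resolve_left h
      subst this
      exact ⟨l, by omega, e₂, he₂, hE, hr⟩

theorem reached_of_edge {e f e₂ : ℕ} (he : e < D.size + 1) (hf : f < D.size + 1)
    (he₂ : e₂ < D.size) (h : D.Edge σ e f e₂) (hr : D.Reached σ e₂) : D.Reached σ e :=
  reached_of_reach (l := D.size + 1 + 1) he (Or.inr ⟨f, hf, e₂, he₂, h, hr⟩)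

/-- While an agent is searching, one of the free elements of the market has no owner. -/
theorem Valid.exists_addable (hv : D.Valid σ m j) (hD : D.IsFree N n m) (hj : j ≤ m)
    (hs : σ.own D.size ≠ 0) : ∃ e < D.size, D.Addable σ e := by
  have hsz := hD.size_eq
  suffices h : ∃ e, n ≤ e ∧ e < D.size ∧ σ.own e = 0 by
    obtain ⟨e, he, hes, h0⟩ := h
    exact ⟨e, hes, h0, (hD.held_iff e).2 (hD.free e he _ hv.ind)⟩
  by_contra! hcon
  have hne : ∀ e ∈ Finset.Icc n D.size, σ.own e ≠ 0 := fun e he => by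
    rw [Finset.mem_Icc] at he
    rcases he.2.lt_or_eq with h | rfl
    · exact hcon e he.1 h
    · exact hs
  obtain ⟨x, hx, y, hy, hxy, h⟩ := Finset.exists_ne_map_eq_of_card_lt_of_maps_to
    (s := Finset.Icc n D.size) (t := Finset.Icc 1 m) (f := σ.own) (by simp; omega) (by
      intro e he
      have h1 := hne e (by simpa using he)
      have h2 := hv.le e (by simp at he; omega)
      simp only [Finset.coe_Icc, Set.mem_Icc]
      omega)
  rw [Finset.mem_Icc] at hx hy
  exact hxy (hv.inj x (by omega) y (by omega) (hne x (by simp; omega)) h)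

end Market
end

/-! ### Progress of the primal-dual method -/

section
variable {D : Market} {σ : Ledger} {N : Matroid ℕ} {n m j : ℕ}

namespace Market

/-- The gap is positive and attained: the move of the searching agent itself to an addable element is
among the moves over which the minimum is taken. -/
theorem gap_spec (hv : D.Valid σ m j) (hD : D.IsFree N n m) (hj : j ≤ m)
    (hs : σ.own D.size ≠ 0) (hr : ¬ D.Reached σ D.size) :
    0 < D.gap σ ∧ (∃ e < D.size + 1, ∃ f < D.size + 1, ∃ e₂ < D.size,
      ¬ D.Reached σ e ∧ D.Exch σ e f ∧ D.Reached σ e₂ ∧ D.gap σ = D.slack σ e f e₂) ∧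
    ∀ e < D.size + 1, ∀ f < D.size + 1, ∀ e₂ < D.size,
      ¬ D.Reached σ e → D.Exch σ e f → D.Reached σ e₂ → D.gap σ ≤ D.slack σ e f e₂ := by
  set S := {v | ∃ e < D.size + 1, ∃ f < D.size + 1, ∃ e₂ < D.size,
    ¬ D.Reached σ e ∧ D.Exch σ e f ∧ D.Reached σ e₂ ∧ v = D.slack σ e f e₂} with hS
  have hfin : S.Finite := by
    refine ((((Finset.range (D.size + 1)) ×ˢ (Finset.range (D.size + 1)) ×ˢ
      (Finset.range D.size)).image fun x => D.slack σ x.1 x.2.1 x.2.2).finite_toSet).subset ?_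
    rintro v ⟨e, he, f, hf, e₂, he₂, -, -, -, rfl⟩
    simp only [Finset.coe_image, Set.mem_image, Finset.mem_coe, Finset.mem_product,
      Finset.mem_range]
    exact ⟨(e, f, e₂), ⟨he, hf, he₂⟩, rfl⟩
  have hne : S.Nonempty := by
    obtain ⟨e, he, hadd⟩ := hv.exists_addable hD hj hs
    exact ⟨_, D.size, by omega, D.size, by omega, e, he, hr, hD.exch_self hv (by omega) hs,
      Reach.mono (Nat.zero_le _) hadd, rfl⟩
  have hmem : D.gap σ ∈ S := hne.csInf_mem hfin
  refine ⟨?_, hmem, ?_⟩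
  · obtain ⟨e, he, f, hf, e₂, he₂, h1, h2, h3, h4⟩ := hmem
    rw [h4]
    by_contra! hcon
    exact h1 (reached_of_edge he hf he₂ ⟨h2, hcon⟩ h3)
  · intro e he f hf e₂ he₂ h1 h2 h3
    exact csInf_le hfin.bddBelow ⟨e, he, f, hf, e₂, he₂, h1, h2, h3, rfl⟩

theorem util_raise_of_not_reached {f : ℕ} (hf : f < D.size + 1) (h : σ.own f ≠ 0)
    (hr : ¬ D.Reached σ f) :
    (D.raise σ).util (σ.own f - 1) = σ.util (σ.own f - 1) - D.gap σ := by
  rw [raise]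
  exact if_pos ⟨f, hf, by omega, hr⟩

theorem util_raise_of_reached (hv : D.Valid σ m j) {f : ℕ} (hf : f < D.size + 1)
    (h : σ.own f ≠ 0) (hr : D.Reached σ f) :
    (D.raise σ).util (σ.own f - 1) = σ.util (σ.own f - 1) := by
  rw [raise]
  refine if_neg ?_
  rintro ⟨f', hf', h', hr'⟩
  have := hv.inj f hf f' hf' h (by omega)
  subst this
  exact hr' hr

theorem price_raise_of_not_reached {e : ℕ} (he : e < D.size + 1) (hr : ¬ D.Reached σ e) :
    (D.raise σ).price e = σ.price e + D.gap σ := by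
  rw [raise]; exact if_pos ⟨he, hr⟩

theorem price_raise_of_reached {e : ℕ} (hr : D.Reached σ e) :
    (D.raise σ).price e = σ.price e := by
  rw [raise]; exact if_neg fun h => h.2 hr

theorem items_raise : D.items (D.raise σ) = D.items σ := rfl

/-- The change of the dual variables preserves the invariants. The prices remain maximal on the
elements given away because no exchange of these elements becomes profitable. -/
theorem Valid.raise (hv : D.Valid σ m j) (hD : D.IsFree N n m) (hj : j ≤ m)
    (hs : σ.own D.size ≠ 0) (hr : ¬ D.Reached σ D.size) : D.Valid (D.raise σ) m j := by
  classical
  obtain ⟨hpos, -, hgap⟩ := gap_spec hv hD hj hs hr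
  have hple : ∀ e, σ.price e ≤ (D.raise σ).price e := fun e => by
    rw [Market.raise]; dsimp only; split_ifs <;> linarith
  have hule : ∀ a, σ.util a - D.gap σ ≤ (D.raise σ).util a := fun a => by
    rw [Market.raise]; dsimp only; split_ifs <;> linarith
  refine ⟨hv.inj, hv.le, hv.cover, hv.ind, ?_, ?_, ?_, ?_⟩
  · intro a ha e he
    by_cases hre : D.Reached σ e
    · rw [price_raise_of_reached hre]
      by_cases hf : ∃ f < D.size + 1, σ.own f = a + 1 ∧ ¬ D.Reached σ f
      · obtain ⟨f, hf, hfa, hfr⟩ := hf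
        have hf0 : σ.own f ≠ 0 := by omega
        -- the utility of the agent drops, but not below the bound given by the move from `f` to `e`
        have h1 := hgap f hf f hf e he hfr (hD.exch_self hv hf hf0) hre
        have h2 := util_raise_of_not_reached hf hf0 hfr
        have ha : σ.own f - 1 = a := by omega
        rw [slack] at h1
        rw [ha] at h1 h2
        rw [h2]
        linarith
      · rw [Market.raise]
        simp only [hf, if_false]
        exact hv.dual a ha e he
    · rw [price_raise_of_not_reached (by omega) hre]
      have := hv.dual a ha e he
      have := hule a
      linarith
  · intro e he h0
    change σ.own e ≠ 0 at h0
    change (D.raise σ).util (σ.own e - 1) + (D.raise σ).price e ≤ D.wt (σ.own e - 1) e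
    have := hv.tight e he h0
    by_cases hre : D.Reached σ e
    · rw [price_raise_of_reached hre, util_raise_of_reached hv (by omega) h0 hre]
      exact this
    · rw [price_raise_of_not_reached (by omega) hre,
        util_raise_of_not_reached (by omega) h0 hre]
      linarith
  · intro e he
    exact (hv.nonneg e he).trans (hple e)
  · intro J hJ hJI
    rw [items_raise]
    refine sum_le_of_local_max hD.ground (D.raise σ).price (G := Finset.range D.size)
      ((hD.ind_iff _).1 hv.ind) (fun e he => (hv.nonneg e (mem_items.1 he).1).trans (hple e))
      ?_ ?_ J hJ ((hD.ind_iff _).1 hJI)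
    · intro e he heI hind
      have hes := Finset.mem_range.1 he
      have hadd : D.Addable σ e := by
        refine ⟨?_, (hD.held_iff e).2 ((hD.ind_iff _).2 (by simpa using hind))⟩
        by_contra h
        exact heI (mem_items.2 ⟨hes, h⟩)
      rw [price_raise_of_reached (Reach.mono (Nat.zero_le _) hadd)]
      exact (hv.price_addable hD hes hadd).le
    · intro e he heI hind f hf hexch
      have hes := Finset.mem_range.1 he
      obtain ⟨hfs, hf0⟩ := mem_items.1 hf
      have he0 : σ.own e = 0 := by
        by_contra h
        exact heI (mem_items.2 ⟨hes, h⟩)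
      have hE : D.Exch σ e f := by
        refine ⟨hf0, Or.inl he0, (hD.held_erase_iff e f).2 ((hD.ind_iff _).2 ?_)⟩
        rw [Finset.coe_insert, Finset.coe_erase]
        exact hexch
      have hle := hv.price_exch hD hes hfs hE
      by_cases hre : D.Reached σ e
      · rw [price_raise_of_reached hre]
        exact hle.trans (hple f)
      · rw [price_raise_of_not_reached (by omega) hre]
        by_cases hrf : D.Reached σ f
        -- compare the moves from `e` and from `f` that make the owner of `f` turn to `e₂`
        · obtain ⟨l', hl', e₂, he₂, hE₂, hr₂⟩ := reach_held hf0 hrf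
          have h1 := hgap e (by omega) f (by omega) e₂ he₂ hre hE (hr₂.mono hl'.le)
          have h2 := hE₂.2
          rw [price_raise_of_reached hrf]
          rw [slack] at h1 h2
          linarith
        · rw [price_raise_of_not_reached (by omega) hrf]
          linarith

/-- Tight moves among the reached elements remain tight when the dual variables change. -/
theorem Valid.reach_raise (hv : D.Valid σ m j) (hD : D.IsFree N n m) (hj : j ≤ m) {l e : ℕ}
    (he : e < D.size + 1) (h : D.Reach σ l e) : D.Reach (D.raise σ) l e := by
  induction l generalizing e with
  | zero => exact h
  | succ l ih =>
    by_cases hadd : D.Addable σ e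
    · exact Reach.mono (l := 0) (Nat.zero_le _) (show D.Addable (D.raise σ) e from hadd)
    rcases h with h | ⟨f, hf, e₂, he₂, hE, hr⟩
    · exact Or.inl (ih he h)
    · refine Or.inr ⟨f, hf, e₂, he₂, ⟨hE.1, ?_⟩, ih (by omega) hr⟩
      obtain ⟨hc, hp, hd⟩ := hv.edge_spec hD hj he hf he₂ hadd hE
      have hre : D.Reached σ e := reached_of_reach (l := l + 1) he (Or.inr ⟨f, hf, e₂, he₂, hE, hr⟩)
      have hre₂ : D.Reached σ e₂ := reached_of_reach (by omega) hr
      have hrf : D.Reached σ f := by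
        rcases hc with rfl | ⟨-, hfs⟩
        · exact hre
        · refine reached_of_edge hf hf he₂ ⟨hD.exch_self hv hf hE.1.1, ?_⟩ hre₂
          rw [slack]
          linarith
      change (D.raise σ).price f + (D.raise σ).util (σ.own f - 1) + (D.raise σ).price e₂ -
        ((D.raise σ).price e + D.wt (σ.own f - 1) e₂) ≤ 0
      rw [price_raise_of_reached hre, price_raise_of_reached hrf, price_raise_of_reached hre₂,
        util_raise_of_reached hv hf hE.1.1 hrf]
      exact hE.2

/-- When the dual variables change, a move that attains the gap becomes tight, so that a further index
is reached. -/
theorem Valid.potential_raise (hv : D.Valid σ m j) (hD : D.IsFree N n m) (hj : j ≤ m)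
    (hs : σ.own D.size ≠ 0) (hr : ¬ D.Reached σ D.size) :
    D.potential (D.raise σ) < D.potential σ := by
  classical
  obtain ⟨hpos, ⟨e, he, f, hf, e₂, he₂, hre, hE, hre₂, hg⟩, -⟩ := gap_spec hv hD hj hs hr
  have hE' : D.Edge (D.raise σ) e f e₂ := by
    refine ⟨hE, ?_⟩
    change (D.raise σ).price f + (D.raise σ).util (σ.own f - 1) + (D.raise σ).price e₂ -
        ((D.raise σ).price e + D.wt (σ.own f - 1) e₂) ≤ 0
    rw [price_raise_of_not_reached he hre, price_raise_of_reached hre₂]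
    rw [slack] at hg
    by_cases hrf : D.Reached σ f
    · rw [price_raise_of_reached hrf, util_raise_of_reached hv hf hE.1 hrf]
      linarith
    · rw [price_raise_of_not_reached hf hrf, util_raise_of_not_reached hf hE.1 hrf]
      linarith
  have hre' : D.Reached (D.raise σ) e :=
    reached_of_edge he hf he₂ hE' (hv.reach_raise hD hj (by omega) hre₂)
  have hlt : ((Finset.range (D.size + 1)).filter (D.Reached σ)).card <
      ((Finset.range (D.size + 1)).filter (D.Reached (D.raise σ))).card := by
    apply Finset.card_lt_card
    rw [Finset.ssubset_iff_of_subset]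
    · exact ⟨e, by simp [he, hre'], by simp [hre]⟩
    · intro x hx
      rw [Finset.mem_filter, Finset.mem_range] at hx ⊢
      exact ⟨hx.1, hv.reach_raise hD hj hx.1 hx.2⟩
  have hle : ((Finset.range (D.size + 1)).filter (D.Reached (D.raise σ))).card ≤ D.size + 1 := by
    simpa using Finset.card_filter_le (Finset.range (D.size + 1)) (D.Reached (D.raise σ))
  have hs' : (D.raise σ).own D.size ≠ 0 := hs
  rw [potential, potential, if_neg hs', if_neg hs, if_neg hr]
  split_ifs with h
  · have := (level_spec h).1
    omega
  · omega

/-- The outcome of an augmentation step: the searching agent takes the element `e`; either `e` was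
addable, or a displaced agent becomes the searching one. -/
theorem advance_spec (hr : D.Reached σ D.size)
    (hs : σ.own D.size ≠ 0) : ∃ e < D.size, D.Edge σ D.size D.size e ∧
      ((D.Addable σ e ∧ (D.advance σ).own =
          Function.update (Function.update σ.own e (σ.own D.size)) D.size 0) ∨
        2 ≤ D.level σ ∧ ¬ D.Reach σ (D.level σ - 2) e ∧ ∃ f < D.size + 1, ∃ e₃ < D.size,
          D.Edge σ e f e₃ ∧ D.Reach σ (D.level σ - 2) e₃ ∧
          (D.advance σ).own =
            (let own₁ := Function.update σ.own f 0
            Function.update (Function.update own₁ e (own₁ D.size)) D.size (σ.own f))) := by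
  obtain ⟨hle, hlev⟩ := level_spec hr
  have hself : D.Reach σ (D.level σ) D.size := (hlev _).2 le_rfl
  have hpos : D.level σ ≠ 0 := fun h => by
    rw [h] at hself
    exact hs hself.1
  obtain ⟨d, hd⟩ := Nat.exists_eq_succ_of_ne_zero hpos
  have hex : ∃ e < D.size, D.Edge σ D.size D.size e ∧ D.Reach σ d e := by
    rw [hd] at hself
    rcases hself with h | ⟨f, hf, e₂, he₂, hE, h⟩
    · rw [hlev] at h; omega
    · have := hE.1.2.1.resolve_left hs
      subst this
      exact ⟨e₂, he₂, hE, h⟩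
  have htaken : D.taken σ < D.size ∧ D.Reach σ d (D.taken σ) ∧
      D.Edge σ D.size D.size (D.taken σ) := by
    obtain ⟨e, he, hE, h⟩ := hex
    have hne : lastSat (fun e => D.Reach σ (D.level σ - 1) e ∧ D.Edge σ D.size D.size e) D.size
        ≠ 0 := lastSat_ne_zero he ⟨by rw [hd]; exact h, hE⟩
    have := lastSat_spec hne
    rw [hd] at this
    rw [taken, hd]
    exact ⟨this.1, this.2.1, this.2.2⟩
  refine ⟨D.taken σ, htaken.1, htaken.2.2, ?_⟩
  by_cases h2 : D.level σ < 2
  · have hd0 : d = 0 := by omega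
    subst hd0
    refine Or.inl ⟨htaken.2.1, ?_⟩
    rw [advance, displaced, if_pos h2]
    simp
  · have hnr : ¬ D.Reach σ (D.level σ - 2) (D.taken σ) := fun h => by
      have h3 : D.Reach σ (D.level σ - 2 + 1) D.size :=
        Or.inr ⟨D.size, by omega, _, htaken.1, htaken.2.2, h⟩
      rw [hlev] at h3
      omega
    refine Or.inr ⟨by omega, hnr, ?_⟩
    have hex₃ : ∃ f < D.size + 1, ∃ e₃ < D.size,
        D.Edge σ (D.taken σ) f e₃ ∧ D.Reach σ (D.level σ - 2) e₃ := by
      have h3 := htaken.2.1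
      have hd2 : d = (D.level σ - 2) + 1 := by omega
      rw [hd2] at h3
      rcases h3 with h3 | h3
      · exact absurd h3 hnr
      · obtain ⟨f, hf, e₃, he₃, h⟩ := h3
        exact ⟨f, hf, e₃, he₃, h⟩
    obtain ⟨f, hf, hf'⟩ := hex₃
    have hdisp : D.displaced σ = lastSat (fun f => ∃ e₃ < D.size,
        D.Edge σ (D.taken σ) f e₃ ∧ D.Reach σ (D.level σ - 2) e₃) (D.size + 1) := if_neg h2
    have hne : D.displaced σ ≠ 0 := by
      rw [hdisp]
      exact lastSat_ne_zero hf hf'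
    have hspec : D.displaced σ - 1 < D.size + 1 ∧ ∃ e₃ < D.size,
        D.Edge σ (D.taken σ) (D.displaced σ - 1) e₃ ∧ D.Reach σ (D.level σ - 2) e₃ := by
      rw [hdisp] at hne ⊢
      exact lastSat_spec hne
    obtain ⟨h4, e₃, he₃, hE, hr₃⟩ := hspec
    refine ⟨_, h4, e₃, he₃, hE, hr₃, ?_⟩
    rw [advance]
    simp only [if_pos hne]

/-- Each augmentation step either ends the search or brings the searching agent one move nearer to
an addable element, and it preserves the invariants. As a shortest sequence of moves is followed, the
exchange that is carried out leaves all later moves of the sequence intact. -/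
theorem Valid.advance (hv : D.Valid σ m j) (hD : D.IsFree N n m) (hj : j ≤ m)
    (hs : σ.own D.size ≠ 0) (hr : D.Reached σ D.size) :
    D.Valid (D.advance σ) m j ∧ D.potential (D.advance σ) < D.potential σ := by
  classical
  obtain ⟨e, he, hE, hcase⟩ := advance_spec hr hs
  have hutil : (D.advance σ).util = σ.util := rfl
  have hprice : (D.advance σ).price = σ.price := rfl
  have htight_e : σ.util (σ.own D.size - 1) + σ.price e ≤ D.wt (σ.own D.size - 1) e := by
    have := hE.2
    rw [slack] at this
    linarith
  have hpot : D.potential σ = D.level σ := by rw [potential, if_neg hs, if_pos hr]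
  have hlevpos : 0 < D.level σ := by
    rw [Nat.pos_iff_ne_zero]
    intro h
    have := (level_spec hr).2 0
    rw [h] at this
    exact hs (this.2 le_rfl).1
  rcases hcase with ⟨hadd, hown⟩ | ⟨h2, hnr, f, hf, e₃, he₃, hE₃, hr₃, hown⟩
  · have hval : ∀ x, (D.advance σ).own x =
        if x = D.size then 0 else if x = e then σ.own D.size else σ.own x := fun x => by
      rw [hown]
      by_cases h1 : x = D.size
      · simp [h1]
      · by_cases h2 : x = e <;> simp [h1, h2, Function.update_apply]
    have hitems : D.items (D.advance σ) = insert e (D.items σ) := by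
      ext x
      simp only [mem_items, Finset.mem_insert, hval]
      by_cases hxe : x = e
      · subst hxe; simp [he, he.ne, hs]
      · by_cases hxs : x = D.size <;> simp [hxe, hxs, he.ne']
    have hnot : e ∉ D.items σ := by simp [mem_items, hadd.1]
    refine ⟨⟨?_, ?_, ?_, ?_, hv.dual, ?_, hv.nonneg, ?_⟩, ?_⟩
    · intro x hx y hy h0 hxy
      rw [hval] at h0 hxy
      rw [hval y] at hxy
      have hi := hv.inj
      split_ifs at h0 hxy with h1 h2 h3 h4 h5 h6 h7
      all_goals first
        | omega
        | (have := hi x hx y hy h0 hxy; omega)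
        | (have := hi D.size (by omega) y hy h0 hxy; omega)
        | (have := hi x hx D.size (by omega) h0 hxy; omega)
    · intro x hx
      rw [hval]
      split_ifs
      · omega
      · exact hv.le _ (by omega)
      · exact hv.le x hx
    · intro a ha
      obtain ⟨x, hx, h⟩ := hv.cover a ha
      by_cases hxs : x = D.size
      · refine ⟨e, by omega, ?_⟩
        rw [hval, if_neg he.ne, if_pos rfl, ← hxs, h]
      · refine ⟨x, hx, ?_⟩
        have : x ≠ e := by rintro rfl; have := hadd.1; omega
        rw [hval, if_neg hxs, if_neg this, h]
    · rw [hitems]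
      exact (hD.held_iff e).1 hadd.2
    · intro x hx h0
      rw [hval] at h0 ⊢
      rw [hutil, hprice]
      by_cases hxe : x = e
      · subst hxe
        rw [if_neg he.ne, if_pos rfl]
        exact htight_e
      · rw [if_neg hx.ne, if_neg hxe] at h0 ⊢
        exact hv.tight x hx h0
    · intro J hJ hJI
      rw [hitems, hprice, Finset.sum_insert hnot, hv.price_addable hD he hadd, zero_add]
      exact hv.best J hJ hJI
    · rw [hpot, potential, if_pos (by rw [hval]; simp)]
      exact hlevpos
  · -- the element `e` is not addable, so that `f` is a proper element
    have hnadd : ¬ D.Addable σ e := fun h => hnr (Reach.mono (Nat.zero_le _) h)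
    obtain ⟨hc, hp, hd⟩ := hv.edge_spec hD hj (by omega) hf he₃ hnadd hE₃
    have hfs : f < D.size := by rcases hc with rfl | h; exacts [he, h.2]
    have hf0 := hE₃.1.1
    have hval : ∀ x, (D.advance σ).own x =
        if x = D.size then σ.own f else if x = e then σ.own D.size else
          if x = f then 0 else σ.own x := fun x => by
      rw [hown]
      dsimp only
      rw [Function.update_of_ne hfs.ne']
      simp only [Function.update_apply]
    have hitems : D.items (D.advance σ) = insert e ((D.items σ).erase f) := by
      ext x
      simp only [mem_items, Finset.mem_insert, Finset.mem_erase, hval]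
      by_cases hxe : x = e
      · subst hxe; simp [he, he.ne, hs]
      · by_cases hxs : x = D.size
        · simp [hxs, he.ne']
        · by_cases hxf : x = f
          · subst hxf; simp [hxe, hxs]
          · simp [hxe, hxs, hxf]
    have hfm : f ∈ D.items σ := mem_items.2 ⟨hfs, hf0⟩
    have hnot : e ∉ (D.items σ).erase f := by
      rcases hE₃.1.2.1 with h | h
      · simp [mem_items, h]
      · simp [h]
    have hsum : ∑ x ∈ insert e ((D.items σ).erase f), σ.price x = ∑ x ∈ D.items σ, σ.price x := by
      rw [Finset.sum_insert hnot, hp, Finset.add_sum_erase _ _ hfm]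
    have hsize' : (D.advance σ).own D.size = σ.own f := by rw [hval, if_pos rfl]
    have hv' : D.Valid (D.advance σ) m j := by
      refine ⟨?_, ?_, ?_, ?_, hv.dual, ?_, hv.nonneg, ?_⟩
      · intro x hx y hy h0 hxy
        rw [hval] at h0 hxy
        rw [hval y] at hxy
        have hi := hv.inj
        have hfL : f < D.size + 1 := hf
        split_ifs at h0 hxy
        all_goals first
          | omega
          | (have := hi x hx y hy h0 hxy; omega)
          | (have := hi D.size (by omega) y hy h0 hxy; omega)
          | (have := hi x hx D.size (by omega) h0 hxy; omega)
          | (have := hi f hfL y hy h0 hxy; omega)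
          | (have := hi x hx f hfL h0 hxy; omega)
          | (have := hi f hfL D.size (by omega) h0 hxy; omega)
          | (have := hi D.size (by omega) f hfL h0 hxy; omega)
      · intro x hx
        rw [hval]
        split_ifs
        · exact hv.le _ (by omega)
        · exact hv.le _ (by omega)
        · omega
        · exact hv.le x hx
      · intro a ha
        obtain ⟨x, hx, h⟩ := hv.cover a ha
        by_cases hxs : x = D.size
        · refine ⟨e, by omega, ?_⟩
          rw [hval, if_neg he.ne, if_pos rfl, ← hxs, h]
        by_cases hxf : x = f
        · refine ⟨D.size, by omega, ?_⟩
          rw [hsize', ← hxf, h]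
        · refine ⟨x, hx, ?_⟩
          have : x ≠ e := by
            rintro rfl
            rcases hE₃.1.2.1 with h' | h'
            · omega
            · exact hxf h'
          rw [hval, if_neg hxs, if_neg this, if_neg hxf, h]
      · rw [hitems]
        exact (hD.held_erase_iff e f).1 hE₃.1.2.2
      · intro x hx h0
        rw [hval] at h0 ⊢
        rw [hutil, hprice]
        by_cases hxe : x = e
        · subst hxe
          rw [if_neg he.ne, if_pos rfl]
          exact htight_e
        · rw [if_neg hx.ne, if_neg hxe] at h0 ⊢
          by_cases hxf : x = f
          · rw [if_pos hxf] at h0; exact absurd rfl h0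
          · rw [if_neg hxf] at h0 ⊢
            exact hv.tight x hx h0
      · intro J hJ hJI
        rw [hitems, hprice, hsum]
        exact hv.best J hJ hJI
    refine ⟨hv', ?_⟩
    -- everything within distance `level - 2` stays within that distance
    have hkeep : ∀ l, l ≤ D.level σ - 2 → ∀ x < D.size, D.Reach σ l x →
        D.Reach (D.advance σ) l x := by
      intro l
      induction l with
      | zero =>
        intro hl x hx hrx
        have hxe : x ≠ e := by rintro rfl; exact hnadd hrx
        have hx0 := hrx.1
        have hxf : x ≠ f := by rintro rfl; exact hf0 hx0
        refine ⟨?_, ?_⟩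
        · rw [hval, if_neg hx.ne, if_neg hxe, if_neg hxf, hx0]
        rw [hD.held_iff, hitems]
        by_cases hef : e = f
        · rw [hef, Finset.insert_erase hfm]
          exact (hD.held_iff x).1 hrx.2
        have he0 := hE₃.1.2.1.resolve_right hef
        rw [hD.ind_iff, Finset.coe_insert, Finset.coe_insert, Finset.coe_erase]
        have hins : insert f ((D.items σ : Set ℕ) \ {f}) = (D.items σ : Set ℕ) := by
          rw [Set.insert_sdiff_singleton, Set.insert_eq_of_mem (by exact_mod_cast hfm)]
        refine indep_insert_exchange hD.ground (f := f) ?_ ?_ ?_ ?_ ?_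
        · have := (hD.held_erase_iff e f).1 hE₃.1.2.2
          rwa [hD.ind_iff, Finset.coe_insert, Finset.coe_erase] at this
        · rw [hins, ← Finset.coe_insert, ← hD.ind_iff]
          exact (hD.held_iff x).1 hrx.2
        · rw [hins, ← Finset.coe_insert, ← hD.ind_iff]
          exact fun h => hnadd ⟨he0, (hD.held_iff e).2 h⟩
        · simp [mem_items, he0]
        · rw [hins]
          simp [mem_items, hx0]
      | succ l ih =>
        intro hl x hx hrx
        rcases hrx with hrx | ⟨f₂, hf₂, e₂, he₂, hE₂, hr₂⟩
        · exact Or.inl (ih (by omega) x hx hrx)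
        by_cases hxadd : D.Addable σ x
        · exact Or.inl (ih (by omega) x hx (Reach.mono (Nat.zero_le _) hxadd))
        obtain ⟨hc₂, hp₂, hd₂⟩ := hv.edge_spec hD hj (by omega) hf₂ he₂ hxadd hE₂
        have hf₂s : f₂ < D.size := by rcases hc₂ with h | h; exacts [h ▸ hx, h.2]
        -- a tight move from `e` to `e₂` would put `e` within distance `level - 2`
        have hno : ∀ g < D.size + 1, D.Exch σ e g → σ.own g = σ.own f₂ →
            σ.price e < σ.price g := by
          intro g hg hEg hgo
          have hgs : g < D.size := by
            by_contra hcon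
            have : g = D.size := by omega
            subst this
            exact hnadd (hD.exch_size he hEg)
          have hle := hv.price_exch hD he hgs hEg
          refine lt_of_le_of_ne hle fun heq => hnr ?_
          refine Reach.mono hl (Or.inr ⟨g, hg, e₂, he₂, ⟨hEg, ?_⟩, hr₂⟩)
          rw [slack, hgo]
          linarith
        have hf₂f : f₂ ≠ f := by
          rintro rfl
          exact (hno f₂ hf hE₃.1 rfl).ne hp
        have hxe : x ≠ e := by
          rintro rfl
          exact (hno f₂ hf₂ hE₂.1 rfl).ne hp₂
        have hf₂e : f₂ ≠ e := by
          rintro rfl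
          rcases hE₃.1.2.1 with h | h
          · exact hE₂.1.1 h
          · exact hf₂f h
        have hownf₂ : (D.advance σ).own f₂ = σ.own f₂ := by
          rw [hval, if_neg hf₂s.ne, if_neg hf₂e, if_neg hf₂f]
        have hxf : σ.own x = 0 → x ≠ f := fun h0 => by rintro rfl; exact hf0 h0
        refine Or.inr ⟨f₂, hf₂, e₂, he₂, ⟨⟨?_, ?_, ?_⟩, ?_⟩, ih (by omega) e₂ he₂ hr₂⟩
        · rw [hownf₂]; exact hE₂.1.1
        · rcases hE₂.1.2.1 with h0 | h0
          · left
            rw [hval, if_neg hx.ne, if_neg hxe, if_neg (hxf h0), h0]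
          · exact Or.inr h0
        · by_cases hxf₂ : x = f₂
          · subst hxf₂
            exact (hD.exch_self hv' hf₂ (by rw [hownf₂]; exact hE₂.1.1)).2.2
          have hx0 := hE₂.1.2.1.resolve_right hxf₂
          have hI₂ := (hD.held_erase_iff x f₂).1 hE₂.1.2.2
          rw [hD.held_erase_iff, hitems]
          by_cases hef : e = f
          · rw [hef, Finset.insert_erase hfm]
            exact hI₂
          have he0 := hE₃.1.2.1.resolve_right hef
          have hI₁ := (hD.held_erase_iff e f).1 hE₃.1.2.2
          rw [Finset.erase_insert_of_ne hf₂e.symm, Finset.erase_right_comm]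
          set H := ((D.items σ).erase f₂).erase f with hH
          have hf₂m : f₂ ∈ D.items σ := mem_items.2 ⟨hf₂s, hE₂.1.1⟩
          have hi₁ : (D.items σ).erase f₂ = insert f H :=
            (Finset.insert_erase (Finset.mem_erase.2 ⟨hf₂f.symm, hfm⟩)).symm
          have hi₂ : (D.items σ).erase f = insert f₂ H := by
            rw [hH, Finset.erase_right_comm]
            exact (Finset.insert_erase (Finset.mem_erase.2 ⟨hf₂f, hf₂m⟩)).symm
          rw [hi₁] at hI₂
          rw [hi₂] at hI₁
          have hnx : ∀ g : Finset ℕ, g ⊆ D.items σ → x ∉ (g : Set ℕ) ∧ e ∉ (g : Set ℕ) := by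
            intro g hg
            constructor
            · intro h; exact (mem_items.1 (hg (by simpa using h))).2 hx0
            · intro h; exact (mem_items.1 (hg (by simpa using h))).2 he0
          have hs₁ : insert f H ⊆ D.items σ := hi₁ ▸ Finset.erase_subset _ _
          have hs₂ : insert f₂ H ⊆ D.items σ := hi₂ ▸ Finset.erase_subset _ _
          rw [hD.ind_iff] at hI₁ hI₂
          push_cast at hI₁ hI₂
          rw [hD.ind_iff]
          push_cast
          -- Two exchanges are compatible as soon as one of the crossed exchanges is impossible. If
          -- `e` can replace `f₂`, then `f₂` is more expensive than `e`, so `x` cannot replace `f`.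
          by_cases hex : D.Exch σ e f₂
          · have hlt := hno f₂ hf₂ hex rfl
            have hnx' : ¬ N.Indep (insert x (insert f₂ (H : Set ℕ))) := by
              intro hcon
              have : D.Exch σ x f := by
                refine ⟨hf0, Or.inl hx0, (hD.held_erase_iff x f).2 ?_⟩
                rw [hi₂, hD.ind_iff]
                push_cast
                exact hcon
              have := hv.price_exch hD hx hfs this
              linarith
            rw [Set.insert_comm]
            refine indep_exchange_two hD.ground hI₂ hI₁ hnx' ?_ ?_
            · have := (hnx _ hs₁).1; push_cast at this; exact this
            · have := (hnx _ hs₂).2; push_cast at this; exact this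
          · have hne' : ¬ N.Indep (insert e (insert f (H : Set ℕ))) := by
              intro hcon
              refine hex ⟨hE₂.1.1, Or.inl he0, (hD.held_erase_iff e f₂).2 ?_⟩
              rw [hi₁, hD.ind_iff]
              push_cast
              exact hcon
            refine indep_exchange_two hD.ground hI₁ hI₂ hne' ?_ ?_
            · have := (hnx _ hs₂).2; push_cast at this; exact this
            · have := (hnx _ hs₁).1; push_cast at this; exact this
        · rw [slack, hownf₂]
          exact hE₂.2
    have hs' : (D.advance σ).own D.size ≠ 0 := by rw [hsize']; exact hf0
    have hreach : D.Reach (D.advance σ) (D.level σ - 2 + 1) D.size := by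
      refine Or.inr ⟨D.size, by omega, e₃, he₃, ⟨hD.exch_self hv' (by omega) hs', ?_⟩,
        hkeep _ le_rfl e₃ he₃ hr₃⟩
      rw [slack, hsize', hutil, hprice]
      linarith
    have hr' : D.Reached (D.advance σ) D.size := reached_of_reach (by omega) hreach
    rw [hpot, potential, if_neg hs', if_pos hr']
    have := ((level_spec hr').2 _).1 hreach
    omega

end Market
end

/-! ### The offline optimum -/

section
variable {D : Market} {σ : Ledger} {N : Matroid ℕ} {n m j : ℕ}

namespace Market

theorem Valid.step (hv : D.Valid σ m j) (hD : D.IsFree N n m) (hj : j ≤ m) :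
    D.Valid (D.step σ) m j ∧ D.potential (D.step σ) ≤ D.potential σ - 1 := by
  rw [Market.step]
  split_ifs with h1 h2
  · exact ⟨hv, by simp [potential, h1]⟩
  · have := hv.advance hD hj h1 h2
    exact ⟨this.1, by omega⟩
  · have := hv.potential_raise hD hj h1 h2
    exact ⟨hv.raise hD hj h1 h2, by omega⟩

theorem Valid.iterate_step (hv : D.Valid σ m j) (hD : D.IsFree N n m) (hj : j ≤ m) (c : ℕ) :
    D.Valid (D.step^[c] σ) m j ∧ D.potential (D.step^[c] σ) ≤ D.potential σ - c := by
  induction c with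
  | zero => exact ⟨hv, by simp⟩
  | succ c ih =>
    rw [Function.iterate_succ_apply']
    have := ih.1.step hD hj
    exact ⟨this.1, by omega⟩

/-- If the potential vanishes, then no agent is searching. -/
theorem own_size_eq_zero_of_potential (h : D.potential σ = 0) : σ.own D.size = 0 := by
  classical
  by_contra hs
  rw [potential, if_neg hs] at h
  split_ifs at h with hr
  · have := (level_spec hr).2 0
    rw [h] at this
    exact hs (this.2 le_rfl).1
  · omega

theorem potential_le : D.potential σ ≤ 2 * D.size + 4 := by
  classical
  rw [potential]
  split_ifs with _ hr
  · omega
  · have := (level_spec hr).1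
    omega
  · omega

theorem Valid.enter (hv : D.Valid σ m j) (hj : j < m) (hs : σ.own D.size = 0) :
    D.Valid (D.enter σ j) m (j + 1) := by
  have hne : ∀ e, e ≠ D.size → (D.enter σ j).own e = σ.own e := fun e he =>
    Function.update_of_ne he _ _
  have heq : (D.enter σ j).own D.size = j + 1 := Function.update_self ..
  have hitems : D.items (D.enter σ j) = D.items σ := by
    ext x
    simp only [mem_items]
    refine and_congr_right fun hx => ?_
    rw [hne x hx.ne]
  refine ⟨?_, ?_, ?_, ?_, hv.dual, ?_, hv.nonneg, ?_⟩
  · intro e he f hf h0 h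
    by_cases h1 : e = D.size
    · by_cases h2 : f = D.size
      · rw [h1, h2]
      · rw [h1, heq, hne f h2] at h
        have := hv.le f hf
        omega
    · by_cases h2 : f = D.size
      · rw [h2, heq, hne e h1] at h
        have := hv.le e he
        omega
      · rw [hne e h1] at h0 h
        rw [hne f h2] at h
        exact hv.inj e he f hf h0 h
  · intro e he
    by_cases h1 : e = D.size
    · rw [h1, heq]
    · rw [hne e h1]
      exact (hv.le e he).trans (Nat.le_succ _)
  · intro a ha
    rcases Nat.lt_succ_iff_lt_or_eq.1 ha with h | rfl
    · obtain ⟨e, he, h'⟩ := hv.cover a h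
      refine ⟨e, he, ?_⟩
      rw [hne e, h']
      rintro rfl
      omega
    · exact ⟨D.size, by omega, heq⟩
  · rw [hitems]; exact hv.ind
  · intro e he h0
    rw [hne e he.ne] at h0 ⊢
    exact hv.tight e he h0
  · intro J hJ hJI
    rw [hitems]
    exact hv.best J hJ hJI

theorem valid_start (hD : D.IsFree N n m) (hw : ∀ a e, 0 ≤ D.wt a e) : D.Valid D.start m 0 := by
  have hitems : D.items D.start = ∅ := by
    ext x
    simp [mem_items, start]
  refine ⟨fun e _ f _ h => absurd rfl h, fun _ _ => le_rfl, fun a ha => absurd ha (by omega),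
    ?_, ?_, fun e _ h => absurd rfl h, fun _ _ => le_rfl, ?_⟩
  · rw [hitems, hD.ind_iff]
    simp
  · intro a _ e he
    change D.wt a e ≤ ∑ e ∈ Finset.range D.size, D.wt a e + 0
    rw [add_zero]
    exact Finset.single_le_sum (f := D.wt a) (fun x _ => hw a x) (Finset.mem_range.2 he)
  · intro J _ _
    simp [start]

theorem valid_serve (hD : D.IsFree N n m) (hw : ∀ a e, 0 ≤ D.wt a e) (hj : j ≤ m) :
    D.Valid (D.serve j) m j ∧ (D.serve j).own D.size = 0 := by
  induction j with
  | zero => exact ⟨valid_start hD hw, rfl⟩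
  | succ j ih =>
    obtain ⟨h1, h2⟩ := ih (by omega)
    have h3 := (h1.enter (by omega) h2).iterate_step hD hj (2 * D.size + 4)
    have h4 : D.potential (D.enter (D.serve j) j) ≤ 2 * D.size + 4 := potential_le
    refine ⟨h3.1, own_size_eq_zero_of_potential ?_⟩
    exact Nat.eq_zero_of_le_zero (h3.2.trans (by omega))

end Market

open Classical in
/-- The offline problem of a weight profile. Besides the elements of the matroid there is one free
element of weight zero per agent. -/
noncomputable def market (M : Matroid (Fin n)) (X : Profile n m) : Market where
  size := n + m
  Ind := fun S => M.Indep ((Finset.univ.filter fun e : Fin n => (e : ℕ) ∈ S : Finset (Fin n)) :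
    Set (Fin n))
  wt := fun a e => if h : a < m ∧ e < n then X ⟨a, h.1⟩ ⟨e, h.2⟩ else 0

theorem market_isFree (M : Matroid (Fin n)) (hM : M.E = Set.univ) (X : Profile n m) :
    (market M X).IsFree (freeExtension M) n m := by
  refine ⟨freeExtension_ground M hM, fun S => ?_, fun e he S hS => ?_, rfl⟩
  · rw [freeExtension_indep_iff M hM]
    simp [market]
  · simp only [market] at hS ⊢
    convert hS using 2
    ext x
    simp only [Finset.mem_insert]
    have : (x : ℕ) ≠ e := by omega
    simp [this]

theorem market_wt_nonneg (M : Matroid (Fin n)) (X : Profile n m) (a e : ℕ) :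
    0 ≤ (market M X).wt a e := by
  simp only [market]
  split_ifs
  · exact NNReal.coe_nonneg _
  · exact le_rfl

/-- The final owners in the primal-dual method. -/
noncomputable def finalOwn (M : Matroid (Fin n)) (X : Profile n m) : ℕ → ℕ :=
  ((market M X).serve m).own

open Classical in
/-- The optimal assignment that the primal-dual method finds. An agent that holds one of the free
elements gets `⊥`. -/
noncomputable def solve (M : Matroid (Fin n)) (X : Profile n m) : Assignment n m := fun a =>
  if h : ∃ e : Fin n, finalOwn M X e = a + 1 then some h.choose else none

variable {M : Matroid (Fin n)} {X : Profile n m}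

theorem solve_eq_some_iff (hM : M.E = Set.univ) {a : Fin m} {e : Fin n} :
    solve M X a = some e ↔ finalOwn M X e = a + 1 := by
  have hv := (Market.valid_serve (market_isFree M hM X) (market_wt_nonneg M X) le_rfl).1
  have key : ∀ e f : Fin n, finalOwn M X e = a + 1 → finalOwn M X f = a + 1 → e = f := by
    intro e f he hf
    have hsz : (market M X).size = n + m := rfl
    refine Fin.ext (hv.inj e (by omega) f (by omega) ?_ (he.trans hf.symm))
    change finalOwn M X e ≠ 0
    omega
  rw [solve]
  constructor
  · intro h
    split_ifs at h with h'
    rw [← Option.some.inj h]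
    exact h'.choose_spec
  · intro h
    have h' : ∃ e : Fin n, finalOwn M X e = a + 1 := ⟨e, h⟩
    rw [dif_pos h']
    exact congrArg some (key _ _ h'.choose_spec h)

theorem finalOwn_ne_zero_iff (hM : M.E = Set.univ) {e : Fin n} :
    finalOwn M X e ≠ 0 ↔ ∃ a, solve M X a = some e := by
  have hv := (Market.valid_serve (market_isFree M hM X) (market_wt_nonneg M X) le_rfl).1
  have hsz : (market M X).size = n + m := rfl
  have hle : finalOwn M X e ≤ m := hv.le e (by omega)
  constructor
  · intro h
    exact ⟨⟨finalOwn M X e - 1, by omega⟩, (solve_eq_some_iff hM).2 (by simp; omega)⟩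
  · rintro ⟨a, h⟩
    have := (solve_eq_some_iff hM).1 h
    omega

theorem solve_feasible (hM : M.E = Set.univ) : Feasible M (solve M X) := by
  have hv := (Market.valid_serve (market_isFree M hM X) (market_wt_nonneg M X) le_rfl).1
  have hsz : (market M X).size = n + m := rfl
  constructor
  · intro a a' hne h
    by_contra hcon
    obtain ⟨e, he⟩ := Option.ne_none_iff_exists'.1 hcon
    have h1 := (solve_eq_some_iff hM).1 he
    have h2 := (solve_eq_some_iff hM).1 (h ▸ he)
    exact hne (Fin.ext (by omega))
  · refine Matroid.Indep.subset hv.ind ?_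
    rintro e ⟨a, ha⟩
    have := (finalOwn_ne_zero_iff hM).2 ⟨a, ha⟩
    simp only [Finset.coe_filter, Finset.mem_univ, true_and, Set.mem_ofPred_eq,
      Market.mem_items]
    exact ⟨by omega, this⟩

theorem weightOf_solve (hM : M.E = Set.univ) (a : Fin m) {f : ℕ} (hf : f < n + m)
    (h : finalOwn M X f = a + 1) :
    (weightOf (X a) (solve M X a) : ℝ) = (market M X).wt a f := by
  have hv := (Market.valid_serve (market_isFree M hM X) (market_wt_nonneg M X) le_rfl).1
  by_cases hfn : f < n
  · rw [(solve_eq_some_iff hM (e := ⟨f, hfn⟩)).2 h]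
    simp [weightOf, market, hfn]
  · have : solve M X a = none := by
      by_contra hcon
      obtain ⟨e, he⟩ := Option.ne_none_iff_exists'.1 hcon
      have h1 := (solve_eq_some_iff hM).1 he
      have hsz : (market M X).size = n + m := rfl
      have := hv.inj e (by omega) f (by omega) (by change finalOwn M X e ≠ 0; omega)
        (h1.trans h.symm)
      omega
    rw [this]
    simp [weightOf, market, hfn]

/-- Optimality follows from the dual solution: the weight of any assignment is at most the sum of
the utilities and of the prices of the elements given away. -/
theorem value_le_value_solve (hM : M.E = Set.univ) (A : Assignment n m) (hA : Feasible M A) :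
    value X A ≤ value X (solve M X) := by
  have hD := market_isFree M hM X
  obtain ⟨hv, hs⟩ := Market.valid_serve hD (market_wt_nonneg M X) le_rfl
  set D := market M X with hDdef
  set σ := D.serve m with hσ
  have hsz : D.size = n + m := rfl
  have hcov : ∀ a : Fin m, ∃ e, e < D.size ∧ σ.own e = a + 1 := fun a => by
    obtain ⟨e, he, h⟩ := hv.cover a a.2
    refine ⟨e, ?_, h⟩
    by_contra hcon
    have : e = D.size := by omega
    rw [this, hs] at h
    omega
  choose g hg hown using hcov
  have ginj : Function.Injective g := fun a a' h => by
    have h1 := hown a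
    rw [h, hown a'] at h1
    exact Fin.ext (by omega)
  have himg : Finset.univ.image g = D.items σ := by
    ext e
    simp only [Finset.mem_image, Finset.mem_univ, true_and, Market.mem_items]
    constructor
    · rintro ⟨a, rfl⟩
      exact ⟨hg a, by rw [hown]; omega⟩
    · rintro ⟨he, h0⟩
      have := hv.le e (by omega)
      refine ⟨⟨σ.own e - 1, by omega⟩, ?_⟩
      exact hv.inj _ (by have := hg ⟨σ.own e - 1, by omega⟩; omega) _ (by omega)
        (by rw [hown]; omega) (by rw [hown]; simp only; omega)
  -- the free element with number `n + a` represents `⊥` for the agent `a`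
  let b : Fin m → ℕ := fun a => match A a with
    | some e => e
    | none => n + a
  have hbs : ∀ a e, A a = some e → b a = e := fun a e h => by simp only [b, h]
  have hbn : ∀ a, A a = none → b a = n + a := fun a h => by simp only [b, h]
  have hb : ∀ a, b a < D.size := fun a => by
    rcases h : A a with _ | e
    · rw [hbn a h]; omega
    · rw [hbs a e h]; omega
  have hbw : ∀ a, (weightOf (X a) (A a) : ℝ) = D.wt a (b a) := fun a => by
    rcases h : A a with _ | e
    · rw [hbn a h]; simp [weightOf, hDdef, market]
    · rw [hbs a e h]; simp [weightOf, hDdef, market]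
  have binj : Function.Injective b := fun a a' h => by
    by_contra hne
    rcases h1 : A a with _ | e <;> rcases h2 : A a' with _ | e'
    · rw [hbn a h1, hbn a' h2] at h
      exact hne (Fin.ext (by omega))
    · rw [hbn a h1, hbs a' e' h2] at h; omega
    · rw [hbs a e h1, hbn a' h2] at h; omega
    · rw [hbs a e h1, hbs a' e' h2] at h
      have := hA.1 a a' hne (by rw [h1, h2, Fin.ext h])
      rw [h1] at this
      cases this
  have hJ : D.Ind (Finset.univ.image b) := by
    change M.Indep _
    convert hA.2 using 1
    ext e
    simp only [Finset.coe_filter, Finset.mem_univ, true_and, Finset.mem_image,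
      Set.mem_ofPred_eq]
    refine exists_congr fun a => ?_
    rcases h : A a with _ | e'
    · rw [hbn a h]
      simp only [reduceCtorEq, iff_false]
      omega
    · rw [hbs a e' h]
      simp [Fin.ext_iff]
  have hbest := hv.best _ (fun x hx => by
    obtain ⟨a, -, rfl⟩ := Finset.mem_image.1 hx
    exact Finset.mem_range.2 (hb a)) hJ
  rw [← himg, Finset.sum_image fun _ _ _ _ h => binj h,
    Finset.sum_image fun _ _ _ _ h => ginj h] at hbest
  -- weak duality for the given assignment, complementary slackness for the one of the method
  have h1 : ∑ a : Fin m, D.wt a (b a) ≤ ∑ a : Fin m, (σ.util a + σ.price (b a)) :=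
    Finset.sum_le_sum fun a _ => hv.dual a a.2 _ (hb a)
  have h2 : ∑ a : Fin m, (σ.util a + σ.price (g a)) ≤ ∑ a : Fin m, D.wt a (g a) := by
    refine Finset.sum_le_sum fun a _ => ?_
    have := hv.tight (g a) (hg a) (by rw [hown]; omega)
    rwa [hown] at this
  rw [Finset.sum_add_distrib] at h1 h2
  rw [← NNReal.coe_le_coe, value, value]
  push_cast
  rw [Finset.sum_congr rfl fun a _ => hbw a,
    Finset.sum_congr rfl fun a _ => weightOf_solve hM a (hg a) (hown a)]
  linarith

theorem value_solve (hM : M.E = Set.univ) : value X (solve M X) = opt M X := by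
  classical
  refine le_antisymm ?_ ?_
  · exact Finset.le_sup (f := value X)
      (Finset.mem_filter.2 ⟨Finset.mem_univ _, solve_feasible hM⟩)
  · refine Finset.sup_le fun A hA => ?_
    exact value_le_value_solve hM A (Finset.mem_filter.1 hA).2

theorem value_le_opt {A : Assignment n m} (hA : Feasible M A) : value X A ≤ opt M X := by
  classical
  exact Finset.le_sup (f := value X) (Finset.mem_filter.2 ⟨Finset.mem_univ _, hA⟩)

end

/-! ### Reasoning about programs -/

section
variable {n : ℕ} {V : View n}

@[simp] theorem Store.nat_setNat_self (s : Store) (x i j v i' j' : ℕ) :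
    (s.setNat x i j v).nat x i' j' = if i' = i ∧ j' = j then v else s.nat x i' j' := by
  simp [Store.setNat]

theorem Store.nat_setNat_of_ne (s : Store) {x y : ℕ} (i j v : ℕ) (h : y ≠ x) :
    (s.setNat x i j v).nat y = s.nat y := by
  funext i' j'
  simp [Store.setNat, h]

@[simp] theorem Store.real_setNat (s : Store) (x i j v : ℕ) :
    (s.setNat x i j v).real = s.real := rfl

@[simp] theorem Store.real_setReal_self (s : Store) (x i j : ℕ) (v : ℝ) (i' j' : ℕ) :
    (s.setReal x i j v).real x i' j' = if i' = i ∧ j' = j then v else s.real x i' j' := by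
  simp [Store.setReal]

theorem Store.real_setReal_of_ne (s : Store) {x y : ℕ} (i j : ℕ) (v : ℝ) (h : y ≠ x) :
    (s.setReal x i j v).real y = s.real y := by
  funext i' j'
  simp [Store.setReal, h]

@[simp] theorem Store.nat_setReal (s : Store) (x i j : ℕ) (v : ℝ) :
    (s.setReal x i j v).nat = s.nat := rfl

/-- The arrays of natural numbers that a program writes. -/
def Prog.natWrites : Prog → List ℕ
  | .skip => []
  | .setNat x _ _ _ => [x]
  | .setReal _ _ _ _ => []
  | .seq p q => p.natWrites ++ q.natWrites
  | .ite _ p q => p.natWrites ++ q.natWrites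
  | .loop x _ p => x :: p.natWrites

/-- The arrays of real numbers that a program writes. -/
def Prog.realWrites : Prog → List ℕ
  | .skip => []
  | .setNat _ _ _ _ => []
  | .setReal x _ _ _ => [x]
  | .seq p q => p.realWrites ++ q.realWrites
  | .ite _ p q => p.realWrites ++ q.realWrites
  | .loop _ _ p => p.realWrites

/-- A relation that is respected by every pass through the body holds after a loop. -/
theorem iterate_induction {f : ℕ → Store → Store} {s : Store} (Inv : ℕ → Store → Prop) {c : ℕ}
    (h0 : Inv 0 s) (hstep : ∀ i < c, ∀ t, Inv i t → Inv (i + 1) (f i t)) :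
    Inv c (iterate f c s) := by
  induction c with
  | zero => exact h0
  | succ c ih =>
    exact hstep c (Nat.lt_succ_self c) _ (ih fun i hi => hstep i (hi.trans (Nat.lt_succ_self c)))

theorem Prog.nat_exec (P : Prog) {x : ℕ} (hx : x ∉ P.natWrites) (s : Store) :
    (P.exec V s).nat x = s.nat x := by
  induction P generalizing s with
  | skip => rfl
  | setNat y i j a =>
    exact Store.nat_setNat_of_ne _ _ _ _ (by simpa [natWrites] using hx)
  | setReal => rfl
  | seq p q ihp ihq =>
    simp only [natWrites, List.mem_append, not_or] at hx
    rw [exec, ihq hx.2, ihp hx.1]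
  | ite a p q ihp ihq =>
    simp only [natWrites, List.mem_append, not_or] at hx
    rw [exec]
    split_ifs
    · exact ihp hx.1 s
    · exact ihq hx.2 s
  | loop y a p ih =>
    simp only [natWrites, List.mem_cons, not_or] at hx
    rw [exec]
    refine iterate_induction (fun _ t => t.nat x = s.nat x) rfl fun i _ t ht => ?_
    rw [ih hx.2, Store.nat_setNat_of_ne _ _ _ _ hx.1, ht]

theorem Prog.real_exec (P : Prog) {x : ℕ} (hx : x ∉ P.realWrites) (s : Store) :
    (P.exec V s).real x = s.real x := by
  induction P generalizing s with
  | skip => rfl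
  | setNat => rfl
  | setReal y i j a =>
    exact Store.real_setReal_of_ne _ _ _ _ (by simpa [realWrites] using hx)
  | seq p q ihp ihq =>
    simp only [realWrites, List.mem_append, not_or] at hx
    rw [exec, ihq hx.2, ihp hx.1]
  | ite a p q ihp ihq =>
    simp only [realWrites, List.mem_append, not_or] at hx
    rw [exec]
    split_ifs
    · exact ihp hx.1 s
    · exact ihq hx.2 s
  | loop y a p ih =>
    simp only [realWrites] at hx
    rw [exec]
    refine iterate_induction (fun _ t => t.real x = s.real x) rfl fun i _ t ht => ?_
    rw [ih hx, Store.real_setNat, ht]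

/-! ### Running times -/

open Polynomial in
/-- A polynomial bound for an expression that does not depend on the memory. -/
noncomputable def Exp.sizeBound : {t : Ty} → Exp t → Option (Polynomial ℕ)
  | _, .lit c => some (C c)
  | _, .numElements => some X
  | _, .numAgents => some X
  | _, .add a b => do return (← a.sizeBound) + (← b.sizeBound)
  | _, _ => none

open Polynomial in
/-- A polynomial bound for the number of steps of a program all of whose loops have bounds that do
not depend on the memory. The variable stands for the number of elements plus the number of agents. -/
noncomputable def Prog.stepBound : Prog → Option (Polynomial ℕ)
  | .skip => some 1
  | .setNat _ _ _ _ => some 1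
  | .setReal _ _ _ _ => some 1
  | .seq p q => do return (← p.stepBound) + (← q.stepBound)
  | .ite _ p q => do return 1 + ((← p.stepBound) + (← q.stepBound))
  | .loop _ a p => do return 1 + (← a.sizeBound) * (1 + (← p.stepBound))

theorem Exp.eval_le_sizeBound (s : Store) {t : Ty} (a : Exp t) :
    match t, a with
    | .nat, a => ∀ B ∈ a.sizeBound, (a.eval V s : ℕ) ≤ B.eval (n + V.numAgents)
    | .real, _ => True := by
  induction a with
  | lit c =>
    intro B hB
    simp only [sizeBound, Option.mem_def, Option.some.injEq] at hB
    subst hB; simp [eval]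
  | numElements =>
    intro B hB
    simp only [sizeBound, Option.mem_def, Option.some.injEq] at hB
    subst hB; simp [eval]
  | numAgents =>
    intro B hB
    simp only [sizeBound, Option.mem_def, Option.some.injEq] at hB
    subst hB; simp [eval]
  | add a b iha ihb =>
    intro B hB
    simp only [sizeBound, Option.mem_def, Option.bind_eq_bind, Option.bind_eq_some_iff,
      Option.pure_def, Option.some.injEq] at hB
    obtain ⟨Ba, ha, Bb, hb, rfl⟩ := hB
    rw [Polynomial.eval_add]
    exact Nat.add_le_add (iha Ba ha) (ihb Bb hb)
  | _ => first | trivial | (intro B hB; simp [sizeBound] at hB)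

theorem Prog.steps_le_stepBound (P : Prog) (s : Store) {B : Polynomial ℕ} (hB : B ∈ P.stepBound) :
    P.steps V s ≤ B.eval (n + V.numAgents) := by
  induction P generalizing s B with
  | skip => simp only [stepBound, Option.mem_def, Option.some.injEq] at hB; subst hB; simp [steps]
  | setNat =>
    simp only [stepBound, Option.mem_def, Option.some.injEq] at hB; subst hB; simp [steps]
  | setReal =>
    simp only [stepBound, Option.mem_def, Option.some.injEq] at hB; subst hB; simp [steps]
  | seq p q ihp ihq =>
    simp only [stepBound, Option.mem_def, Option.bind_eq_bind, Option.bind_eq_some_iff,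
      Option.pure_def, Option.some.injEq] at hB
    obtain ⟨Bp, hp, Bq, hq, rfl⟩ := hB
    rw [Polynomial.eval_add]
    exact Nat.add_le_add (ihp _ hp) (ihq _ hq)
  | ite a p q ihp ihq =>
    simp only [stepBound, Option.mem_def, Option.bind_eq_bind, Option.bind_eq_some_iff,
      Option.pure_def, Option.some.injEq] at hB
    obtain ⟨Bp, hp, Bq, hq, rfl⟩ := hB
    have h1 := ihp s hp
    have h2 := ihq s hq
    simp only [steps, Polynomial.eval_add, Polynomial.eval_one]
    split_ifs <;> omega
  | loop x a p ih =>
    simp only [stepBound, Option.mem_def, Option.bind_eq_bind, Option.bind_eq_some_iff,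
      Option.pure_def, Option.some.injEq] at hB
    obtain ⟨Ba, ha, Bp, hp, rfl⟩ := hB
    have h1 : (a.eval V s : ℕ) ≤ _ := Exp.eval_le_sizeBound s a Ba ha
    simp only [steps, Polynomial.eval_add, Polynomial.eval_one, Polynomial.eval_mul]
    refine Nat.add_le_add_left ?_ 1
    refine (Finset.sum_le_card_nsmul _ _ (1 + Bp.eval (n + V.numAgents)) fun c _ =>
      Nat.add_le_add_left (ih _ hp) 1).trans ?_
    rw [Finset.card_range, smul_eq_mul]
    exact Nat.mul_le_mul_right _ h1

end

/-! ### Measurability of runs -/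

section
variable {n : ℕ} {Z : Type*} [MeasurableSpace Z]

/-- A family of stores all of whose cells are measurable. -/
structure Store.IsMeasurable (s : Z → Store) : Prop where
  nat : ∀ x i j, Measurable fun z => (s z).nat x i j
  real : ∀ x i j, Measurable fun z => (s z).real x i j

/-- A family of views in which only weights, samples and random numbers vary, and these are
measurable. -/
structure View.IsMeasurable (V : Z → View n) : Prop where
  const : ∃ V₀ : View n, ∀ z, (V z).numAgents = V₀.numAgents ∧ (V z).param = V₀.param ∧
    (V z).indep = V₀.indep ∧ (V z).blocks = V₀.blocks ∧ (V z).round = V₀.round ∧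
    (V z).agent = V₀.agent
  samples : ∀ i e, Measurable fun z => (V z).samples i e
  coins : ∀ i, Measurable fun z => (V z).coins i
  weight : ∀ e, Measurable fun z => (V z).weight e

theorem measurable_apply_countable {ι β : Type*} [Countable ι] [MeasurableSpace ι]
    [MeasurableSingletonClass ι] [MeasurableSpace β] {f : ι → Z → β} (hf : ∀ i, Measurable (f i))
    {g : Z → ι} (hg : Measurable g) : Measurable fun z => f (g z) z := by
  have : Measurable fun q : ι × Z => f q.1 q.2 := measurable_from_prod_countable_right hf
  exact this.comp (hg.prodMk measurable_id)

theorem Store.IsMeasurable.row {s : Z → Store} (hs : Store.IsMeasurable s) {x : ℕ} {i : Z → ℕ}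
    (hi : Measurable i) (S : Set (Finset (Fin n))) :
    MeasurableSet {z | (s z).row n x (i z) ∈ S} := by
  have hT : Measurable fun z (e : Fin n) => (s z).nat x (i z) e :=
    measurable_pi_lambda _ fun e =>
      measurable_apply_countable (f := fun k z => (s z).nat x k e) (fun k => hs.nat x k e) hi
  have hS : MeasurableSet {r : Fin n → ℕ | (Finset.univ.filter fun e => r e ≠ 0) ∈ S} :=
    (Set.to_countable _).measurableSet
  exact hT hS

theorem measurable_ite_nat {p : Z → Prop} [∀ z, Decidable (p z)] (hp : MeasurableSet {z | p z}) :
    Measurable fun z => if p z then (1 : ℕ) else 0 :=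
  Measurable.ite hp measurable_const measurable_const

theorem Exp.measurable_eval {V : Z → View n} (hV : View.IsMeasurable V) {s : Z → Store}
    (hs : Store.IsMeasurable s) {t : Ty} (a : Exp t) :
    match t, a with
    | .nat, a => Measurable fun z => (a.eval (V z) (s z) : ℕ)
    | .real, u => Measurable fun z => (u.eval (V z) (s z) : ℝ) := by
  classical
  obtain ⟨V₀, h0⟩ := hV.const
  induction a with
  | lit c => exact measurable_const
  | readNat x i j hi hj =>
    exact measurable_apply_countable (f := fun k z => (s z).nat x k (j.eval (V z) (s z)))
      (fun k => measurable_apply_countable (f := fun l z => (s z).nat x k l)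
        (fun l => hs.nat x k l) hj) hi
  | add a b ha hb => exact Measurable.add ha hb
  | sub a b ha hb => exact Measurable.sub ha hb
  | le a b ha hb => exact measurable_ite_nat (measurableSet_le ha hb)
  | leReal u v hu hv => exact measurable_ite_nat (measurableSet_le hu hv)
  | numElements => exact measurable_const
  | numAgents => simp only [eval, (h0 _).1]; exact measurable_const
  | param => simp only [eval, (h0 _).2.1]; exact measurable_const
  | round => simp only [eval, (h0 _).2.2.2.2.1]; exact measurable_const
  | agent => simp only [eval, (h0 _).2.2.2.2.2]; exact measurable_const
  | indep x i hi =>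
    simp only [eval, (h0 _).2.2.1]
    refine measurable_ite_nat ?_
    exact hs.row (x := x) hi {I | V₀.indep I}
  | blocks x i e y j f hi he hj hf =>
    simp only [eval, (h0 _).2.2.2.1]
    have h1 := hs.row (n := n) (x := x) hi
    have h2 := hs.row (n := n) (x := y) hj
    refine measurable_ite_nat ?_
    simp only [Set.ofPred_exists]
    refine MeasurableSet.iUnion fun e' => MeasurableSet.iUnion fun f' => ?_
    have e1 := measurableSet_eq_fun (measurable_const (a := (e' : ℕ))) he
    have e2 := measurableSet_eq_fun (measurable_const (a := (f' : ℕ))) hf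
    have e3 : MeasurableSet {z | V₀.blocks ((s z).row n x (i.eval (V z) (s z)), e')
        ((s z).row n y (j.eval (V z) (s z)), f')} := by
      have : {z | V₀.blocks ((s z).row n x (i.eval (V z) (s z)), e')
          ((s z).row n y (j.eval (V z) (s z)), f')} =
          ⋃ I : Finset (Fin n), {z | (s z).row n x (i.eval (V z) (s z)) = I} ∩
            {z | (s z).row n y (j.eval (V z) (s z)) ∈ {J | V₀.blocks (I, e') (J, f')}} := by
        ext z; simp
      rw [this]
      exact MeasurableSet.iUnion fun I =>
        (h1 {I}).inter (h2 {J | V₀.blocks (I, e') (J, f')})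
    exact e1.inter (e2.inter e3)
  | readReal x i j hi hj =>
    exact measurable_apply_countable (f := fun k z => (s z).real x k (j.eval (V z) (s z)))
      (fun k => measurable_apply_countable (f := fun l z => (s z).real x k l)
        (fun l => hs.real x k l) hj) hi
  | cast a ha =>
    exact (measurable_from_nat (f := fun k : ℕ => (k : ℝ))).comp ha
  | addReal u v hu hv => exact Measurable.add hu hv
  | subReal u v hu hv => exact Measurable.sub hu hv
  | mulReal u v hu hv => exact Measurable.mul hu hv
  | divReal u v hu hv => exact Measurable.div hu hv
  | weight e he =>
    refine measurable_apply_countable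
      (f := fun k z => if h : k < n then ((V z).weight ⟨k, h⟩ : ℝ) else 0) (fun k => ?_) he
    split_ifs with h
    · exact (hV.weight _).coe_nnreal_real
    · exact measurable_const
  | sample i e hi he =>
    refine measurable_apply_countable
      (f := fun k z => if h : (e.eval (V z) (s z) : ℕ) < n then
        ((V z).samples k ⟨e.eval (V z) (s z), h⟩ : ℝ) else 0) (fun k => ?_) hi
    refine measurable_apply_countable
      (f := fun l z => if h : l < n then ((V z).samples k ⟨l, h⟩ : ℝ) else 0) (fun l => ?_) he
    split_ifs with h
    · exact (hV.samples _ _).coe_nnreal_real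
    · exact measurable_const
  | coin i hi =>
    exact measurable_apply_countable (f := fun k z => ((V z).coins k : ℝ))
      (fun k => measurable_subtype_coe.comp (hV.coins k)) hi

theorem Store.IsMeasurable.setNat {s : Z → Store} (hs : Store.IsMeasurable s) (x : ℕ)
    {i j v : Z → ℕ} (hi : Measurable i) (hj : Measurable j) (hv : Measurable v) :
    Store.IsMeasurable fun z => (s z).setNat x (i z) (j z) (v z) := by
  refine ⟨fun y i' j' => ?_, hs.real⟩
  simp only [Store.setNat]
  refine Measurable.ite ?_ hv (hs.nat y i' j')
  exact (MeasurableSet.const _).inter ((measurableSet_eq_fun measurable_const hi).inter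
    (measurableSet_eq_fun measurable_const hj))

theorem Store.IsMeasurable.setReal {s : Z → Store} (hs : Store.IsMeasurable s) (x : ℕ)
    {i j : Z → ℕ} {v : Z → ℝ} (hi : Measurable i) (hj : Measurable j) (hv : Measurable v) :
    Store.IsMeasurable fun z => (s z).setReal x (i z) (j z) (v z) := by
  refine ⟨hs.nat, fun y i' j' => ?_⟩
  simp only [Store.setReal]
  refine Measurable.ite ?_ hv (hs.real y i' j')
  exact (MeasurableSet.const _).inter ((measurableSet_eq_fun measurable_const hi).inter
    (measurableSet_eq_fun measurable_const hj))

/-- Programs preserve measurability of the memory. -/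
theorem Prog.measurable_exec {V : Z → View n} (hV : View.IsMeasurable V) (P : Prog)
    {s : Z → Store} (hs : Store.IsMeasurable s) :
    Store.IsMeasurable fun z => P.exec (V z) (s z) := by
  induction P generalizing s with
  | skip => exact hs
  | setNat x i j a =>
    exact hs.setNat x (i.measurable_eval hV hs) (j.measurable_eval hV hs) (a.measurable_eval hV hs)
  | setReal x i j u =>
    exact hs.setReal x (i.measurable_eval hV hs) (j.measurable_eval hV hs)
      (u.measurable_eval hV hs)
  | seq p q ihp ihq => exact ihq (ihp hs)
  | ite a p q ihp ihq =>
    have ha : Measurable fun z => (a.eval (V z) (s z) : ℕ) := a.measurable_eval hV hs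
    have hm : MeasurableSet {z | (a.eval (V z) (s z) : ℕ) ≠ 0} :=
      (measurableSet_eq_fun ha measurable_const).compl
    constructor
    · intro x i j
      simp only [exec, apply_ite Store.nat, ite_apply]
      exact Measurable.ite hm ((ihp hs).nat x i j) ((ihq hs).nat x i j)
    · intro x i j
      simp only [exec, apply_ite Store.real, ite_apply]
      exact Measurable.ite hm ((ihp hs).real x i j) ((ihq hs).real x i j)
  | loop x a p ih =>
    have ha : Measurable fun z => (a.eval (V z) (s z) : ℕ) := a.measurable_eval hV hs
    have hc : ∀ c, Store.IsMeasurable fun z =>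
        iterate (fun i s' => p.exec (V z) (s'.setNat x 0 0 i)) c (s z) := by
      intro c
      induction c with
      | zero => exact hs
      | succ c ihc =>
        exact ih (ihc.setNat x measurable_const measurable_const measurable_const)
    exact ⟨fun y i j => measurable_apply_countable
        (f := fun c z => (iterate (fun i s' => p.exec (V z) (s'.setNat x 0 0 i)) c (s z)).nat y i j)
        (fun c => (hc c).nat y i j) ha,
      fun y i j => measurable_apply_countable
        (f := fun c z => (iterate (fun i s' => p.exec (V z) (s'.setNat x 0 0 i)) c (s z)).real y i j)
        (fun c => (hc c).real y i j) ha⟩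

/-- The collected weight depends measurably on the weights, the samples and the random tape. -/
theorem measurable_collected {m : ℕ} (P : Prog) (M : Matroid (Fin n)) (k : ℕ)
    (B : Pair n → Pair n → Prop) (order : Equiv.Perm (Fin m)) {r : Z → Profile n m}
    {s : Z → ℕ → Fin n → ℝ≥0} {ω : Z → ℕ → unitInterval} (hr : Measurable r)
    (hs : ∀ i e, Measurable fun z => s z i e) (hω : Measurable ω) :
    Measurable fun z => (Scenario.mk M k B order (r z) (s z) (ω z)).collected P := by
  have hV : ∀ t, View.IsMeasurable fun z =>
      (Scenario.mk M k B order (r z) (s z) (ω z)).view t := fun t => by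
    refine ⟨⟨⟨m, k, fun I => M.Indep (I : Set (Fin n)), B, fun _ _ => 0, fun _ => 0, t, order t, fun _ => 0⟩,
      fun z => ⟨rfl, rfl, rfl, rfl, rfl, rfl⟩⟩, hs, fun i => (measurable_pi_apply i).comp hω,
      fun e => ?_⟩
    exact (measurable_pi_apply e).comp ((measurable_pi_apply (order t)).comp hr)
  have hstore : ∀ t, Store.IsMeasurable fun z =>
      (Scenario.mk M k B order (r z) (s z) (ω z)).storeAfter P t := fun t => by
    induction t with
    | zero => exact ⟨fun _ _ _ => measurable_const, fun _ _ _ => measurable_const⟩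
    | succ t ih =>
      simp only [Scenario.storeAfter]
      split_ifs with h
      · exact P.measurable_exec (hV ⟨t, h⟩) ih
      · exact ih
  simp only [Scenario.collected, value]
  refine Finset.measurable_sum _ fun a _ => ?_
  have hw : ∀ o : Option (Fin n), Measurable fun z => weightOf (r z a) o := fun o => by
    cases o with
    | none => exact measurable_const
    | some e => exact (measurable_pi_apply e).comp ((measurable_pi_apply a).comp hr)
  let dec : ℕ → Option (Fin n) := fun v =>
    if h : v ≠ 0 ∧ v - 1 < n then some ⟨v - 1, h.2⟩ else none
  have := measurable_apply_countable (f := fun v z => weightOf (r z a) (dec v))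
    (fun v => hw (dec v)) ((hstore (order.symm a + 1)).nat 0 0 0)
  exact this

end

/-! ### A calculus for programs -/

/-- Sequential composition. -/
infixr:60 ";;" => Prog.seq

-- Names of arrays of natural numbers; a scalar occupies the entry `(0, 0)` of its array. The row `0`
-- of `nOwn` holds the owners, `nExch` the exchange matrix, and the row `l` of `nReach` the indices that
-- are reached by at most `l` moves. The names that begin with `c` belong to loop counters.
notation "nOut" => (0 : ℕ)
notation "nOwn" => (1 : ℕ)
notation "nExch" => (2 : ℕ)
notation "nReach" => (3 : ℕ)
notation "nTmp" => (4 : ℕ)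
notation "cE" => (5 : ℕ)
notation "cF" => (6 : ℕ)
notation "cG" => (7 : ℕ)
notation "cL" => (8 : ℕ)
notation "cH" => (9 : ℕ)
notation "cJ" => (10 : ℕ)
notation "cT" => (11 : ℕ)
notation "nLevel" => (12 : ℕ)
notation "nTaken" => (13 : ℕ)
notation "nDisp" => (14 : ℕ)
notation "nNext" => (15 : ℕ)
notation "nFlag" => (16 : ℕ)
-- Names of arrays of real numbers. `rW` holds the weights, with one row per agent; the row `0` of
-- `rUtil` and of `rPrice` holds the dual variables.
notation "rW" => (0 : ℕ)
notation "rUtil" => (1 : ℕ)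
notation "rPrice" => (2 : ℕ)
notation "rGap" => (3 : ℕ)

namespace Exp

/-- The scalar `x`. -/
abbrev var (x : ℕ) : Exp .nat := .readNat x (.lit 0) (.lit 0)

/-- An entry of the first row of `x`. -/
abbrev cell (x : ℕ) (i : Exp .nat) : Exp .nat := .readNat x (.lit 0) i

/-- Conjunction; every nonzero value counts as true. -/
def and (a b : Exp .nat) : Exp .nat := .le (.lit 2) (.add (.le (.lit 1) a) (.le (.lit 1) b))

/-- Disjunction. -/
def or (a b : Exp .nat) : Exp .nat := .add a b

/-- Negation. -/
def not (a : Exp .nat) : Exp .nat := .le a (.lit 0)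

/-- Equality. -/
def eq (a b : Exp .nat) : Exp .nat := and (.le a b) (.le b a)

/-- Strict inequality. -/
def lt (a b : Exp .nat) : Exp .nat := .le (.add a (.lit 1)) b

/-- The number of elements of the offline problem. -/
abbrev size : Exp .nat := .add .numElements .numAgents

/-- The number of indices of the offline problem. -/
abbrev size₁ : Exp .nat := .add size (.lit 1)

end Exp

section
variable {n : ℕ} {V : View n} {s : Store}

/-- The value of an expression of type `nat`, as a natural number. -/
noncomputable def Exp.natVal (V : View n) (s : Store) (a : Exp .nat) : ℕ := a.eval V s

/-- The value of an expression of type `real`, as a real number. -/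
noncomputable def Exp.realVal (V : View n) (s : Store) (u : Exp .real) : ℝ := u.eval V s

/-- An expression is true if its value is nonzero. -/
def Exp.Holds (V : View n) (s : Store) (a : Exp .nat) : Prop := a.natVal V s ≠ 0

@[simp] theorem Exp.natVal_lit (c : ℕ) : (Exp.lit c).natVal V s = c := rfl

@[simp] theorem Exp.natVal_readNat (x : ℕ) (i j : Exp .nat) :
    (Exp.readNat x i j).natVal V s = s.nat x (i.natVal V s) (j.natVal V s) := rfl

@[simp] theorem Exp.natVal_add (a b : Exp .nat) :
    (Exp.add a b).natVal V s = a.natVal V s + b.natVal V s := rfl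

@[simp] theorem Exp.natVal_sub (a b : Exp .nat) :
    (Exp.sub a b).natVal V s = a.natVal V s - b.natVal V s := rfl

@[simp] theorem Exp.natVal_numElements : Exp.numElements.natVal V s = n := rfl

@[simp] theorem Exp.natVal_numAgents : Exp.numAgents.natVal V s = V.numAgents := rfl

@[simp] theorem Exp.natVal_param : Exp.param.natVal V s = V.param := rfl

@[simp] theorem Exp.natVal_round : Exp.round.natVal V s = V.round := rfl

@[simp] theorem Exp.natVal_agent : Exp.agent.natVal V s = V.agent := rfl

@[simp] theorem Exp.realVal_readReal (x : ℕ) (i j : Exp .nat) :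
    (Exp.readReal x i j).realVal V s = s.real x (i.natVal V s) (j.natVal V s) := rfl

@[simp] theorem Exp.realVal_addReal (a b : Exp .real) :
    (Exp.addReal a b).realVal V s = a.realVal V s + b.realVal V s := rfl

@[simp] theorem Exp.realVal_subReal (a b : Exp .real) :
    (Exp.subReal a b).realVal V s = a.realVal V s - b.realVal V s := rfl

@[simp] theorem Exp.realVal_mulReal (a b : Exp .real) :
    (Exp.mulReal a b).realVal V s = a.realVal V s * b.realVal V s := rfl

@[simp] theorem Exp.realVal_divReal (a b : Exp .real) :
    (Exp.divReal a b).realVal V s = a.realVal V s / b.realVal V s := rfl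

@[simp] theorem Exp.realVal_cast (a : Exp .nat) :
    (Exp.cast a).realVal V s = (a.natVal V s : ℝ) := rfl

@[simp] theorem Exp.realVal_coin (a : Exp .nat) :
    (Exp.coin a).realVal V s = (V.coins (a.natVal V s) : ℝ) := rfl

theorem Exp.realVal_weight (e : Exp .nat) : (Exp.weight e).realVal V s =
    if h : e.natVal V s < n then (V.weight ⟨e.natVal V s, h⟩ : ℝ) else 0 := rfl

theorem Exp.realVal_sample (i e : Exp .nat) : (Exp.sample i e).realVal V s =
    if h : e.natVal V s < n then (V.samples (i.natVal V s) ⟨e.natVal V s, h⟩ : ℝ) else 0 := rfl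

theorem Exp.natVal_le (a b : Exp .nat) :
    (Exp.le a b).natVal V s = if a.natVal V s ≤ b.natVal V s then 1 else 0 := by
  simp only [Exp.natVal, Exp.eval]
  congr 1

theorem Exp.natVal_eq_zero (a : Exp .nat) : a.natVal V s = 0 ↔ ¬ a.Holds V s := not_not.symm

@[simp] theorem Exp.holds_readNat (x : ℕ) (i j : Exp .nat) :
    (Exp.readNat x i j).Holds V s ↔ s.nat x (i.natVal V s) (j.natVal V s) ≠ 0 := Iff.rfl

@[simp] theorem Exp.holds_le (a b : Exp .nat) :
    (Exp.le a b).Holds V s ↔ a.natVal V s ≤ b.natVal V s := by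
  simp [Exp.Holds, Exp.natVal_le]

@[simp] theorem Exp.holds_leReal (a b : Exp .real) :
    (Exp.leReal a b).Holds V s ↔ a.realVal V s ≤ b.realVal V s := by
  simp [Exp.Holds, Exp.natVal, Exp.realVal, Exp.eval]

@[simp] theorem Exp.holds_indep (x : ℕ) (i : Exp .nat) :
    (Exp.indep x i).Holds V s ↔ V.indep (s.row n x (i.natVal V s)) := by
  simp [Exp.Holds, Exp.natVal, Exp.eval]

@[simp] theorem Exp.holds_blocks (x : ℕ) (i e : Exp .nat) (y : ℕ) (j f : Exp .nat) :
    (Exp.blocks x i e y j f).Holds V s ↔ ∃ e' f' : Fin n, (e' : ℕ) = e.natVal V s ∧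
      (f' : ℕ) = f.natVal V s ∧
      V.blocks (s.row n x (i.natVal V s), e') (s.row n y (j.natVal V s), f') := by
  simp [Exp.Holds, Exp.natVal, Exp.eval]

@[simp] theorem Exp.holds_and (a b : Exp .nat) :
    (a.and b).Holds V s ↔ a.Holds V s ∧ b.Holds V s := by
  rw [Exp.and, Exp.holds_le, Exp.natVal_add, Exp.natVal_le, Exp.natVal_le, Exp.natVal_lit,
    Exp.natVal_lit, Exp.Holds, Exp.Holds]
  split_ifs <;> omega

@[simp] theorem Exp.holds_or (a b : Exp .nat) :
    (a.or b).Holds V s ↔ a.Holds V s ∨ b.Holds V s := by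
  simp only [Exp.or, Exp.Holds, Exp.natVal_add]
  omega

@[simp] theorem Exp.holds_not (a : Exp .nat) : a.not.Holds V s ↔ ¬ a.Holds V s := by
  rw [Exp.not, Exp.holds_le, Exp.natVal_lit, Exp.Holds]
  omega

@[simp] theorem Exp.holds_eq (a b : Exp .nat) :
    (a.eq b).Holds V s ↔ a.natVal V s = b.natVal V s := by
  rw [Exp.eq, Exp.holds_and, Exp.holds_le, Exp.holds_le]
  omega

@[simp] theorem Exp.holds_lt (a b : Exp .nat) :
    (a.lt b).Holds V s ↔ a.natVal V s < b.natVal V s := by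
  rw [Exp.lt, Exp.holds_le]
  exact Iff.rfl

@[simp] theorem Prog.exec_skip : Prog.skip.exec V s = s := rfl

@[simp] theorem Prog.exec_seq (p q : Prog) : (p ;; q).exec V s = q.exec V (p.exec V s) := rfl

@[simp] theorem Prog.exec_setNat (x : ℕ) (i j a : Exp .nat) :
    (Prog.setNat x i j a).exec V s = s.setNat x (i.natVal V s) (j.natVal V s) (a.natVal V s) := rfl

@[simp] theorem Prog.exec_setReal (x : ℕ) (i j : Exp .nat) (u : Exp .real) :
    (Prog.setReal x i j u).exec V s = s.setReal x (i.natVal V s) (j.natVal V s) (u.realVal V s) := rfl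

open Classical in
@[simp] theorem Prog.exec_ite (a : Exp .nat) (p q : Prog) :
    (Prog.ite a p q).exec V s = if a.Holds V s then p.exec V s else q.exec V s := by
  rw [Prog.exec]
  exact if_congr Iff.rfl rfl rfl

/-- The loop rule: an invariant has to be maintained by the body, in a store that agrees with the
initial one on all arrays that the loop does not write. -/
theorem Prog.exec_loop {x : ℕ} {a : Exp .nat} {p : Prog} (Inv : ℕ → Store → Prop)
    (h0 : Inv 0 s)
    (hstep : ∀ i < a.natVal V s, ∀ t : Store,
      (∀ y, y ∉ x :: p.natWrites → t.nat y = s.nat y) →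
      (∀ y, y ∉ p.realWrites → t.real y = s.real y) → Inv i t →
      Inv (i + 1) (p.exec V (t.setNat x 0 0 i))) :
    Inv (a.natVal V s) ((Prog.loop x a p).exec V s) := by
  rw [exec]
  refine (iterate_induction (fun i t => (∀ y, y ∉ x :: p.natWrites → t.nat y = s.nat y) ∧
    (∀ y, y ∉ p.realWrites → t.real y = s.real y) ∧ Inv i t)
    ⟨fun _ _ => rfl, fun _ _ => rfl, h0⟩ ?_).2.2
  rintro i hi t ⟨h1, h2, h3⟩
  refine ⟨fun y hy => ?_, fun y hy => ?_, hstep i hi t h1 h2 h3⟩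
  · have hy' := hy
    simp only [List.mem_cons, not_or] at hy'
    rw [p.nat_exec hy'.2, Store.nat_setNat_of_ne _ _ _ _ hy'.1, h1 y hy]
  · rw [p.real_exec hy, Store.real_setNat, h2 y hy]

end

/-! ### Programs for exchanges and tight moves -/

/-- Write the indices that have an owner, without the value of `cF` and with the value of `cE`, to the
row `0` of `nTmp`. -/
def tmpProg : Prog :=
  .loop cG .size₁ (.setNat nTmp (.lit 0) (.var cG)
    (.or (.and (.cell nOwn (.var cG)) (.not (.eq (.var cG) (.var cF))))
      (.eq (.var cG) (.var cE))))

/-- Compute the possible exchanges and the addable elements. For the latter, `cF` gets a value that is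
not an index, so that nothing is removed. -/
def exchProg : Prog :=
  .loop cE .size₁ (
    .loop cF .size₁ (tmpProg ;;
      .setNat nExch (.var cE) (.var cF) (.and (.cell nOwn (.var cF))
        (.and (.or (.not (.cell nOwn (.var cE))) (.eq (.var cE) (.var cF)))
          (.indep nTmp (.lit 0))))) ;;
    .setNat cF (.lit 0) (.lit 0) .size₁ ;;
    tmpProg ;;
    .setNat nReach (.lit 0) (.var cE) (.and (.not (.cell nOwn (.var cE))) (.indep nTmp (.lit 0))))

/-- The first part of the slack. -/
def Exp.gain (f h : Exp .nat) : Exp .real :=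
  .addReal (.addReal (.readReal rPrice (.lit 0) f)
    (.readReal rUtil (.lit 0) (.sub (.cell nOwn f) (.lit 1)))) (.readReal rPrice (.lit 0) h)

/-- The second part of the slack. -/
def Exp.loss (e f h : Exp .nat) : Exp .real :=
  .addReal (.readReal rPrice (.lit 0) e) (.readReal rW (.sub (.cell nOwn f) (.lit 1)) h)

/-- The test for a tight move. -/
def Exp.edge (e f h : Exp .nat) : Exp .nat :=
  .and (.readNat nExch e f) (.leReal (Exp.gain f h) (Exp.loss e f h))

/-- Compute the indices that are reached, for all numbers of moves. -/
def reachProg : Prog :=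
  .loop cL .size₁ (.loop cE .size₁ (
    .setNat nReach (.add (.var cL) (.lit 1)) (.var cE) (.readNat nReach (.var cL) (.var cE)) ;;
    .loop cF .size₁ (.loop cH .size (
      .ite (.and (Exp.edge (.var cE) (.var cF) (.var cH)) (.readNat nReach (.var cL) (.var cH)))
        (.setNat nReach (.add (.var cL) (.lit 1)) (.var cE) (.lit 1)) .skip))))

section
variable {n : ℕ} {V : View n} {D : Market} {σ : Ledger} {s t : Store}

/-- The memory represents a state of the primal-dual method. -/
structure Represents (V : View n) (D : Market) (σ : Ledger) (s : Store) : Prop where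
  size : D.size = n + V.numAgents
  ind : D.Ind = fun S => V.indep (Finset.univ.filter fun e : Fin n => (e : ℕ) ∈ S)
  wt : s.real rW = D.wt
  own : s.nat nOwn 0 = σ.own
  util : s.real rUtil 0 = σ.util
  price : s.real rPrice 0 = σ.price

theorem Represents.congr (h : Represents V D σ s) (h1 : t.nat nOwn = s.nat nOwn)
    (h2 : t.real rW = s.real rW) (h3 : t.real rUtil = s.real rUtil)
    (h4 : t.real rPrice = s.real rPrice) : Represents V D σ t :=
  ⟨h.size, h.ind, by rw [h2, h.wt], by rw [h1, h.own], by rw [h3, h.util], by rw [h4, h.price]⟩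

theorem row_exec_tmp (h : Represents V D σ s) :
    (tmpProg.exec V s).row n nTmp 0 = Finset.univ.filter fun e : Fin n =>
      (e : ℕ) ∈ insert (s.nat cE 0 0) ((D.held σ).erase (s.nat cF 0 0)) := by
  have key : ∀ g < Exp.size₁.natVal V s, (tmpProg.exec V s).nat nTmp 0 g ≠ 0 ↔
      (σ.own g ≠ 0 ∧ g ≠ s.nat cF 0 0) ∨ g = s.nat cE 0 0 := by
    refine Prog.exec_loop (fun i t => ∀ g < i, t.nat nTmp 0 g ≠ 0 ↔
      (σ.own g ≠ 0 ∧ g ≠ s.nat cF 0 0) ∨ g = s.nat cE 0 0) (fun g hg => absurd hg (by omega)) ?_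
    intro i _ t hn hr ih g hg
    have e1 := hn nOwn (by decide)
    have e2 := hn cE (by decide)
    have e3 := hn cF (by decide)
    by_cases hgi : g = i
    · subst hgi
      simp [Exp.natVal_eq_zero, Store.nat_setNat_of_ne, e1, e2, e3, h.own]
      tauto
    · simp [Store.nat_setNat_of_ne, hgi, ih g (by omega)]
  ext e
  have := key e (by simp; omega)
  simp only [Store.row, Finset.mem_filter, Finset.mem_univ, true_and, this, Finset.mem_insert,
    Finset.mem_erase, Market.held, Finset.mem_range]
  have h2 : (e : ℕ) < D.size + 1 := by rw [h.size]; omega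
  tauto

/-- The exchange matrix is correct. -/
def ExchOK (D : Market) (σ : Ledger) (s : Store) : Prop :=
  ∀ e < D.size + 1, ∀ f < D.size + 1, s.nat nExch e f ≠ 0 ↔ D.Exch σ e f

/-- The rows of the reachability table below `c` are correct. -/
def ReachOK (D : Market) (σ : Ledger) (c : ℕ) (s : Store) : Prop :=
  ∀ l < c, ∀ e < D.size + 1, s.nat nReach l e ≠ 0 ↔ D.Reach σ l e

theorem exec_exch (h : Represents V D σ s) :
    ExchOK D σ (exchProg.exec V s) ∧ ReachOK D σ 1 (exchProg.exec V s) := by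
  have hsz : Exp.size₁.natVal V s = D.size + 1 := by simp [h.size]
  have key : (∀ e < Exp.size₁.natVal V s, ∀ f < D.size + 1,
      (exchProg.exec V s).nat nExch e f ≠ 0 ↔ D.Exch σ e f) ∧
      ∀ e < Exp.size₁.natVal V s,
        (exchProg.exec V s).nat nReach 0 e ≠ 0 ↔ D.Addable σ e := by
    refine Prog.exec_loop (fun i t => (∀ e < i, ∀ f < D.size + 1,
      t.nat nExch e f ≠ 0 ↔ D.Exch σ e f) ∧ ∀ e < i, t.nat nReach 0 e ≠ 0 ↔ D.Addable σ e)
      ⟨fun e he => absurd he (by omega), fun e he => absurd he (by omega)⟩ ?_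
    intro i _ t hn hr ih
    have ht : Represents V D σ (t.setNat cE 0 0 i) :=
      h.congr (by rw [Store.nat_setNat_of_ne _ _ _ _ (by decide)]; exact hn _ (by decide))
        (hr _ (by decide)) (hr _ (by decide)) (hr _ (by decide))
    set t₀ := t.setNat cE 0 0 i with ht₀
    set inner : Prog := .loop cF .size₁ (tmpProg ;;
      .setNat nExch (.var cE) (.var cF) (.and (.cell nOwn (.var cF))
        (.and (.or (.not (.cell nOwn (.var cE))) (.eq (.var cE) (.var cF)))
          (.indep nTmp (.lit 0))))) with hinner
    have hin : (∀ f < Exp.size₁.natVal V t₀, (inner.exec V t₀).nat nExch i f ≠ 0 ↔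
        D.Exch σ i f) ∧ ∀ e ≠ i, ∀ f, (inner.exec V t₀).nat nExch e f = t₀.nat nExch e f := by
      refine Prog.exec_loop (fun c u => (∀ f < c, u.nat nExch i f ≠ 0 ↔ D.Exch σ i f) ∧
        ∀ e ≠ i, ∀ f, u.nat nExch e f = t₀.nat nExch e f)
        ⟨fun f hf => absurd hf (by omega), fun _ _ _ => rfl⟩ ?_
      intro c _ u hnu hru ihu
      have hu : Represents V D σ (u.setNat cF 0 0 c) :=
        ht.congr (by rw [Store.nat_setNat_of_ne _ _ _ _ (by decide)]; exact hnu _ (by decide))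
          (hru _ (by decide)) (hru _ (by decide)) (hru _ (by decide))
      have hrow := row_exec_tmp hu
      have e1 : (tmpProg.exec V (u.setNat cF 0 0 c)).nat cE = t₀.nat cE := by
        rw [Prog.nat_exec _ (by decide), Store.nat_setNat_of_ne _ _ _ _ (by decide)]
        exact hnu _ (by decide)
      have e2 : (tmpProg.exec V (u.setNat cF 0 0 c)).nat cF = (u.setNat cF 0 0 c).nat cF :=
        Prog.nat_exec _ (by decide) _
      have e3 : (tmpProg.exec V (u.setNat cF 0 0 c)).nat nOwn 0 = σ.own := by
        rw [Prog.nat_exec _ (by decide)]; exact hu.own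
      have e4 : (tmpProg.exec V (u.setNat cF 0 0 c)).nat nExch = u.nat nExch := by
        rw [Prog.nat_exec _ (by decide), Store.nat_setNat_of_ne _ _ _ _ (by decide)]
      have e5 : t₀.nat cE 0 0 = i := by simp [ht₀]
      have e6 : (u.setNat cF 0 0 c).nat cE 0 0 = i := by
        rw [Store.nat_setNat_of_ne _ _ _ _ (by decide), hnu _ (by decide), e5]
      have e7 : (u.setNat cF 0 0 c).nat cF 0 0 = c := by simp
      rw [e6, e7] at hrow
      constructor
      · intro f hf
        by_cases hfc : f = c
        · subst hfc
          simp only [Prog.exec_seq, Prog.exec_setNat, Store.nat_setNat_self, Exp.natVal_readNat,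
            Exp.natVal_lit, e1, e2, e5, and_self, if_true, ne_eq, Exp.natVal_eq_zero, Exp.holds_and,
            Exp.holds_or, Exp.holds_not, Exp.holds_eq, Exp.holds_readNat, Exp.holds_indep, e3,
            hrow, Market.Exch, h.ind, not_not]
        · simp only [Prog.exec_seq, Prog.exec_setNat, Store.nat_setNat_self, Exp.natVal_readNat,
            Exp.natVal_lit, e1, e2, e5, and_self, if_true, hfc, and_false, if_false, e4]
          exact ihu.1 f (by omega)
      · intro e he f
        simp only [Prog.exec_seq, Prog.exec_setNat, Store.nat_setNat_self, Exp.natVal_readNat,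
            Exp.natVal_lit, e1, e2, e5, he, false_and, if_false, e4]
        exact ihu.2 e he f
    set u := (inner.exec V t₀).setNat cF 0 0 (D.size + 1) with hu
    have hinEq : ∀ y, y ∉ inner.natWrites → (inner.exec V t₀).nat y = t₀.nat y :=
      fun y hy => Prog.nat_exec _ hy _
    have hur : ∀ y, u.real y = t₀.real y := fun y => by
      rw [hu, Store.real_setNat]
      exact Prog.real_exec _ (by simp [hinner, tmpProg, Prog.realWrites]) _
    have hRu : Represents V D σ u :=
      ht.congr (by rw [hu, Store.nat_setNat_of_ne _ _ _ _ (by decide)]; exact hinEq _ (by decide))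
        (hur _) (hur _) (hur _)
    have hrow := row_exec_tmp hRu
    have e6 : u.nat cE 0 0 = i := by
      rw [hu, Store.nat_setNat_of_ne _ _ _ _ (by decide), hinEq _ (by decide)]; simp [ht₀]
    have e7 : u.nat cF 0 0 = D.size + 1 := by simp [hu]
    rw [e6, e7, Finset.erase_eq_of_notMem (by simp [Market.held])] at hrow
    have e1 : (tmpProg.exec V u).nat cE 0 0 = i := by rw [Prog.nat_exec _ (by decide), e6]
    have e3 : (tmpProg.exec V u).nat nOwn 0 = σ.own := by
      rw [Prog.nat_exec _ (by decide), hRu.own]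
    have e4 : (tmpProg.exec V u).nat nExch = (inner.exec V t₀).nat nExch := by
      rw [Prog.nat_exec _ (by decide), hu, Store.nat_setNat_of_ne _ _ _ _ (by decide)]
    have e8 : (tmpProg.exec V u).nat nReach = t.nat nReach := by
      rw [Prog.nat_exec _ (by decide), hu, Store.nat_setNat_of_ne _ _ _ _ (by decide),
        hinEq _ (by decide), ht₀, Store.nat_setNat_of_ne _ _ _ _ (by decide)]
    have e9 : Exp.size₁.natVal V (inner.exec V t₀) = D.size + 1 := by simp [h.size]
    have e10 : t₀.nat nExch = t.nat nExch := by
      rw [ht₀, Store.nat_setNat_of_ne _ _ _ _ (by decide)]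
    have hexec : ∀ q : Prog, (inner ;; Prog.setNat cF (.lit 0) (.lit 0) .size₁ ;; tmpProg ;;
        q).exec V t₀ = q.exec V (tmpProg.exec V u) := fun q => by
      simp only [Prog.exec_seq, Prog.exec_setNat, e9, Exp.natVal_lit, hu]
    rw [hexec]
    constructor
    · intro e he f hf
      rw [Prog.exec_setNat, Store.nat_setNat_of_ne _ _ _ _ (by decide), e4]
      by_cases hei : e = i
      · subst hei
        exact hin.1 f (by simp [← h.size]; omega)
      · rw [hin.2 e hei f, e10]
        exact ih.1 e (by omega) f hf
    · intro e he
      simp only [Prog.exec_setNat, Store.nat_setNat_self, Exp.natVal_lit, true_and,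
        Exp.natVal_readNat, e1]
      by_cases hei : e = i
      · subst hei
        simp only [if_true, ne_eq, Exp.natVal_eq_zero, Exp.holds_and, Exp.holds_not, Exp.holds_readNat,
          Exp.natVal_lit, Exp.natVal_readNat, e1, e3, Exp.holds_indep, hrow, Market.Addable, h.ind,
          not_not]
      · rw [if_neg hei, e8]
        exact ih.2 e (by omega)
  rw [hsz] at key
  refine ⟨key.1, fun l hl e he => ?_⟩
  obtain rfl : l = 0 := by omega
  exact key.2 e he

end

/-! ### Nested loops and reachability -/

section
variable {n : ℕ} {V : View n} {D : Market} {σ : Ledger} {s t : Store}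

/-- The rule for two nested loops whose passes may be taken in any order. The relation `Acc S`
says that the passes belonging to the keys in `S` have been taken. -/
theorem Prog.exec_loop₂ {τ : Type*} {x₁ x₂ : ℕ} {a₁ a₂ : Exp .nat} {p : Prog} {A₁ A₂ : ℕ}
    (Acc : Set τ → Store → Prop) (key : ℕ → ℕ → τ) {S₀ : Set τ} (h0 : Acc S₀ s)
    (hA₁ : ∀ t, a₁.natVal V t = A₁) (hA₂ : ∀ t, a₂.natVal V t = A₂) (hx : x₁ ∉ x₂ :: p.natWrites)
    (hcount : ∀ S t i, Acc S t → Acc S (t.setNat x₁ 0 0 i) ∧ Acc S (t.setNat x₂ 0 0 i))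
    (hstep : ∀ i < A₁, ∀ j < A₂, ∀ S t, (∀ y, y ∉ x₁ :: x₂ :: p.natWrites → t.nat y = s.nat y) →
      (∀ y, y ∉ p.realWrites → t.real y = s.real y) → t.nat x₁ 0 0 = i → t.nat x₂ 0 0 = j →
      Acc S t → Acc (insert (key i j) S) (p.exec V t)) :
    Acc (S₀ ∪ {q | ∃ i < A₁, ∃ j < A₂, q = key i j})
      ((Prog.loop x₁ a₁ (.loop x₂ a₂ p)).exec V s) := by
  have main := Prog.exec_loop (V := V) (s := s) (x := x₁) (a := a₁) (p := .loop x₂ a₂ p)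
    (fun c t => Acc (S₀ ∪ {q | ∃ i < c, ∃ j < A₂, q = key i j}) t) (by simpa using h0) ?_
  · rwa [hA₁] at main
  intro i hi t hn hr ht
  rw [hA₁] at hi
  have inner := Prog.exec_loop (V := V) (s := t.setNat x₁ 0 0 i) (x := x₂) (a := a₂) (p := p)
    (fun c u => Acc ((S₀ ∪ {q | ∃ i' < i, ∃ j < A₂, q = key i' j}) ∪ {q | ∃ j < c, q = key i j}) u)
    (by simpa using (hcount _ _ i ht).1) ?_
  · rw [hA₂] at inner
    convert inner using 1
    rw [Set.union_assoc]
    congr 1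
    ext q
    constructor
    · rintro ⟨i', hi', j, hj, rfl⟩
      rcases Nat.lt_succ_iff_lt_or_eq.1 hi' with h | rfl
      · exact Or.inl ⟨i', h, j, hj, rfl⟩
      · exact Or.inr ⟨j, hj, rfl⟩
    · rintro (⟨i', hi', j, hj, rfl⟩ | ⟨j, hj, rfl⟩)
      · exact ⟨i', by omega, j, hj, rfl⟩
      · exact ⟨i, by omega, j, hj, rfl⟩
  intro j hj u hnu hru hu
  rw [hA₂] at hj
  have := hstep i hi j hj _ (u.setNat x₂ 0 0 j) (fun y hy => ?_) (fun y hy => ?_) ?_ (by simp)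
    (hcount _ _ j hu).2
  · convert this using 1
    rw [← Set.union_insert]
    congr 1
    ext q
    constructor
    · rintro ⟨j', hj', rfl⟩
      rcases Nat.lt_succ_iff_lt_or_eq.1 hj' with h | rfl
      · exact Or.inr ⟨j', h, rfl⟩
      · exact Or.inl rfl
    · rintro (rfl | ⟨j', hj', rfl⟩)
      · exact ⟨j, by omega, rfl⟩
      · exact ⟨j', by omega, rfl⟩
  · have hy' := hy
    simp only [List.mem_cons, not_or] at hy'
    rw [Store.nat_setNat_of_ne _ _ _ _ hy'.2.1, hnu y (by simp [hy'.2]),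
      Store.nat_setNat_of_ne _ _ _ _ hy'.1, hn y (by simp [Prog.natWrites, hy'])]
  · rw [Store.real_setNat, hru y hy, Store.real_setNat, hr y hy]
  · rw [Store.nat_setNat_of_ne _ _ _ _ (fun h => hx (by simp [h])), hnu _ hx]
    simp

theorem Represents.size₁_eq (h : Represents V D σ s) (t : Store) :
    Exp.size₁.natVal V t = D.size + 1 := by simp [h.size]

theorem Represents.size_eq (h : Represents V D σ s) (t : Store) :
    Exp.size.natVal V t = D.size := by simp [h.size]

theorem Represents.gain_sub_loss (h : Represents V D σ s) (e f g : Exp .nat) :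
    (Exp.gain f g).realVal V s - (Exp.loss e f g).realVal V s =
      D.slack σ (e.natVal V s) (f.natVal V s) (g.natVal V s) := by
  simp [Exp.gain, Exp.loss, Market.slack, h.own, h.util, h.price, h.wt]

theorem Represents.holds_edge (h : Represents V D σ s) (hE : ExchOK D σ s) {e f g : Exp .nat}
    (he : e.natVal V s < D.size + 1) (hf : f.natVal V s < D.size + 1) :
    (Exp.edge e f g).Holds V s ↔ D.Edge σ (e.natVal V s) (f.natVal V s) (g.natVal V s) := by
  rw [Exp.edge, Exp.holds_and, Exp.holds_leReal, Exp.holds_readNat, hE _ he _ hf, Market.Edge,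
    ← h.gain_sub_loss e f g, sub_nonpos]

theorem ExchOK.congr (h : ExchOK D σ s) (ht : t.nat nExch = s.nat nExch) : ExchOK D σ t := by
  rw [ExchOK, ht]; exact h

theorem exec_reach (h : Represents V D σ s) (hE : ExchOK D σ s) (h0 : ReachOK D σ 1 s) :
    ReachOK D σ (D.size + 2) (reachProg.exec V s) := by
  rw [show D.size + 2 = Exp.size₁.natVal V s + 1 by rw [h.size₁_eq]]
  refine Prog.exec_loop (fun i t => ReachOK D σ (i + 1) t) h0 ?_
  intro l _ t hn hr ih
  have ht : Represents V D σ (t.setNat cL 0 0 l) :=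
    h.congr (by rw [Store.nat_setNat_of_ne _ _ _ _ (by decide)]; exact hn _ (by decide))
      (hr _ (by decide)) (hr _ (by decide)) (hr _ (by decide))
  have htE : ExchOK D σ (t.setNat cL 0 0 l) :=
    hE.congr (by rw [Store.nat_setNat_of_ne _ _ _ _ (by decide)]; exact hn _ (by decide))
  set t₀ := t.setNat cL 0 0 l with ht₀
  have hL : t₀.nat cL 0 0 = l := by simp [ht₀]
  have hR₀ : t₀.nat nReach = t.nat nReach := by
    rw [ht₀, Store.nat_setNat_of_ne _ _ _ _ (by decide)]
  suffices hs : (∀ e < Exp.size₁.natVal V t₀, (Prog.exec V _ t₀).nat nReach (l + 1) e ≠ 0 ↔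
      D.Reach σ (l + 1) e) ∧ ∀ l' ≠ l + 1, ∀ e, (Prog.exec V _ t₀).nat nReach l' e =
        t.nat nReach l' e by
    intro l' hl' e he
    by_cases hll : l' = l + 1
    · subst hll
      exact hs.1 e (by rw [h.size₁_eq]; exact he)
    · rw [hs.2 l' hll e]
      exact ih l' (by omega) e he
  refine Prog.exec_loop (fun c u => (∀ e < c, u.nat nReach (l + 1) e ≠ 0 ↔ D.Reach σ (l + 1) e) ∧
    ∀ l' ≠ l + 1, ∀ e, u.nat nReach l' e = t.nat nReach l' e)
    ⟨fun e he => absurd he (by omega), fun _ _ _ => by rw [hR₀]⟩ ?_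
  intro e he u hnu hru ihu
  rw [h.size₁_eq] at he
  rw [Prog.exec_seq]
  set v := (Prog.setNat nReach ((Exp.var cL).add (Exp.lit 1)) (Exp.var cE)
    (Exp.readNat nReach (Exp.var cL) (Exp.var cE))).exec V (u.setNat cE 0 0 e) with hv
  have hvL : (u.setNat cE 0 0 e).nat cL 0 0 = l := by
    rw [Store.nat_setNat_of_ne _ _ _ _ (by decide), hnu _ (by decide), hL]
  have hvn : ∀ y, y ∉ [cE, cL, nReach, cF, cH] → v.nat y = t₀.nat y := fun y hy => by
    simp only [List.mem_cons, List.not_mem_nil, not_or] at hy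
    rw [hv, Prog.exec_setNat, Store.nat_setNat_of_ne _ _ _ _ hy.2.2.1,
      Store.nat_setNat_of_ne _ _ _ _ hy.1, hnu y (by simp [Prog.natWrites, hy])]
  have hvr : ∀ y, v.real y = t₀.real y := fun y => by
    rw [hv, Prog.exec_setNat, Store.real_setNat, Store.real_setNat]
    exact hru y (by simp [Prog.realWrites])
  have hvR : Represents V D σ v := ht.congr (hvn _ (by decide)) (hvr _) (hvr _) (hvr _)
  have hvE : ExchOK D σ v := htE.congr (hvn _ (by decide))
  have hvcell : ∀ l' e', v.nat nReach l' e' =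
      if l' = l + 1 ∧ e' = e then t.nat nReach l e else u.nat nReach l' e' := fun l' e' => by
    rw [hv, Prog.exec_setNat]
    simp only [Exp.natVal_readNat, Exp.natVal_lit, Exp.natVal_add, hvL, Store.nat_setNat_self,
      and_self, if_true]
    rw [Store.nat_setNat_of_ne _ _ _ _ (by decide), ihu.2 l (by omega) e]
  have hve : v.nat cE 0 0 = e := by
    rw [hv, Prog.exec_setNat, Store.nat_setNat_of_ne _ _ _ _ (by decide)]; simp
  have hvl : v.nat cL 0 0 = l := by
    rw [hv, Prog.exec_setNat, Store.nat_setNat_of_ne _ _ _ _ (by decide), hvL]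
  have key := Prog.exec_loop₂ (V := V) (s := v) (x₁ := cF) (x₂ := cH) (a₁ := .size₁) (a₂ := .size)
    (p := .ite (.and (Exp.edge (.var cE) (.var cF) (.var cH)) (.readNat nReach (.var cL) (.var cH)))
        (.setNat nReach (.add (.var cL) (.lit 1)) (.var cE) (.lit 1)) .skip)
    (A₁ := D.size + 1) (A₂ := D.size)
    (fun S w => (w.nat nReach (l + 1) e ≠ 0 ↔ D.Reach σ l e ∨
      ∃ q ∈ S, D.Edge σ e q.1 q.2 ∧ D.Reach σ l q.2) ∧
      ∀ l' e', ¬ (l' = l + 1 ∧ e' = e) → w.nat nReach l' e' = v.nat nReach l' e')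
    (fun f g => (f, g)) (S₀ := ∅) ⟨?_, fun _ _ _ => rfl⟩ (h.size₁_eq) (h.size_eq) (by decide)
    (fun S w i hw => by
      rw [Store.nat_setNat_of_ne _ _ _ _ (by decide), Store.nat_setNat_of_ne _ _ _ _ (by decide)]
      exact ⟨hw, hw⟩) ?_
  · constructor
    · intro e' he'
      by_cases hee : e' = e
      · subst hee
        rw [key.1]
        refine or_congr Iff.rfl ?_
        constructor
        · rintro ⟨q, hq, hq'⟩
          simp only [Set.empty_union, Set.mem_ofPred_eq] at hq
          obtain ⟨f, hf, g, hg, rfl⟩ := hq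
          exact ⟨f, hf, g, hg, hq'⟩
        · rintro ⟨f, hf, g, hg, hq'⟩
          exact ⟨(f, g), Or.inr ⟨f, hf, g, hg, rfl⟩, hq'⟩
      · rw [key.2 _ _ (by simp [hee]), hvcell, if_neg (by simp [hee])]
        exact ihu.1 e' (by omega)
    · intro l' hl' e'
      rw [key.2 _ _ (by simp [hl']), hvcell, if_neg (by simp [hl'])]
      exact ihu.2 l' hl' e'
  · rw [hvcell, if_pos ⟨rfl, rfl⟩]
    simpa using ih l (by omega) e he
  · intro f hf g hg S w hnw hrw hwf hwg hacc
    have hwR : Represents V D σ w :=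
      hvR.congr (hnw _ (by decide)) (hrw _ (by decide)) (hrw _ (by decide)) (hrw _ (by decide))
    have hwE : ExchOK D σ w := hvE.congr (hnw _ (by decide))
    have hwe : w.nat cE 0 0 = e := by rw [hnw _ (by decide), hve]
    have hwl : w.nat cL 0 0 = l := by rw [hnw _ (by decide), hvl]
    have hcell : w.nat nReach l g ≠ 0 ↔ D.Reach σ l g := by
      rw [hacc.2 _ _ (by omega), hvcell, if_neg (by omega), ihu.2 l (by omega)]
      exact ih l (by omega) g (by omega)
    have hcond : (Exp.and (Exp.edge (.var cE) (.var cF) (.var cH))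
        (.readNat nReach (.var cL) (.var cH))).Holds V w ↔ D.Edge σ e f g ∧ D.Reach σ l g := by
      rw [Exp.holds_and, hwR.holds_edge hwE (by simp [hwe]; omega) (by simp [hwf]; omega),
        Exp.holds_readNat]
      simp only [Exp.natVal_readNat, Exp.natVal_lit, hwe, hwf, hwg, hwl, hcell]
    rw [Prog.exec_ite]
    split_ifs with hc
    · rw [hcond] at hc
      simp only [Prog.exec_setNat, Exp.natVal_readNat, Exp.natVal_lit, Exp.natVal_add, hwe, hwl,
        Store.nat_setNat_self, and_self, if_true]
      refine ⟨iff_of_true one_ne_zero (Or.inr ⟨(f, g), Set.mem_insert _ _, hc⟩),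
        fun l' e' hle => ?_⟩
      rw [if_neg hle]
      exact hacc.2 l' e' hle
    · rw [hcond] at hc
      refine ⟨?_, hacc.2⟩
      rw [Prog.exec_skip, hacc.1]
      refine or_congr Iff.rfl ⟨?_, ?_⟩
      · rintro ⟨q, hq, hq'⟩; exact ⟨q, Set.mem_insert_of_mem _ hq, hq'⟩
      · rintro ⟨q, hq | hq, hq'⟩
        · subst hq; exact absurd hq' hc
        · exact ⟨q, hq, hq'⟩

end

/-! ### A program for the augmentation step -/

section
variable {n : ℕ} {V : View n} {D : Market} {σ : Ledger} {s t : Store}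

/-- The memory represents a state, and the exchange matrix and the reachability table of this
state have been computed. -/
structure Tables (V : View n) (D : Market) (σ : Ledger) (s : Store) : Prop where
  rep : Represents V D σ s
  exch : ExchOK D σ s
  reach : ReachOK D σ (D.size + 2) s

theorem Tables.congr (h : Tables V D σ s) (h1 : ∀ y ∈ [nOwn, nExch, nReach], t.nat y = s.nat y)
    (h2 : ∀ y ∈ [rW, rUtil, rPrice], t.real y = s.real y) : Tables V D σ t :=
  ⟨h.rep.congr (h1 _ (by simp)) (h2 _ (by simp)) (h2 _ (by simp)) (h2 _ (by simp)),
    h.exch.congr (h1 _ (by simp)), by rw [ReachOK, h1 nReach (by simp)]; exact h.reach⟩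

theorem Tables.exec (h : Tables V D σ s) (P : Prog)
    (h1 : ∀ y ∈ [nOwn, nExch, nReach], y ∉ P.natWrites)
    (h2 : ∀ y ∈ [rW, rUtil, rPrice], y ∉ P.realWrites) : Tables V D σ (P.exec V s) :=
  h.congr (fun y hy => P.nat_exec (h1 y hy) s) (fun y hy => P.real_exec (h2 y hy) s)

theorem Tables.setNat (h : Tables V D σ s) {x : ℕ} (i j v : ℕ)
    (hx : x ∉ [nOwn, nExch, nReach]) : Tables V D σ (s.setNat x i j v) :=
  h.congr (fun _ hy => Store.nat_setNat_of_ne _ _ _ _ fun e => hx (e ▸ hy)) fun _ _ => rfl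

/-- Compute the number of moves that the searching agent needs. -/
def levelProg : Prog :=
  .setNat nLevel (.lit 0) (.lit 0) (.lit 0) ;;
  .loop cL .size₁ (.ite (.readNat nReach (.var cL) .size) .skip
    (.setNat nLevel (.lit 0) (.lit 0) (.add (.var nLevel) (.lit 1))))

theorem exec_level (h : Tables V D σ s) : (levelProg.exec V s).nat nLevel 0 0 = D.level σ := by
  classical
  rw [levelProg, Prog.exec_seq, Market.level, ← h.rep.size₁_eq
    ((Prog.setNat nLevel (Exp.lit 0) (Exp.lit 0) (Exp.lit 0)).exec V s)]
  refine Prog.exec_loop (fun c t => t.nat nLevel 0 0 =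
    ((Finset.range c).filter fun l => ¬ D.Reach σ l D.size).card) (by simp) ?_
  intro l hl t hn hr ih
  rw [h.rep.size₁_eq] at hl
  have hT : Tables V D σ (t.setNat cL 0 0 l) :=
    ((h.exec (.setNat nLevel (.lit 0) (.lit 0) (.lit 0)) (by decide) (by decide)).congr (fun y hy => hn y (by revert y; decide))
      (fun y hy => hr y (by revert y; decide))).setNat 0 0 l (by decide)
  have hlev : (t.setNat cL 0 0 l).nat nLevel = t.nat nLevel :=
    Store.nat_setNat_of_ne _ _ _ _ (by decide)
  have hR := hT.reach l (by omega) D.size (by omega)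
  rw [Finset.range_add_one, Finset.filter_insert, Prog.exec_ite]
  simp only [Exp.holds_readNat, Exp.natVal_readNat, Exp.natVal_lit, Store.nat_setNat_self,
    and_self, if_true, h.rep.size_eq, hR]
  split_ifs with hc
  · rw [Prog.exec_skip, hlev, ih]
  · rw [Finset.card_insert_of_notMem (by simp)]
    simp [hlev, ih]

/-- Choose the element that the searching agent takes. -/
def takenProg : Prog :=
  .setNat nTaken (.lit 0) (.lit 0) (.lit 0) ;;
  .loop cE .size (.ite (.and (.readNat nReach (.sub (.var nLevel) (.lit 1)) (.var cE))
      (Exp.edge .size .size (.var cE)))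
    (.setNat nTaken (.lit 0) (.lit 0) (.add (.var cE) (.lit 1))) .skip) ;;
  .setNat nTaken (.lit 0) (.lit 0) (.sub (.var nTaken) (.lit 1))

theorem level_le : D.level σ ≤ D.size + 1 := by
  classical
  simpa [Market.level] using Finset.card_filter_le (Finset.range (D.size + 1))
    (fun l => ¬ D.Reach σ l D.size)

theorem exec_taken (h : Tables V D σ s) (hl : s.nat nLevel 0 0 = D.level σ) :
    (takenProg.exec V s).nat nTaken 0 0 = D.taken σ := by
  classical
  rw [takenProg, Prog.exec_seq, Prog.exec_seq]
  set s₁ := (Prog.setNat nTaken (Exp.lit 0) (Exp.lit 0) (Exp.lit 0)).exec V s with hs₁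
  have h₁ : Tables V D σ s₁ := h.exec _ (by decide) (by decide)
  have hl₁ : s₁.nat nLevel 0 0 = D.level σ := by rw [hs₁, Prog.nat_exec _ (by decide), hl]
  have key := Prog.exec_loop (V := V) (s := s₁) (x := cE) (a := .size)
    (p := .ite (.and (.readNat nReach (.sub (.var nLevel) (.lit 1)) (.var cE))
      (Exp.edge .size .size (.var cE)))
      (.setNat nTaken (.lit 0) (.lit 0) (.add (.var cE) (.lit 1))) .skip)
    (fun c t => t.nat nTaken 0 0 =
      lastSat (fun e => D.Reach σ (D.level σ - 1) e ∧ D.Edge σ D.size D.size e) c)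
    (by simp [hs₁, lastSat]) ?_
  · simp only [Prog.exec_setNat, Exp.natVal_lit, Store.nat_setNat_self, and_self, if_true,
      Exp.natVal_sub, Exp.natVal_readNat, key, h.rep.size_eq, Market.taken]
  intro e he t hn hr ih
  rw [h.rep.size_eq] at he
  have hT : Tables V D σ (t.setNat cE 0 0 e) :=
    (h₁.congr (fun y hy => hn y (by revert y; decide))
      (fun y hy => hr y (by revert y; decide))).setNat 0 0 e (by decide)
  have hlev : (t.setNat cE 0 0 e).nat nLevel 0 0 = D.level σ := by
    rw [Store.nat_setNat_of_ne _ _ _ _ (by decide), hn _ (by decide), hl₁]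
  have htk : (t.setNat cE 0 0 e).nat nTaken = t.nat nTaken :=
    Store.nat_setNat_of_ne _ _ _ _ (by decide)
  have hle := level_le (D := D) (σ := σ)
  have hR := hT.reach (D.level σ - 1) (by omega) e (by omega)
  have hE := hT.rep.holds_edge hT.exch (e := .size) (f := .size) (g := .var cE)
    (by rw [h.rep.size_eq]; omega) (by rw [h.rep.size_eq]; omega)
  have hcond : (Exp.and (.readNat nReach (.sub (.var nLevel) (.lit 1)) (.var cE))
      (Exp.edge .size .size (.var cE))).Holds V (t.setNat cE 0 0 e) ↔
      D.Reach σ (D.level σ - 1) e ∧ D.Edge σ D.size D.size e := by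
    rw [Exp.holds_and, hE, Exp.holds_readNat, h.rep.size_eq]
    simp only [Exp.natVal_readNat, Exp.natVal_lit, Exp.natVal_sub, hlev, Store.nat_setNat_self,
      and_self, if_true, hR]
  rw [lastSat, Prog.exec_ite, if_congr hcond rfl rfl]
  split_ifs with hc
  · simp
  · rw [Prog.exec_skip, htk, ih]

/-- Choose the displaced agent. -/
def dispProg : Prog :=
  .setNat nDisp (.lit 0) (.lit 0) (.lit 0) ;;
  .ite (.lt (.var nLevel) (.lit 2)) .skip
    (.loop cF .size₁ (.loop cH .size (
      .ite (.and (Exp.edge (.var nTaken) (.var cF) (.var cH))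
          (.readNat nReach (.sub (.var nLevel) (.lit 2)) (.var cH)))
        (.setNat nDisp (.lit 0) (.lit 0) (.add (.var cF) (.lit 1))) .skip)))

theorem taken_lt : D.taken σ < D.size + 1 := by
  rw [Market.taken]
  by_cases h : lastSat (fun e => D.Reach σ (D.level σ - 1) e ∧ D.Edge σ D.size D.size e) D.size = 0
  · omega
  · have := (lastSat_spec h).1
    omega

theorem exec_disp (h : Tables V D σ s) (hl : s.nat nLevel 0 0 = D.level σ)
    (ht : s.nat nTaken 0 0 = D.taken σ) :
    (dispProg.exec V s).nat nDisp 0 0 = D.displaced σ := by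
  classical
  rw [dispProg, Prog.exec_seq]
  set s₁ := (Prog.setNat nDisp (Exp.lit 0) (Exp.lit 0) (Exp.lit 0)).exec V s with hs₁
  have h₁ : Tables V D σ s₁ := h.exec _ (by decide) (by decide)
  have hl₁ : s₁.nat nLevel 0 0 = D.level σ := by rw [hs₁, Prog.nat_exec _ (by decide), hl]
  have ht₁ : s₁.nat nTaken 0 0 = D.taken σ := by rw [hs₁, Prog.nat_exec _ (by decide), ht]
  have hd₁ : s₁.nat nDisp 0 0 = 0 := by simp [hs₁]
  rw [Prog.exec_ite, Market.displaced]
  simp only [Exp.holds_lt, Exp.natVal_readNat, Exp.natVal_lit, hl₁]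
  split_ifs with hlt
  · exact hd₁
  rw [← h.rep.size₁_eq s₁]
  refine Prog.exec_loop (fun c t => t.nat nDisp 0 0 =
    lastSat (fun f => ∃ e₃ < D.size, D.Edge σ (D.taken σ) f e₃ ∧ D.Reach σ (D.level σ - 2) e₃) c)
    (by simp [hd₁, lastSat]) ?_
  intro f hf t hn hr ih
  rw [h.rep.size₁_eq] at hf
  set t₀ := t.setNat cF 0 0 f with ht₀
  have hT : Tables V D σ t₀ :=
    (h₁.congr (fun y hy => hn y (by revert y; decide))
      (fun y hy => hr y (by revert y; decide))).setNat 0 0 f (by decide)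
  have hl₂ : t₀.nat nLevel 0 0 = D.level σ := by
    rw [ht₀, Store.nat_setNat_of_ne _ _ _ _ (by decide), hn _ (by decide), hl₁]
  have ht₂ : t₀.nat nTaken 0 0 = D.taken σ := by
    rw [ht₀, Store.nat_setNat_of_ne _ _ _ _ (by decide), hn _ (by decide), ht₁]
  have hf₂ : t₀.nat cF 0 0 = f := by simp [ht₀]
  have hd₂ : t₀.nat nDisp 0 0 = t.nat nDisp 0 0 := by
    rw [ht₀, Store.nat_setNat_of_ne _ _ _ _ (by decide)]
  have key := Prog.exec_loop (V := V) (s := t₀) (x := cH) (a := .size)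
    (p := .ite (.and (Exp.edge (.var nTaken) (.var cF) (.var cH))
          (.readNat nReach (.sub (.var nLevel) (.lit 2)) (.var cH)))
        (.setNat nDisp (.lit 0) (.lit 0) (.add (.var cF) (.lit 1))) .skip)
    (fun c u => u.nat nDisp 0 0 = if ∃ e₃ < c, D.Edge σ (D.taken σ) f e₃ ∧
      D.Reach σ (D.level σ - 2) e₃ then f + 1 else t.nat nDisp 0 0) (by simp [hd₂]) ?_
  · rw [key, lastSat, ih, h.rep.size_eq]
    congr
  intro g hg u hnu hru ihu
  rw [h.rep.size_eq] at hg
  have hU : Tables V D σ (u.setNat cH 0 0 g) :=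
    (hT.congr (fun y hy => hnu y (by revert y; decide))
      (fun y hy => hru y (by revert y; decide))).setNat 0 0 g (by decide)
  have hl₃ : (u.setNat cH 0 0 g).nat nLevel 0 0 = D.level σ := by
    rw [Store.nat_setNat_of_ne _ _ _ _ (by decide), hnu _ (by decide), hl₂]
  have ht₃ : (u.setNat cH 0 0 g).nat nTaken 0 0 = D.taken σ := by
    rw [Store.nat_setNat_of_ne _ _ _ _ (by decide), hnu _ (by decide), ht₂]
  have hf₃ : (u.setNat cH 0 0 g).nat cF 0 0 = f := by
    rw [Store.nat_setNat_of_ne _ _ _ _ (by decide), hnu _ (by decide), hf₂]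
  have hd₃ : (u.setNat cH 0 0 g).nat nDisp = u.nat nDisp :=
    Store.nat_setNat_of_ne _ _ _ _ (by decide)
  have hle := level_le (D := D) (σ := σ)
  have hR := hU.reach (D.level σ - 2) (by omega) g (by omega)
  have hE := hU.rep.holds_edge hU.exch (e := .var nTaken) (f := .var cF) (g := .var cH)
    (by simp only [Exp.natVal_readNat, Exp.natVal_lit, ht₃]; exact taken_lt)
    (by simp only [Exp.natVal_readNat, Exp.natVal_lit, hf₃]; exact hf)
  rw [Prog.exec_ite]
  simp only [Exp.holds_and, hE, Exp.holds_readNat, Exp.natVal_readNat, Exp.natVal_lit,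
    Exp.natVal_sub, hl₃, ht₃, hf₃, Store.nat_setNat_self, and_self, if_true, hR]
  split_ifs with hc hex hex
  · simp [hf₃]
  · exact absurd ⟨g, by omega, hc⟩ hex
  · rw [Prog.exec_skip, hd₃, ihu, if_pos]
    obtain ⟨e₃, he₃, hh⟩ := hex
    rcases Nat.lt_succ_iff_lt_or_eq.1 he₃ with h' | rfl
    · exact ⟨e₃, h', hh⟩
    · exact absurd hh hc
  · rw [Prog.exec_skip, hd₃, ihu, if_neg]
    rintro ⟨e₃, he₃, hh⟩
    exact hex ⟨e₃, by omega, hh⟩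

/-- Carry out the exchange of owners. -/
def moveProg : Prog :=
  .setNat nNext (.lit 0) (.lit 0) (.lit 0) ;;
  .ite (.var nDisp)
    (.setNat nNext (.lit 0) (.lit 0) (.cell nOwn (.sub (.var nDisp) (.lit 1))) ;;
      .setNat nOwn (.lit 0) (.sub (.var nDisp) (.lit 1)) (.lit 0)) .skip ;;
  .setNat nOwn (.lit 0) (.var nTaken) (.cell nOwn .size) ;;
  .setNat nOwn (.lit 0) .size (.var nNext)

theorem exec_move (h : Represents V D σ s) (ht : s.nat nTaken 0 0 = D.taken σ)
    (hd : s.nat nDisp 0 0 = D.displaced σ) :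
    Represents V D (D.advance σ) (moveProg.exec V s) := by
  have hreal : ∀ y, (moveProg.exec V s).real y = s.real y := fun y =>
    Prog.real_exec _ (by simp [moveProg, Prog.realWrites]) s
  refine ⟨h.size, h.ind, (hreal _).trans h.wt, ?_, ?_, ?_⟩
  · funext x
    have hsz := h.size
    by_cases hc : D.displaced σ = 0
    · simp only [moveProg, Prog.exec_seq, Prog.exec_setNat, Exp.natVal_lit, Prog.exec_ite,
        Exp.holds_readNat, Exp.natVal_readNat, Exp.natVal_add, Exp.natVal_numElements,
        Exp.natVal_numAgents, Store.nat_setNat_self]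
      simp [Store.nat_setNat_of_ne, hd, ht, hc, h.own, ← h.size, Market.advance,
        Function.update_apply]
    · simp only [moveProg, Prog.exec_seq, Prog.exec_setNat, Exp.natVal_lit, Prog.exec_ite,
        Exp.holds_readNat, Exp.natVal_readNat, Exp.natVal_add, Exp.natVal_numElements,
        Exp.natVal_numAgents, Store.nat_setNat_self]
      simp [Store.nat_setNat_of_ne, hd, ht, hc, h.own, ← h.size, Market.advance,
        Function.update_apply]
  · rw [hreal, h.util]; rfl
  · rw [hreal, h.price]; rfl

/-- An augmentation step. -/
def advanceProg : Prog := levelProg ;; takenProg ;; dispProg ;; moveProg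

theorem exec_advance (h : Tables V D σ s) :
    Represents V D (D.advance σ) (advanceProg.exec V s) := by
  have h₁ : Tables V D σ (levelProg.exec V s) := h.exec _ (by decide) (by decide)
  have hl₁ := exec_level h
  have h₂ : Tables V D σ (takenProg.exec V (levelProg.exec V s)) := h₁.exec _ (by decide) (by decide)
  have hl₂ : (takenProg.exec V (levelProg.exec V s)).nat nLevel 0 0 = D.level σ := by
    rw [Prog.nat_exec _ (by decide), hl₁]
  have ht₂ := exec_taken h₁ hl₁
  have h₃ := h₂.exec dispProg (by decide) (by decide)
  have ht₃ : (dispProg.exec V (takenProg.exec V (levelProg.exec V s))).nat nTaken 0 0 =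
      D.taken σ := by
    rw [Prog.nat_exec _ (by decide), ht₂]
  exact exec_move h₃.rep ht₃ (exec_disp h₂ hl₂ ht₂)

end

/-! ### A program for the change of the dual variables -/

section
variable {n : ℕ} {V : View n} {D : Market} {σ : Ledger} {s t : Store} {m j : ℕ}

/-- Compute the smallest slack of a move into the set of reached elements. The flag `nFlag` tells
whether such a move has been found yet. -/
def gapProg : Prog :=
  .setNat nFlag (.lit 0) (.lit 0) (.lit 0) ;;
  .setReal rGap (.lit 0) (.lit 0) (.cast (.lit 0)) ;;
  .loop cE .size₁ (.loop cF .size₁ (.loop cH .size (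
    .ite (.and (.and (.not (.readNat nReach .size₁ (.var cE))) (.readNat nExch (.var cE) (.var cF)))
        (.and (.readNat nReach .size₁ (.var cH))
          (.or (.not (.var nFlag))
            (.leReal (.subReal (Exp.gain (.var cF) (.var cH))
              (Exp.loss (.var cE) (.var cF) (.var cH))) (.readReal rGap (.lit 0) (.lit 0))))))
      (.setNat nFlag (.lit 0) (.lit 0) (.lit 1) ;;
        .setReal rGap (.lit 0) (.lit 0) (.subReal (Exp.gain (.var cF) (.var cH))
          (Exp.loss (.var cE) (.var cF) (.var cH)))) .skip)))

theorem exec_gap (h : Tables V D σ s) : (gapProg.exec V s).real rGap 0 0 = D.gap σ := by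
  classical
  let Good : ℕ × ℕ × ℕ → Prop := fun q =>
    ¬ D.Reached σ q.1 ∧ D.Exch σ q.1 q.2.1 ∧ D.Reached σ q.2.2
  let T : Set (ℕ × ℕ × ℕ) → Set ℝ := fun S =>
    {v | ∃ q ∈ S, Good q ∧ v = D.slack σ q.1 q.2.1 q.2.2}
  -- `Acc S` describes the memory after the passes for the triples in `S`
  let Acc : Set (ℕ × ℕ × ℕ) → Store → Prop := fun S t =>
    (t.nat nFlag 0 0 = 0 ∧ T S = ∅ ∧ t.real rGap 0 0 = 0) ∨
      (t.nat nFlag 0 0 ≠ 0 ∧ IsLeast (T S) (t.real rGap 0 0))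
  have hAcc : ∀ S t x i, x ≠ nFlag → Acc S t → Acc S (t.setNat x 0 0 i) := fun S t x i hx ha => by
    simp only [Acc, Store.nat_setNat_of_ne _ _ _ _ (Ne.symm hx), Store.real_setNat]
    exact ha
  have hins : ∀ q S, T (insert q S) =
      if Good q then insert (D.slack σ q.1 q.2.1 q.2.2) (T S) else T S := fun q S => by
    ext v
    split_ifs with hg
    · constructor
      · rintro ⟨q', hq' | hq', hg', rfl⟩
        · exact Or.inl (by rw [hq'])
        · exact Or.inr ⟨q', hq', hg', rfl⟩
      · rintro (rfl | ⟨q', hq', hg', rfl⟩)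
        · exact ⟨q, Or.inl rfl, hg, rfl⟩
        · exact ⟨q', Or.inr hq', hg', rfl⟩
    · constructor
      · rintro ⟨q', hq' | hq', hg', rfl⟩
        · exact absurd (hq' ▸ hg') hg
        · exact ⟨q', hq', hg', rfl⟩
      · rintro ⟨q', hq', hg', rfl⟩
        exact ⟨q', Or.inr hq', hg', rfl⟩
  rw [gapProg, Prog.exec_seq, Prog.exec_seq]
  set s₁ := (Prog.setReal rGap (.lit 0) (.lit 0) (.cast (.lit 0))).exec V
    ((Prog.setNat nFlag (.lit 0) (.lit 0) (.lit 0)).exec V s) with hs₁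
  have h₁ : Tables V D σ s₁ :=
    (h.exec _ (by decide) (by decide)).exec _ (by decide) (by decide)
  have h0 : Acc ∅ s₁ := by
    refine Or.inl ⟨by simp [hs₁], ?_, by simp [hs₁]⟩
    simp [T]
  have main := Prog.exec_loop (V := V) (s := s₁) (x := cE) (a := .size₁)
    (p := .loop cF .size₁ (.loop cH .size (
      .ite (.and (.and (.not (.readNat nReach .size₁ (.var cE)))
          (.readNat nExch (.var cE) (.var cF)))
        (.and (.readNat nReach .size₁ (.var cH))
          (.or (.not (.var nFlag))
            (.leReal (.subReal (Exp.gain (.var cF) (.var cH))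
              (Exp.loss (.var cE) (.var cF) (.var cH))) (.readReal rGap (.lit 0) (.lit 0))))))
      (.setNat nFlag (.lit 0) (.lit 0) (.lit 1) ;;
        .setReal rGap (.lit 0) (.lit 0) (.subReal (Exp.gain (.var cF) (.var cH))
          (Exp.loss (.var cE) (.var cF) (.var cH)))) .skip)))
    (fun c t => Acc {q | q.1 < c ∧ q.2.1 < D.size + 1 ∧ q.2.2 < D.size} t) (by simpa using h0) ?_
  · rw [h₁.rep.size₁_eq] at main
    have hT : T {q | q.1 < D.size + 1 ∧ q.2.1 < D.size + 1 ∧ q.2.2 < D.size} =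
        {v | ∃ e < D.size + 1, ∃ f < D.size + 1, ∃ e₂ < D.size,
          ¬ D.Reached σ e ∧ D.Exch σ e f ∧ D.Reached σ e₂ ∧ v = D.slack σ e f e₂} := by
      ext v
      constructor
      · rintro ⟨⟨e, f, g⟩, ⟨he, hf, hg⟩, ⟨a, b, c⟩, hv⟩
        exact ⟨e, he, f, hf, g, hg, a, b, c, hv⟩
      · rintro ⟨e, he, f, hf, g, hg, a, b, c, hv⟩
        exact ⟨⟨e, f, g⟩, ⟨he, hf, hg⟩, ⟨a, b, c⟩, hv⟩
    rw [Market.gap, ← hT]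
    rcases main with ⟨-, h2, h3⟩ | ⟨-, h2⟩
    · rw [h3, h2, Real.sInf_empty]
    · exact h2.csInf_eq.symm
  intro e he t hn hr ih
  rw [h₁.rep.size₁_eq] at he
  have hT : Tables V D σ (t.setNat cE 0 0 e) :=
    (h₁.congr (fun y hy => hn y (by revert y; decide))
      (fun y hy => hr y (by revert y; decide))).setNat 0 0 e (by decide)
  have key := Prog.exec_loop₂ (V := V) (s := t.setNat cE 0 0 e) (x₁ := cF) (x₂ := cH)
    (a₁ := .size₁) (a₂ := .size)
    (p := .ite (.and (.and (.not (.readNat nReach .size₁ (.var cE)))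
          (.readNat nExch (.var cE) (.var cF)))
        (.and (.readNat nReach .size₁ (.var cH))
          (.or (.not (.var nFlag))
            (.leReal (.subReal (Exp.gain (.var cF) (.var cH))
              (Exp.loss (.var cE) (.var cF) (.var cH))) (.readReal rGap (.lit 0) (.lit 0))))))
      (.setNat nFlag (.lit 0) (.lit 0) (.lit 1) ;;
        .setReal rGap (.lit 0) (.lit 0) (.subReal (Exp.gain (.var cF) (.var cH))
          (Exp.loss (.var cE) (.var cF) (.var cH)))) .skip)
    (A₁ := D.size + 1) (A₂ := D.size) Acc (fun f g => (e, f, g))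
    (S₀ := {q | q.1 < e ∧ q.2.1 < D.size + 1 ∧ q.2.2 < D.size}) (hAcc _ _ _ _ (by decide) ih)
    h.rep.size₁_eq h.rep.size_eq (by decide)
    (fun S w i hw => ⟨hAcc _ _ _ _ (by decide) hw, hAcc _ _ _ _ (by decide) hw⟩) ?_
  · convert key using 1
    ext ⟨e', f, g⟩
    constructor
    · rintro ⟨he', hf, hg⟩
      dsimp only at he' hf hg
      rcases Nat.lt_succ_iff_lt_or_eq.1 he' with h' | rfl
      · exact Or.inl ⟨h', hf, hg⟩
      · exact Or.inr ⟨f, hf, g, hg, rfl⟩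
    · rintro (⟨he', hf, hg⟩ | ⟨f', hf, g', hg, heq⟩)
      · exact ⟨Nat.lt_succ_of_lt he', hf, hg⟩
      · obtain ⟨rfl, rfl, rfl⟩ := heq
        exact ⟨Nat.lt_succ_self _, hf, hg⟩
  intro f hf g hg S w hnw hrw hwf hwg hacc
  have hW : Tables V D σ w :=
    hT.congr (fun y hy => hnw y (by revert y; decide)) (fun y hy => hrw y (by revert y; decide))
  have hwe : w.nat cE 0 0 = e := by rw [hnw _ (by decide)]; simp
  have hR₁ := hW.reach (D.size + 1) (by omega) e (by omega)
  have hR₂ := hW.reach (D.size + 1) (by omega) g (by omega)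
  have hE := hW.exch e he f hf
  have hslack := hW.rep.gain_sub_loss (.var cE) (.var cF) (.var cH)
  simp only [Exp.natVal_readNat, Exp.natVal_lit, hwe, hwf, hwg] at hslack
  have hcond : (Exp.and (.and (.not (.readNat nReach .size₁ (.var cE)))
          (.readNat nExch (.var cE) (.var cF)))
        (.and (.readNat nReach .size₁ (.var cH))
          (.or (.not (.var nFlag))
            (.leReal (.subReal (Exp.gain (.var cF) (.var cH))
              (Exp.loss (.var cE) (.var cF) (.var cH)))
              (.readReal rGap (.lit 0) (.lit 0)))))).Holds V w ↔
      Good (e, f, g) ∧ (w.nat nFlag 0 0 = 0 ∨ D.slack σ e f g ≤ w.real rGap 0 0) := by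
    simp only [Exp.holds_and, Exp.holds_or, Exp.holds_not, Exp.holds_readNat, Exp.holds_leReal,
      Exp.realVal_subReal, Exp.realVal_readReal, Exp.natVal_readNat, Exp.natVal_lit, hwe, hwf, hwg,
      hslack, h.rep.size₁_eq, hR₁, hR₂, hE, Good, not_not]
    tauto
  rw [Prog.exec_ite, if_congr hcond rfl rfl]
  split_ifs with hc
  · obtain ⟨hgood, hc⟩ := hc
    right
    rw [hins, if_pos hgood]
    have e1 : ((Prog.setNat nFlag (.lit 0) (.lit 0) (.lit 1) ;;
        .setReal rGap (.lit 0) (.lit 0) (.subReal (Exp.gain (.var cF) (.var cH))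
          (Exp.loss (.var cE) (.var cF) (.var cH)))).exec V w).real rGap 0 0 =
        D.slack σ e f g := by
      have hW' : Tables V D σ (w.setNat nFlag 0 0 1) := hW.setNat 0 0 1 (by decide)
      have := hW'.rep.gain_sub_loss (.var cE) (.var cF) (.var cH)
      simp only [Exp.natVal_readNat, Exp.natVal_lit] at this
      rw [Store.nat_setNat_of_ne _ _ _ _ (by decide), Store.nat_setNat_of_ne _ _ _ _ (by decide),
        Store.nat_setNat_of_ne _ _ _ _ (by decide), hwe, hwf, hwg] at this
      simp only [Prog.exec_seq, Prog.exec_setNat, Prog.exec_setReal, Exp.natVal_lit,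
        Exp.realVal_subReal, this, Store.real_setReal_self, and_self, if_true]
    rw [e1]
    refine ⟨by simp, Or.inl rfl, ?_⟩
    rintro v (rfl | hv)
    · exact le_rfl
    · rcases hacc with ⟨h1, h2, h3⟩ | ⟨h1, h2⟩
      · rw [h2] at hv; exact absurd hv (Set.notMem_empty _)
      · rcases hc with hc | hc
        · exact absurd hc h1
        · exact hc.trans (h2.2 hv)
  · rw [Prog.exec_skip]
    simp only [Acc, hins]
    split_ifs with hgood
    · rw [not_and] at hc
      have hc := hc hgood
      rw [not_or, not_le] at hc
      rcases hacc with ⟨h1, h2, h3⟩ | ⟨h1, h2⟩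
      · exact absurd h1 hc.1
      · refine Or.inr ⟨h1, Or.inr h2.1, ?_⟩
        rintro v (rfl | hv)
        · exact hc.2.le
        · exact h2.2 hv
    · exact hacc

/-- Change the dual variables. -/
def updateProg : Prog :=
  .loop cE .size₁ (.ite (.readNat nReach .size₁ (.var cE)) .skip (
    .setReal rPrice (.lit 0) (.var cE) (.addReal (.readReal rPrice (.lit 0) (.var cE))
      (.readReal rGap (.lit 0) (.lit 0))) ;;
    .ite (.cell nOwn (.var cE))
      (.setReal rUtil (.lit 0) (.sub (.cell nOwn (.var cE)) (.lit 1))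
        (.subReal (.readReal rUtil (.lit 0) (.sub (.cell nOwn (.var cE)) (.lit 1)))
          (.readReal rGap (.lit 0) (.lit 0)))) .skip))

theorem exec_update (h : Tables V D σ s) (hg : s.real rGap 0 0 = D.gap σ)
    (hv : D.Valid σ m j) : Represents V D (D.raise σ) (updateProg.exec V s) := by
  classical
  have key := Prog.exec_loop (V := V) (s := s) (x := cE) (a := .size₁)
    (p := .ite (.readNat nReach .size₁ (.var cE)) .skip (
      .setReal rPrice (.lit 0) (.var cE) (.addReal (.readReal rPrice (.lit 0) (.var cE))
        (.readReal rGap (.lit 0) (.lit 0))) ;;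
      .ite (.cell nOwn (.var cE))
        (.setReal rUtil (.lit 0) (.sub (.cell nOwn (.var cE)) (.lit 1))
          (.subReal (.readReal rUtil (.lit 0) (.sub (.cell nOwn (.var cE)) (.lit 1)))
            (.readReal rGap (.lit 0) (.lit 0)))) .skip))
    (fun c t => t.real rPrice 0 = (fun e => if e < c ∧ ¬ D.Reached σ e then σ.price e + D.gap σ
        else σ.price e) ∧
      t.real rUtil 0 = fun a => if ∃ f < c, σ.own f = a + 1 ∧ ¬ D.Reached σ f
        then σ.util a - D.gap σ else σ.util a) (by simp [h.rep.price, h.rep.util]) ?_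
  · rw [h.rep.size₁_eq] at key
    refine ⟨h.rep.size, h.rep.ind, ?_, ?_, key.2, key.1⟩
    · rw [updateProg, Prog.real_exec _ (by decide), h.rep.wt]
    · rw [updateProg, Prog.nat_exec _ (by decide), h.rep.own]; rfl
  intro e he t hn hr ih
  rw [h.rep.size₁_eq] at he
  set t₀ := t.setNat cE 0 0 e with ht₀
  have hE : t₀.nat cE 0 0 = e := by simp [ht₀]
  have hO : t₀.nat nOwn 0 = σ.own := by
    rw [ht₀, Store.nat_setNat_of_ne _ _ _ _ (by decide), hn _ (by decide), h.rep.own]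
  have hG : t₀.real rGap 0 0 = D.gap σ := by
    rw [ht₀, Store.real_setNat, hr _ (by decide), hg]
  have hR : t₀.nat nReach (D.size + 1) e ≠ 0 ↔ D.Reached σ e := by
    rw [ht₀, Store.nat_setNat_of_ne _ _ _ _ (by decide), hn _ (by decide)]
    exact h.reach (D.size + 1) (by omega) e (by omega)
  have hcond : (Exp.readNat nReach .size₁ (.var cE)).Holds V t₀ ↔ D.Reached σ e := by
    simp only [Exp.holds_readNat, Exp.natVal_readNat, Exp.natVal_lit, hE, h.rep.size₁_eq, hR]
  have hP : t₀.real rPrice 0 = t.real rPrice 0 := rfl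
  have hU : t₀.real rUtil 0 = t.real rUtil 0 := rfl
  rw [Prog.exec_ite, if_congr hcond rfl rfl]
  split_ifs with hre
  · rw [Prog.exec_skip, hP, hU, ih.1, ih.2]
    constructor
    · funext x
      refine if_congr ⟨fun hx => ⟨by omega, hx.2⟩, fun hx => ⟨?_, hx.2⟩⟩ rfl rfl
      rcases Nat.lt_succ_iff_lt_or_eq.1 hx.1 with h' | rfl
      · exact h'
      · exact absurd hre hx.2
    · funext a
      refine if_congr ⟨fun ⟨f, hf, hx⟩ => ⟨f, by omega, hx⟩, fun ⟨f, hf, hx⟩ => ⟨f, ?_, hx⟩⟩ rfl rfl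
      rcases Nat.lt_succ_iff_lt_or_eq.1 hf with h' | rfl
      · exact h'
      · exact absurd hre hx.2
  rw [Prog.exec_seq]
  set u := (Prog.setReal rPrice (.lit 0) (.var cE) (.addReal (.readReal rPrice (.lit 0) (.var cE))
      (.readReal rGap (.lit 0) (.lit 0)))).exec V t₀ with hu
  have hun : u.nat = t₀.nat := rfl
  have hp : u.real rPrice 0 = fun x => if x < e + 1 ∧ ¬ D.Reached σ x then σ.price x + D.gap σ
      else σ.price x := by
    funext x
    simp only [hu, Prog.exec_setReal, Exp.natVal_lit, Exp.natVal_readNat, hE, Exp.realVal_addReal,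
      Exp.realVal_readReal, hG, Store.real_setReal_self, true_and, hP, ih.1]
    by_cases hx : x = e
    · subst hx
      simp [hre]
    · rw [if_neg hx]
      exact if_congr ⟨fun hx' => ⟨by omega, hx'.2⟩, fun hx' => ⟨by omega, hx'.2⟩⟩ rfl rfl
  have huU : u.real rUtil = t₀.real rUtil := Prog.real_exec _ (by decide) _
  have huG : u.real rGap = t₀.real rGap := Prog.real_exec _ (by decide) _
  have hcond₂ : (Exp.cell nOwn (.var cE)).Holds V u ↔ σ.own e ≠ 0 := by
    simp only [Exp.holds_readNat, Exp.natVal_readNat, Exp.natVal_lit, hun, hE, hO]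
  rw [Prog.exec_ite, if_congr hcond₂ rfl rfl]
  split_ifs with ho
  · constructor
    · rw [Prog.real_exec _ (by decide), hp]
    · funext a
      simp only [Prog.exec_setReal, Exp.natVal_lit, Exp.natVal_readNat, Exp.natVal_sub, hun, hE, hO,
        Exp.realVal_subReal, Exp.realVal_readReal, huG, hG, Store.real_setReal_self, true_and, huU,
        hU, ih.2]
      by_cases ha : a = σ.own e - 1
      · subst ha
        have hold : ¬ ∃ f < e, σ.own f = σ.own e - 1 + 1 ∧ ¬ D.Reached σ f := by
          rintro ⟨f, hf, hf', -⟩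
          have := hv.inj e he f (by omega) ho (by omega)
          omega
        rw [if_pos rfl, if_neg hold, if_pos ⟨e, by omega, by omega, hre⟩]
      · rw [if_neg ha]
        refine if_congr ⟨fun ⟨f, hf, hx⟩ => ⟨f, by omega, hx⟩, fun ⟨f, hf, hx⟩ => ⟨f, ?_, hx⟩⟩
          rfl rfl
        rcases Nat.lt_succ_iff_lt_or_eq.1 hf with h' | rfl
        · exact h'
        · omega
  · rw [Prog.exec_skip, hp, huU, hU, ih.2]
    refine ⟨rfl, ?_⟩
    funext a
    refine if_congr ⟨fun ⟨f, hf, hx⟩ => ⟨f, by omega, hx⟩, fun ⟨f, hf, hx⟩ => ⟨f, ?_, hx⟩⟩ rfl rfl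
    rcases Nat.lt_succ_iff_lt_or_eq.1 hf with h' | rfl
    · exact h'
    · omega

/-- One step of the primal-dual method. -/
def stepProg : Prog :=
  .ite (.cell nOwn .size)
    (exchProg ;; reachProg ;;
      .ite (.readNat nReach .size₁ .size) advanceProg (gapProg ;; updateProg)) .skip

theorem exec_step (h : Represents V D σ s) (hv : D.Valid σ m j) :
    Represents V D (D.step σ) (stepProg.exec V s) := by
  classical
  have hc : (Exp.cell nOwn .size).Holds V s ↔ ¬ σ.own D.size = 0 := by
    rw [Exp.holds_readNat, h.size_eq, Exp.natVal_lit, h.own]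
  rw [stepProg, Prog.exec_ite, if_congr hc rfl rfl, Market.step, ite_not]
  split_ifs with h0 hr
  · exact h
  all_goals
    have h₁ := exec_exch h
    have hR₁ : Represents V D σ (exchProg.exec V s) :=
      h.congr (Prog.nat_exec _ (by decide) _) (Prog.real_exec _ (by decide) _)
        (Prog.real_exec _ (by decide) _) (Prog.real_exec _ (by decide) _)
    have h₂ := exec_reach hR₁ h₁.1 h₁.2
    have hT : Tables V D σ (reachProg.exec V (exchProg.exec V s)) :=
      ⟨hR₁.congr (Prog.nat_exec _ (by decide) _) (Prog.real_exec _ (by decide) _)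
        (Prog.real_exec _ (by decide) _) (Prog.real_exec _ (by decide) _),
        h₁.1.congr (Prog.nat_exec _ (by decide) _), h₂⟩
    have hc₂ : (Exp.readNat nReach .size₁ .size).Holds V (reachProg.exec V (exchProg.exec V s)) ↔
        D.Reached σ D.size := by
      rw [Exp.holds_readNat, h.size₁_eq, h.size_eq]
      exact hT.reach _ (by omega) _ (by omega)
    rw [Prog.exec_seq, Prog.exec_seq, Prog.exec_ite, if_congr hc₂ rfl rfl]
  · rw [if_pos hr]; exact exec_advance hT
  · rw [if_neg hr, Prog.exec_seq]
    exact exec_update (hT.exec _ (by decide) (by decide)) (exec_gap hT) hv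

end

/-! ### A program for the offline problem -/

/-- Nothing is recorded outside of the elements and the `m` agents. -/
structure Ledger.Clean (σ : Ledger) (L m : ℕ) : Prop where
  own : ∀ e, L < e → σ.own e = 0
  util : ∀ a, m ≤ a → σ.util a = 0
  price : ∀ e, L < e → σ.price e = 0

section
variable {D : Market} {σ : Ledger} {N : Matroid ℕ} {n m j : ℕ}

theorem displaced_le : D.displaced σ ≤ D.size + 1 := by
  rw [Market.displaced]
  split_ifs
  · omega
  · by_contra hc
    have := (lastSat_spec (Q := fun f => ∃ e₃ < D.size, D.Edge σ (D.taken σ) f e₃ ∧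
      D.Reach σ (D.level σ - 2) e₃) (c := D.size + 1) (by omega)).1
    omega

theorem Ledger.Clean.step (h : σ.Clean D.size m) (hv : D.Valid σ m j) (hj : j ≤ m) :
    (D.step σ).Clean D.size m := by
  rw [Market.step]
  split_ifs with h1 h2
  · exact h
  · refine ⟨fun e he => ?_, h.util, h.price⟩
    have h3 := taken_lt (D := D) (σ := σ)
    have h4 := displaced_le (D := D) (σ := σ)
    have h5 := h.own e he
    simp only [Market.advance]
    rw [Function.update_of_ne (by omega), Function.update_of_ne (by omega)]
    split_ifs
    · rw [Function.update_of_ne (by omega), h5]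
    · exact h5
  · refine ⟨h.own, fun a ha => ?_, fun e he => ?_⟩
    · simp only [Market.raise]
      rw [if_neg, h.util a ha]
      rintro ⟨f, hf, hf', -⟩
      have := hv.le f hf
      omega
    · simp only [Market.raise]
      rw [if_neg (by omega), h.price e he]

theorem Ledger.Clean.iterate_step (h : σ.Clean D.size m) (hv : D.Valid σ m j)
    (hD : D.IsFree N n m) (hj : j ≤ m) (c : ℕ) : (D.step^[c] σ).Clean D.size m := by
  induction c with
  | zero => exact h
  | succ c ih =>
    rw [Function.iterate_succ_apply']
    exact ih.step (hv.iterate_step hD hj c).1 hj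

theorem Ledger.Clean.enter (h : σ.Clean D.size m) (j : ℕ) : (D.enter σ j).Clean D.size m :=
  ⟨fun e he => by
    simp only [Market.enter]; rw [Function.update_of_ne (by omega), h.own e he], h.util, h.price⟩

end

/-- Initialize the utilities by the sums of the weights. -/
def utilProg : Prog :=
  .loop cJ .numAgents (
    .setReal rUtil (.lit 0) (.var cJ) (.cast (.lit 0)) ;;
    .loop cE .size (.setReal rUtil (.lit 0) (.var cJ)
      (.addReal (.readReal rUtil (.lit 0) (.var cJ)) (.readReal rW (.var cJ) (.var cE)))))

/-- Initialize the owners and the prices. -/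
def clearProg : Prog :=
  .loop cE .size₁ (.setNat nOwn (.lit 0) (.var cE) (.lit 0) ;;
    .setReal rPrice (.lit 0) (.var cE) (.cast (.lit 0)))

/-- Serve the agents. -/
def serveProg : Prog :=
  .loop cJ .numAgents (
    .setNat nOwn (.lit 0) .size (.add (.var cJ) (.lit 1)) ;;
    .loop cT (.add (.add .size .size) (.lit 4)) stepProg)

/-- The primal-dual method. -/
def solveProg : Prog := utilProg ;; clearProg ;; serveProg

section
variable {n m : ℕ} {V : View n} {D : Market} {σ : Ledger} {s t : Store} {N : Matroid ℕ}

theorem exec_util (hs : D.size = n + V.numAgents) (hW : s.real rW = D.wt) (a : ℕ) :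
    (utilProg.exec V s).real rUtil 0 a = if a < V.numAgents then ∑ e ∈ Finset.range D.size, D.wt a e
      else s.real rUtil 0 a := by
  revert a
  refine Prog.exec_loop (fun c t => ∀ a, t.real rUtil 0 a =
    if a < c then ∑ e ∈ Finset.range D.size, D.wt a e else s.real rUtil 0 a) (by simp) ?_
  intro i hi t hn hr ih a
  rw [Prog.exec_seq]
  set u := (Prog.setReal rUtil (.lit 0) (.var cJ) (.cast (.lit 0))).exec V (t.setNat cJ 0 0 i)
    with hu
  have huJ : u.nat cJ 0 0 = i := by simp [hu]
  have huU : ∀ a, u.real rUtil 0 a = if a = i then 0 else t.real rUtil 0 a := fun a => by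
    simp [hu]
  have huW : u.real rW = D.wt := by
    rw [hu, Prog.real_exec _ (by decide), Store.real_setNat, hr _ (by decide), hW]
  have hsz : Exp.size.natVal V u = D.size := by simp [hs]
  have key := Prog.exec_loop (V := V) (s := u) (x := cE) (a := .size)
    (p := .setReal rUtil (.lit 0) (.var cJ)
      (.addReal (.readReal rUtil (.lit 0) (.var cJ)) (.readReal rW (.var cJ) (.var cE))))
    (fun c v => ∀ a, v.real rUtil 0 a = if a = i then ∑ e ∈ Finset.range c, D.wt i e
      else t.real rUtil 0 a) (by simpa using huU) ?_
  · rw [hsz] at key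
    rw [key a, ih a]
    rcases lt_trichotomy a i with h | rfl | h
    · rw [if_neg h.ne, if_pos h, if_pos (by omega)]
    · rw [if_pos rfl, if_pos (by omega)]
    · rw [if_neg h.ne', if_neg (by omega), if_neg (by omega)]
  intro c hc v hnv hrv ihv a
  have e1 : (v.setNat cE 0 0 c).nat cJ 0 0 = i := by
    rw [Store.nat_setNat_of_ne _ _ _ _ (by decide), hnv _ (by decide), huJ]
  have e2 : v.real rW = D.wt := by rw [hrv _ (by decide), huW]
  simp only [Prog.exec_setReal, Exp.natVal_lit, Exp.natVal_readNat, e1, Exp.realVal_addReal,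
    Exp.realVal_readReal, Store.real_setNat, Store.real_setReal_self, true_and, e2, ihv,
    Store.nat_setNat_self, and_self, if_true, Finset.sum_range_succ]
  split_ifs <;> rfl

theorem exec_clear (hs : D.size = n + V.numAgents) (e : ℕ) :
    ((clearProg.exec V s).nat nOwn 0 e = if e < D.size + 1 then 0 else s.nat nOwn 0 e) ∧
      (clearProg.exec V s).real rPrice 0 e = if e < D.size + 1 then 0 else s.real rPrice 0 e := by
  have hsz : Exp.size₁.natVal V s = D.size + 1 := by simp [hs]
  rw [← hsz]
  revert e
  refine Prog.exec_loop (fun c t => ∀ e, (t.nat nOwn 0 e = if e < c then 0 else s.nat nOwn 0 e) ∧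
    t.real rPrice 0 e = if e < c then 0 else s.real rPrice 0 e) (by simp) ?_
  intro i hi t hn hr ih e
  simp [Store.nat_setNat_of_ne, (ih e).1, (ih e).2]
  rcases lt_trichotomy e i with h | rfl | h
  · simp [h, h.ne]; omega
  · simp
  · simp [h.ne', show ¬ e < i by omega]; omega

/-- The data of the offline problem are present in the memory, and the entries of the working
memory that are never initialized are zero. -/
structure Ready (V : View n) (D : Market) (m : ℕ) (s : Store) : Prop where
  numAgents : V.numAgents = m
  ind : D.Ind = fun S => V.indep (Finset.univ.filter fun e : Fin n => (e : ℕ) ∈ S)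
  wt : s.real rW = D.wt
  own : ∀ e, n + m < e → s.nat nOwn 0 e = 0
  util : ∀ a, m ≤ a → s.real rUtil 0 a = 0
  price : ∀ e, n + m < e → s.real rPrice 0 e = 0

theorem exec_solve (h : Ready V D m s) (hD : D.IsFree N n m) (hw : ∀ a e, 0 ≤ D.wt a e)
    (hwm : ∀ a e, m ≤ a → D.wt a e = 0) :
    Represents V D (D.serve m) (solveProg.exec V s) ∧ (D.serve m).Clean D.size m := by
  have hs : D.size = n + V.numAgents := by rw [hD.size_eq, h.numAgents]
  rw [solveProg, Prog.exec_seq, Prog.exec_seq]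
  set u := clearProg.exec V (utilProg.exec V s) with hu
  have hstart : D.start.Clean D.size m := by
    refine ⟨fun _ _ => rfl, fun a ha => ?_, fun _ _ => rfl⟩
    exact (Finset.sum_eq_zero fun e _ => hwm a e ha : ∑ e ∈ Finset.range D.size, D.wt a e = 0)
  have hR : Represents V D D.start u := by
    refine ⟨hs, h.ind, ?_, ?_, ?_, ?_⟩
    · rw [hu, Prog.real_exec _ (by decide), Prog.real_exec _ (by decide), h.wt]
    · funext e
      rw [hu, (exec_clear hs e).1]
      split_ifs with he
      · rfl
      · rw [Prog.nat_exec _ (by decide), h.own e (by rw [hD.size_eq] at he; omega)]; rfl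
    · funext a
      rw [hu, Prog.real_exec _ (by decide), exec_util hs h.wt]
      split_ifs with ha
      · rfl
      · rw [h.numAgents] at ha
        rw [h.util a (by omega), hstart.util a (by omega)]
    · funext e
      rw [hu, (exec_clear hs e).2]
      split_ifs with he
      · rfl
      · rw [Prog.real_exec _ (by decide), h.price e (by rw [hD.size_eq] at he; omega)]; rfl
  have hm : Exp.numAgents.natVal V u = m := by simp [h.numAgents]
  have key := Prog.exec_loop (V := V) (s := u) (x := cJ) (a := .numAgents)
    (p := .setNat nOwn (.lit 0) .size (.add (.var cJ) (.lit 1)) ;;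
      .loop cT (.add (.add .size .size) (.lit 4)) stepProg)
    (fun c t => Represents V D (D.serve c) t ∧ (D.serve c).Clean D.size m) ⟨hR, hstart⟩ ?_
  · rwa [hm] at key
  intro c hc t hn hr ⟨ih, ihc⟩
  rw [hm] at hc
  obtain ⟨hv, hv0⟩ := Market.valid_serve hD hw (j := c) (by omega)
  have hve := hv.enter hc hv0
  have hclean := ihc.enter c
  refine ⟨?_, hclean.iterate_step hve hD hc _⟩
  rw [Prog.exec_seq]
  set v := (Prog.setNat nOwn (.lit 0) .size (.add (.var cJ) (.lit 1))).exec V (t.setNat cJ 0 0 c)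
    with hvdef
  have hRv : Represents V D (D.enter (D.serve c) c) v := by
    refine ⟨hs, h.ind, ih.wt, ?_, ih.util, ih.price⟩
    funext e
    simp only [hvdef, Prog.exec_setNat, Exp.natVal_lit, ih.size_eq, Exp.natVal_add,
      Exp.natVal_readNat, Store.nat_setNat_self, and_self, if_true, true_and, Market.enter,
      Function.update_apply]
    split_ifs
    · rfl
    · rw [Store.nat_setNat_of_ne _ _ _ _ (by decide), ih.own]
  have hcount : Exp.natVal V v (.add (.add .size .size) (.lit 4)) = 2 * D.size + 4 := by
    rw [Exp.natVal_add, Exp.natVal_add, ih.size_eq, Exp.natVal_lit]; omega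
  rw [Market.serve, ← hcount]
  refine Prog.exec_loop (fun i w => Represents V D (D.step^[i] (D.enter (D.serve c) c)) w) hRv ?_
  intro i _ w hnw hrw ihw
  rw [Function.iterate_succ_apply']
  have hw' : Represents V D (D.step^[i] (D.enter (D.serve c) c)) (w.setNat cT 0 0 i) :=
    ihw.congr (Store.nat_setNat_of_ne _ _ _ _ (by decide)) rfl rfl rfl
  exact exec_step hw' (hve.iterate_step hD hc i).1

end

/-! ### Rounds of a certifier-based algorithm -/

-- The position of the arriving agent in the offline problem and the length of the observation phase;
-- the entry `(0, t)` of `nCode` and the row `t` of `nHeld` hold the tentative certificate of round `t`.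
notation "nPos" => (20 : ℕ)
notation "nThr" => (21 : ℕ)
notation "nCode" => (22 : ℕ)
notation "nHeld" => (23 : ℕ)

/-- The elements that the optimal assignment gives away. -/
noncomputable def heldSet {n m : ℕ} (M : Matroid (Fin n)) (X : Profile n m) : Finset (Fin n) :=
  Finset.univ.filter fun e : Fin n => finalOwn M X e ≠ 0

/-- The encoding of decisions by natural numbers. -/
def code {n : ℕ} : Option (Fin n) → ℕ
  | none => 0
  | some e => e + 1

/-- What a certifier-based algorithm does in the single rounds: in round `t` it solves the offline
problem of the profile `profile t`, looks at the element `e` that is given to the agent `pos t`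
there, and treats `(I, e)`, where `I` is the set of all elements given away, as a tentative
certificate. The rounds before `thr` are only observed. -/
structure Plan (n m : ℕ) where
  profile : Fin m → Profile n m
  pos : Fin m → Fin m
  thr : ℕ

namespace Plan

variable {n m : ℕ} (L : Plan n m) (M : Matroid (Fin n)) (B : Pair n → Pair n → Prop)

/-- The element of the tentative certificate. -/
noncomputable def tentative (t : Fin m) : Option (Fin n) :=
  if (t : ℕ) < L.thr then none else solve M (L.profile t) (L.pos t)

/-- The tentative certificate for `e` in round `t` is blocked by an earlier tentative
certificate. -/
def Blocked (t : Fin m) (e : Fin n) : Prop :=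
  ∃ s < t, ∃ f, L.tentative M s = some f ∧
    B (heldSet M (L.profile s), f) (heldSet M (L.profile t), e)

open Classical in
/-- The decision: a tentative element is given away unless it is blocked. -/
noncomputable def accepted (t : Fin m) : Option (Fin n) :=
  if ∃ e, L.tentative M t = some e ∧ L.Blocked M B t e then none else L.tentative M t

end Plan

/-- Record the tentative certificate. -/
def recordProg : Prog :=
  .loop cE .numElements (.setNat nHeld .round (.var cE) (.cell nOwn (.var cE))) ;;
  .setNat nCode (.lit 0) .round (.lit 0) ;;
  .loop cE .numElements (.ite (.and (.le (.var nThr) .round)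
      (.eq (.cell nOwn (.var cE)) (.add (.var nPos) (.lit 1))))
    (.setNat nCode (.lit 0) .round (.add (.var cE) (.lit 1))) .skip)

/-- Decide about the arriving agent. -/
def acceptProg : Prog :=
  .setNat nOut (.lit 0) (.lit 0) (.cell nCode .round) ;;
  .loop cT .numAgents (.ite (.and (.lt (.var cT) .round) (.and (.cell nCode (.var cT))
      (.blocks nHeld (.var cT) (.sub (.cell nCode (.var cT)) (.lit 1))
        nHeld .round (.sub (.cell nCode .round) (.lit 1)))))
    (.setNat nOut (.lit 0) (.lit 0) (.lit 0)) .skip)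

/-- The program that is executed in every round. The part `F` prepares the offline problem. -/
def roundProg (F : Prog) : Prog := F ;; solveProg ;; recordProg ;; acceptProg

section
variable {n m : ℕ} {V : View n} {s : Store} {M : Matroid (Fin n)} {B : Pair n → Pair n → Prop}

theorem exec_record (X : Profile n m) (p : Fin m) (N : ℕ) (hM : M.E = Set.univ)
    (hown : s.nat nOwn 0 = finalOwn M X) (hp : s.nat nPos 0 0 = p) (hN : s.nat nThr 0 0 = N) :
    (recordProg.exec V s).row n nHeld V.round = heldSet M X ∧
    (∀ i ≠ V.round, (recordProg.exec V s).nat nHeld i = s.nat nHeld i) ∧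
    (∀ i, (recordProg.exec V s).nat nCode 0 i = if i = V.round then
      code (if V.round < N then none else solve M X p) else s.nat nCode 0 i) := by
  classical
  rw [recordProg, Prog.exec_seq, Prog.exec_seq]
  set l₁ := Prog.loop cE .numElements (.setNat nHeld .round (.var cE) (.cell nOwn (.var cE)))
    with hl₁
  set u := (Prog.setNat nCode (.lit 0) .round (.lit 0)).exec V (l₁.exec V s) with hu
  have h₁ : (∀ e < n, (l₁.exec V s).nat nHeld V.round e = finalOwn M X e) ∧
      ∀ i ≠ V.round, (l₁.exec V s).nat nHeld i = s.nat nHeld i := by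
    refine Prog.exec_loop (V := V) (a := .numElements)
      (fun c t => (∀ e < c, t.nat nHeld V.round e = finalOwn M X e) ∧
      ∀ i ≠ V.round, t.nat nHeld i = s.nat nHeld i) ⟨by simp, by simp⟩ ?_
    intro i hi t hn hr ih
    refine ⟨fun e he => ?_, fun j hj => ?_⟩
    · by_cases hei : e = i
      · subst hei
        simp [Store.nat_setNat_of_ne, hn nOwn (by decide), hown]
      · simp [Store.nat_setNat_of_ne, hei, ih.1 e (by omega)]
    · funext e
      simp [Store.nat_setNat_of_ne, hj, ih.2 j hj]
  have hu₁ : u.nat nHeld = (l₁.exec V s).nat nHeld := Prog.nat_exec _ (by decide) _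
  have huC : ∀ i, u.nat nCode 0 i = if i = V.round then 0 else s.nat nCode 0 i := fun i => by
    simp only [hu, Prog.exec_setNat, Exp.natVal_lit, Exp.natVal_round, Store.nat_setNat_self,
      true_and]
    rw [Prog.nat_exec _ (by decide)]
  have huO : u.nat nOwn 0 = finalOwn M X := by
    rw [hu, Prog.nat_exec _ (by decide), Prog.nat_exec _ (by decide), hown]
  have huP : u.nat nPos 0 0 = p := by
    rw [hu, Prog.nat_exec _ (by decide), Prog.nat_exec _ (by decide), hp]
  have huN : u.nat nThr 0 0 = N := by
    rw [hu, Prog.nat_exec _ (by decide), Prog.nat_exec _ (by decide), hN]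
  have h₂ := Prog.exec_loop (V := V) (s := u) (x := cE) (a := .numElements)
    (p := .ite (.and (.le (.var nThr) .round)
      (.eq (.cell nOwn (.var cE)) (.add (.var nPos) (.lit 1))))
      (.setNat nCode (.lit 0) .round (.add (.var cE) (.lit 1))) .skip)
    (fun c t => ∀ i, t.nat nCode 0 i = if i = V.round then
      code (if V.round < N then none else (solve M X p).filter fun e => e < c)
        else s.nat nCode 0 i) ?_ ?_
  · refine ⟨?_, fun i hi => ?_, fun i => ?_⟩
    · ext e
      rw [Store.row, heldSet, Finset.mem_filter, Finset.mem_filter, Prog.nat_exec _ (by decide),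
        hu₁, h₁.1 e e.2]
    · rw [Prog.nat_exec _ (by decide), hu₁, h₁.2 i hi]
    · rw [h₂ i]
      have : (solve M X p).filter (fun e : Fin n => decide ((e : ℕ) < n)) = solve M X p := by
        cases solve M X p <;> simp
      rw [Exp.natVal_numElements, this]
  · intro i
    rw [huC]
    have : (solve M X p).filter (fun e : Fin n => decide ((e : ℕ) < 0)) = none := by
      cases solve M X p <;> simp
    rw [this]
    simp [code]
  intro c hc t hn hr ih i
  have hcn : c < n := hc
  have hcond : (Exp.and (.le (.var nThr) .round)
      (.eq (.cell nOwn (.var cE)) (.add (.var nPos) (.lit 1)))).Holds V (t.setNat cE 0 0 c) ↔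
      ¬ V.round < N ∧ solve M X p = some ⟨c, hcn⟩ := by
    rw [solve_eq_some_iff hM]
    simp [Store.nat_setNat_of_ne, hn nThr (by decide), hn nOwn (by decide), hn nPos (by decide),
      huO, huP, huN]
  rw [Prog.exec_ite, if_congr hcond rfl rfl]
  by_cases h1 : ¬ V.round < N ∧ solve M X p = some ⟨c, hcn⟩
  · rw [if_pos h1]
    by_cases h2 : i = V.round
    · simp [h2, h1.1, h1.2, code, Option.filter]
    · simp [h2, Store.nat_setNat_of_ne, ih i]
  rw [if_neg h1, Prog.exec_skip, Store.nat_setNat_of_ne _ _ _ _ (by decide), ih]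
  refine if_congr Iff.rfl ?_ rfl
  by_cases hN' : V.round < N
  · simp [hN']
  · congr 1
    rw [if_neg hN', if_neg hN']
    have h1' : solve M X p ≠ some ⟨c, hcn⟩ := fun h => h1 ⟨hN', h⟩
    cases hsol : solve M X p with
    | none => rfl
    | some e =>
      have hec : (e : ℕ) ≠ c := fun h => h1' (by rw [hsol]; congr 1; exact Fin.ext h)
      by_cases hlt : (e : ℕ) < c
      · simp [Option.filter, hlt, Nat.lt_succ_of_lt hlt]
      · simp [Option.filter, hlt, show ¬ (e : ℕ) < c + 1 by omega]

theorem exec_accept (L : Plan n m) (t : Fin m) (hV : V.numAgents = m) (hB : V.blocks = B)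
    (hround : V.round = t)
    (hrow : ∀ r : Fin m, r ≤ t → s.row n nHeld r = heldSet M (L.profile r))
    (hcode : ∀ r : Fin m, r ≤ t → s.nat nCode 0 r = code (L.tentative M r)) :
    (acceptProg.exec V s).nat nOut 0 0 = code (L.accepted M B t) := by
  classical
  rw [acceptProg, Prog.exec_seq]
  set u := (Prog.setNat nOut (.lit 0) (.lit 0) (.cell nCode .round)).exec V s with hu
  have h := Prog.exec_loop (V := V) (s := u) (x := cT) (a := .numAgents)
    (p := .ite (.and (.lt (.var cT) .round) (.and (.cell nCode (.var cT))
      (.blocks nHeld (.var cT) (.sub (.cell nCode (.var cT)) (.lit 1))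
        nHeld .round (.sub (.cell nCode .round) (.lit 1)))))
      (.setNat nOut (.lit 0) (.lit 0) (.lit 0)) .skip)
    (fun c w => w.nat nOut 0 0 = code (if ∃ e, L.tentative M t = some e ∧ ∃ r < t, (r : ℕ) < c ∧
      ∃ f, L.tentative M r = some f ∧ B (heldSet M (L.profile r), f) (heldSet M (L.profile t), e)
      then none else L.tentative M t)) ?_ ?_
  · rw [h, Plan.accepted]
    congr 1
    refine if_congr ?_ rfl rfl
    simp only [Plan.Blocked, Exp.natVal_numAgents, hV, Fin.is_lt, true_and]
  · rw [if_neg (by simp)]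
    simp [hu, hround, hcode t le_rfl]
  intro c hc w hn hr ih
  have hcm : c < m := by simpa [hV] using hc
  have huH : u.nat nHeld = s.nat nHeld := Prog.nat_exec _ (by decide) _
  have huC : u.nat nCode = s.nat nCode := Prog.nat_exec _ (by decide) _
  have hwH : ∀ i, (w.setNat cT 0 0 c).row n nHeld i = s.row n nHeld i := fun i => by
    simp only [Store.row]
    rw [Store.nat_setNat_of_ne _ _ _ _ (by decide), hn _ (by decide), huH]
  have hwC : (w.setNat cT 0 0 c).nat nCode = s.nat nCode := by
    rw [Store.nat_setNat_of_ne _ _ _ _ (by decide), hn _ (by decide), huC]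
  cases htent : L.tentative M t with
  | none =>
    have hz : ∀ v : Store, v.nat nOut 0 0 = 0 → ((Prog.ite (.and (.lt (.var cT) .round)
      (.and (.cell nCode (.var cT))
      (.blocks nHeld (.var cT) (.sub (.cell nCode (.var cT)) (.lit 1))
        nHeld .round (.sub (.cell nCode .round) (.lit 1)))))
      (.setNat nOut (.lit 0) (.lit 0) (.lit 0)) .skip).exec V v).nat nOut 0 0 = 0 := by
      intro v hv
      rw [Prog.exec_ite]
      split_ifs
      · simp
      · simpa using hv
    rw [hz]
    · simp [code]
    · rw [Store.nat_setNat_of_ne _ _ _ _ (by decide), ih, htent]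
      simp [code]
  | some e =>
    have hct : s.nat nCode 0 t = e + 1 := by rw [hcode t le_rfl, htent]; rfl
    have hcond : (Exp.and (.lt (.var cT) .round) (.and (.cell nCode (.var cT))
      (.blocks nHeld (.var cT) (.sub (.cell nCode (.var cT)) (.lit 1))
        nHeld .round (.sub (.cell nCode .round) (.lit 1))))).Holds V (w.setNat cT 0 0 c) ↔
        c < t ∧ ∃ f, L.tentative M ⟨c, hcm⟩ = some f ∧
          B (heldSet M (L.profile ⟨c, hcm⟩), f) (heldSet M (L.profile t), e) := by
      simp only [Exp.holds_and, Exp.holds_lt, Exp.natVal_readNat, Exp.natVal_lit, Exp.natVal_round,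
        Store.nat_setNat_self, and_self, if_true, Exp.holds_readNat, Exp.holds_blocks, hwC, hwH,
        Exp.natVal_sub, hround, hB, hct, hrow t le_rfl]
      refine and_congr_right fun hct' => ?_
      have hc1 := hcode ⟨c, hcm⟩ (Fin.le_def.2 hct'.le)
      have hc2 := hrow ⟨c, hcm⟩ (Fin.le_def.2 hct'.le)
      dsimp only at hc1 hc2
      rw [hc1, hc2]
      cases L.tentative M ⟨c, hcm⟩ with
      | none => simp [code]
      | some f =>
        simp only [code, Nat.add_sub_cancel]
        constructor
        · rintro ⟨-, e', f', he', hf', hb⟩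
          obtain rfl := Fin.ext he'
          obtain rfl := Fin.ext hf'
          exact ⟨_, rfl, hb⟩
        · rintro ⟨f', hf', hb⟩
          obtain rfl := Option.some_injective _ hf'
          exact ⟨by omega, _, _, rfl, rfl, hb⟩
    rw [Prog.exec_ite, if_congr hcond rfl rfl]
    have hstep : (∃ e', some e = some e' ∧ ∃ r < t, (r : ℕ) < c + 1 ∧ ∃ f,
        L.tentative M r = some f ∧
          B (heldSet M (L.profile r), f) (heldSet M (L.profile t), e')) ↔
        (∃ e', some e = some e' ∧ ∃ r < t, (r : ℕ) < c ∧ ∃ f,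
        L.tentative M r = some f ∧
          B (heldSet M (L.profile r), f) (heldSet M (L.profile t), e')) ∨
        (c < t ∧ ∃ f, L.tentative M ⟨c, hcm⟩ = some f ∧
          B (heldSet M (L.profile ⟨c, hcm⟩), f) (heldSet M (L.profile t), e)) := by
      constructor
      · rintro ⟨e', he', r, hrt, hrc, f, hf⟩
        obtain rfl := Option.some_injective _ he'
        rcases Nat.lt_succ_iff_lt_or_eq.1 hrc with h' | h'
        · exact Or.inl ⟨e, rfl, r, hrt, h', f, hf⟩
        · obtain rfl : r = ⟨c, hcm⟩ := Fin.ext h'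
          exact Or.inr ⟨hrt, f, hf⟩
      · rintro (⟨e', he', r, hrt, hrc, f, hf⟩ | ⟨hct', f, hf⟩)
        · exact ⟨e', he', r, hrt, by omega, f, hf⟩
        · exact ⟨e, rfl, ⟨c, hcm⟩, hct', Nat.lt_succ_self c, f, hf⟩
    rw [htent] at ih
    rw [if_congr hstep rfl rfl]
    split_ifs with h1 h2 h2
    · simp [code]
    · exact absurd (Or.inr h1) h2
    · rw [Prog.exec_skip, Store.nat_setNat_of_ne _ _ _ _ (by decide), ih, if_pos]
      exact h2.resolve_right h1
    · rw [Prog.exec_skip, Store.nat_setNat_of_ne _ _ _ _ (by decide), ih, if_neg]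
      exact fun h => h2 (Or.inl h)

end

/-! ### Correctness and feasibility of the rounds -/

section
variable {n m : ℕ} {M : Matroid (Fin n)} {B : Pair n → Pair n → Prop} {k : ℕ}

theorem isCertificate_heldSet (hM : M.E = Set.univ) {X : Profile n m} {a : Fin m} {e : Fin n}
    (h : solve M X a = some e) : IsCertificate M (heldSet M X, e) := by
  constructor
  · have := (solve_feasible hM (X := X)).2
    convert this using 1
    ext f
    simp [heldSet, finalOwn_ne_zero_iff hM]
  · simp only [heldSet, Finset.mem_filter, Finset.mem_univ, true_and, finalOwn_ne_zero_iff hM]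
    exact ⟨a, h⟩

theorem Plan.solve_of_tentative {L : Plan n m} {t : Fin m} {e : Fin n}
    (h : L.tentative M t = some e) : L.thr ≤ t ∧ solve M (L.profile t) (L.pos t) = some e := by
  rw [tentative] at h
  split_ifs at h with hN
  exact ⟨not_lt.1 hN, h⟩

theorem Plan.accepted_eq_some_iff {L : Plan n m} {t : Fin m} {e : Fin n} :
    L.accepted M B t = some e ↔ L.tentative M t = some e ∧ ¬ L.Blocked M B t e := by
  rw [accepted]
  split_ifs with h
  · obtain ⟨f, hf, hb⟩ := h
    refine ⟨fun h => by simp at h, fun ⟨h1, h2⟩ => ?_⟩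
    rw [hf] at h1
    exact absurd (Option.some_injective _ h1 ▸ hb) h2
  · exact ⟨fun h1 => ⟨h1, fun h2 => h ⟨e, h1, h2⟩⟩, fun h1 => h1.1⟩

/-- Whatever the profiles and positions are, the elements that are given away are distinct and
form an independent set: an element is rejected as soon as it is blocked by an earlier one. -/
theorem Plan.feasible (L : Plan n m) (hM : M.E = Set.univ) (hB : IsDirectedCertifier M k B)
    (order : Equiv.Perm (Fin m)) : Feasible M fun a => L.accepted M B (order.symm a) := by
  have hcert : ∀ t e, L.tentative M t = some e → IsCertificate M (heldSet M (L.profile t), e) :=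
    fun t e h => isCertificate_heldSet hM (solve_of_tentative h).2
  have hne : ∀ s t : Fin m, s < t → ∀ e, L.accepted M B s = some e →
      L.accepted M B t ≠ some e := by
    intro s t hst e hs ht
    rw [accepted_eq_some_iff] at hs ht
    exact ht.2 ⟨s, hst, e, hs.1, hB.same _ _ (hcert s e hs.1) (hcert t e ht.1) rfl⟩
  constructor
  · intro a a' haa h
    by_contra hcon
    obtain ⟨e, he⟩ := Option.ne_none_iff_exists'.1 hcon
    dsimp only at h he
    rw [h] at he
    rcases lt_trichotomy (order.symm a) (order.symm a') with h' | h' | h'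
    · exact hne _ _ h' e (h.trans he) he
    · exact haa (order.symm.injective h')
    · exact hne _ _ h' e he (h.trans he)
  · let g : Fin m → Option (Pair n) := fun t =>
      (L.accepted M B t).map fun e => (heldSet M (L.profile t), e)
    have hg : ∀ t c, g t = some c ↔ ∃ e, L.accepted M B t = some e ∧
        (heldSet M (L.profile t), e) = c := by
      intro t c
      simp [g, Option.map_eq_some_iff]
    have hind := hB.certification ((List.finRange m).filterMap g) ?_ ?_
    · convert hind using 1
      ext e
      simp only [Set.mem_ofPred_eq, List.mem_filterMap, List.mem_finRange, true_and]
      constructor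
      · rintro ⟨a, ha⟩
        exact ⟨_, ⟨order.symm a, (hg _ _).2 ⟨e, ha, rfl⟩⟩, rfl⟩
      · rintro ⟨c, ⟨t, ht⟩, rfl⟩
        obtain ⟨e, he, rfl⟩ := (hg _ _).1 ht
        exact ⟨order t, by simpa using he⟩
    · intro c hc
      simp only [List.mem_filterMap, List.mem_finRange, true_and] at hc
      obtain ⟨t, ht⟩ := hc
      obtain ⟨e, he, rfl⟩ := (hg _ _).1 ht
      exact hcert t e (accepted_eq_some_iff.1 he).1
    · rw [List.pairwise_filterMap]
      refine (List.pairwise_lt_finRange m).imp ?_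
      intro s t hst c hc d hd hb
      obtain ⟨e, he, rfl⟩ := (hg _ _).1 hc
      obtain ⟨f, hf, rfl⟩ := (hg _ _).1 hd
      rw [accepted_eq_some_iff] at he hf
      exact hf.2 ⟨s, hst, e, he.1, hb⟩

/-- The weights that are in the memory at the beginning of round `t`. -/
noncomputable def Plan.weightsBefore (L : Plan n m) (M : Matroid (Fin n)) (t : ℕ) : ℕ → ℕ → ℝ :=
  if h : 0 < t ∧ t ≤ m then (market M (L.profile ⟨t - 1, by omega⟩)).wt else fun _ _ => 0

/-- The program `F` prepares the rounds of the scenario `S` according to the plan `L`. -/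
structure Prepares (F : Prog) (S : Scenario n m) (L : Plan n m) : Prop where
  wt : ∀ (t : Fin m) (s : Store), s.real rW = L.weightsBefore S.M t →
    (F.exec (S.view t) s).real rW = (market S.M (L.profile t)).wt
  pos : ∀ (t : Fin m) (s : Store), (F.exec (S.view t) s).nat nPos 0 0 = L.pos t
  thr : ∀ (t : Fin m) (s : Store), (F.exec (S.view t) s).nat nThr 0 0 = L.thr
  nat : ∀ y ∈ [nOwn, nCode, nHeld], y ∉ F.natWrites
  real : ∀ y ∈ [rUtil, rPrice], y ∉ F.realWrites

/-- The memory after `t` rounds: it contains the tentative certificates of these rounds and the profile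
of the last one. -/
structure History (M : Matroid (Fin n)) (L : Plan n m) (t : ℕ) (s : Store) : Prop where
  row : ∀ r : Fin m, (r : ℕ) < t → s.row n nHeld r = heldSet M (L.profile r)
  code : ∀ r : Fin m, (r : ℕ) < t → s.nat nCode 0 r = code (L.tentative M r)
  wt : s.real rW = L.weightsBefore M t
  own : ∀ e, n + m < e → s.nat nOwn 0 e = 0
  util : ∀ a, m ≤ a → s.real rUtil 0 a = 0
  price : ∀ e, n + m < e → s.real rPrice 0 e = 0

variable {F : Prog} {S : Scenario n m} {L : Plan n m}

theorem History.round (hF : Prepares F S L) (hM : S.M.E = Set.univ) (t : Fin m) {s : Store}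
    (h : History S.M L t s) : History S.M L (t + 1) ((roundProg F).exec (S.view t) s) ∧
      ((roundProg F).exec (S.view t) s).nat nOut 0 0 = OnlineAssignment.code (L.accepted S.M S.B t) := by
  classical
  rw [roundProg, Prog.exec_seq, Prog.exec_seq, Prog.exec_seq]
  set V := S.view t with hV
  set s₁ := F.exec V s with hs₁
  have hW₁ : s₁.real rW = (market S.M (L.profile t)).wt := hF.wt t s h.wt
  have hnat : ∀ y ∈ [nOwn, nCode, nHeld], s₁.nat y = s.nat y := fun y hy =>
    F.nat_exec (hF.nat y hy) s
  have hreal : ∀ y ∈ [rUtil, rPrice], s₁.real y = s.real y := fun y hy =>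
    F.real_exec (hF.real y hy) s
  have hready : Ready V (market S.M (L.profile t)) m s₁ := by
    refine ⟨rfl, ?_, hW₁, fun e he => ?_, fun a ha => ?_, fun e he => ?_⟩
    · funext T
      simp only [market, hV, Scenario.view]
    · rw [hnat _ (by simp), h.own e he]
    · rw [hreal _ (by simp), h.util a ha]
    · rw [hreal _ (by simp), h.price e he]
  obtain ⟨hR, hC⟩ := exec_solve hready (market_isFree S.M hM (L.profile t))
    (market_wt_nonneg S.M (L.profile t)) (fun a e ha => by simp [market, not_lt.2 ha])
  set s₂ := solveProg.exec V s₁ with hs₂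
  have hP₂ : s₂.nat nPos 0 0 = L.pos t := by
    rw [hs₂, Prog.nat_exec _ (by decide)]; exact hF.pos t s
  have hN₂ : s₂.nat nThr 0 0 = L.thr := by
    rw [hs₂, Prog.nat_exec _ (by decide)]; exact hF.thr t s
  obtain ⟨hr1, hr2, hr3⟩ := exec_record (V := V) (L.profile t) (L.pos t) L.thr hM hR.own hP₂ hN₂
  set s₃ := recordProg.exec V s₂ with hs₃
  have hround : V.round = t := rfl
  have hheld₂ : s₂.nat nHeld = s.nat nHeld := by
    rw [hs₂, Prog.nat_exec _ (by decide), hnat _ (by simp)]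
  have hcode₂ : s₂.nat nCode = s.nat nCode := by
    rw [hs₂, Prog.nat_exec _ (by decide), hnat _ (by simp)]
  have hrow : ∀ r : Fin m, r ≤ t → s₃.row n nHeld r = heldSet S.M (L.profile r) := by
    intro r hr
    rcases eq_or_lt_of_le hr with rfl | hlt
    · exact hr1
    · rw [← h.row r hlt]
      simp only [Store.row]
      rw [hr2 r (by rw [hround]; exact Nat.ne_of_lt hlt), hheld₂]
  have hcode : ∀ r : Fin m, r ≤ t → s₃.nat nCode 0 r =
      OnlineAssignment.code (L.tentative S.M r) := by
    intro r hr
    rw [hr3 r, hround]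
    rcases eq_or_lt_of_le hr with rfl | hlt
    · rw [if_pos rfl]; rfl
    · rw [if_neg (Nat.ne_of_lt hlt), hcode₂, h.code r hlt]
  refine ⟨⟨fun r hr => ?_, fun r hr => ?_, ?_, ?_, ?_, ?_⟩, ?_⟩
  · rw [← hrow r (Nat.lt_succ_iff.1 hr)]
    simp only [Store.row]
    rw [Prog.nat_exec _ (by decide)]
  · rw [Prog.nat_exec _ (by decide)]
    exact hcode r (Nat.lt_succ_iff.1 hr)
  · rw [Prog.real_exec _ (by decide), hs₃, Prog.real_exec _ (by decide), hR.wt,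
      Plan.weightsBefore, dif_pos ⟨Nat.succ_pos _, t.2⟩]
    rfl
  · intro e he
    rw [Prog.nat_exec _ (by decide), hs₃, Prog.nat_exec _ (by decide), hR.own]
    exact hC.own e he
  · intro a ha
    rw [Prog.real_exec _ (by decide), hs₃, Prog.real_exec _ (by decide), hR.util]
    exact hC.util a ha
  · intro e he
    rw [Prog.real_exec _ (by decide), hs₃, Prog.real_exec _ (by decide), hR.price]
    exact hC.price e he
  · exact exec_accept L t rfl rfl rfl hrow hcode

theorem history_storeAfter (hF : Prepares F S L) (hM : S.M.E = Set.univ) (t : ℕ) (ht : t ≤ m) :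
    History S.M L t (S.storeAfter (roundProg F) t) := by
  induction t with
  | zero =>
    refine ⟨fun r hr => absurd hr (by omega), fun r hr => absurd hr (by omega), ?_, fun _ _ => rfl,
      fun _ _ => rfl, fun _ _ => rfl⟩
    rw [Plan.weightsBefore, dif_neg (by omega)]; rfl
  | succ t ih =>
    rw [Scenario.storeAfter, dif_pos (by omega)]
    exact (History.round hF hM ⟨t, by omega⟩ (ih (by omega))).1

theorem result_eq (hF : Prepares F S L) (hM : S.M.E = Set.univ) :
    S.result (roundProg F) = fun a => L.accepted S.M S.B (S.order.symm a) := by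
  have key : ∀ t : Fin m, S.decision (roundProg F) t = L.accepted S.M S.B t := fun t => by
    have h : (S.storeAfter (roundProg F) (t + 1)).nat 0 0 0 = code (L.accepted S.M S.B t) := by
      rw [Scenario.storeAfter, dif_pos t.2]
      exact (History.round hF hM t (history_storeAfter hF hM t t.2.le)).2
    simp only [Scenario.decision, h]
    have hdec : ∀ o : Option (Fin n), (if h : code o ≠ 0 ∧ code o - 1 < n then
        some (⟨code o - 1, h.2⟩ : Fin n) else none) = o := fun o => by cases o <;> simp [code]
    exact hdec _
  funext a
  exact key _

/-- The weight that an algorithm collects is the sum of the accepted weights over all rounds. -/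
theorem collected_eq (hF : Prepares F S L) (hM : S.M.E = Set.univ) :
    S.collected (roundProg F) =
      ∑ t, weightOf (S.weights (S.order t)) (L.accepted S.M S.B t) := by
  rw [Scenario.collected, result_eq hF hM, value,
    ← Equiv.sum_comp S.order fun a => weightOf (S.weights a) (L.accepted S.M S.B (S.order.symm a))]
  simp

/-- The bound for a single round, summed over at most as many rounds as there are agents. -/
theorem totalSteps_le (P : Prog) {b : Polynomial ℕ} (hb : b ∈ P.stepBound) (S : Scenario n m) :
    S.totalSteps P ≤ (Polynomial.X * b).eval (n + m) := by
  rw [Scenario.totalSteps, Polynomial.eval_mul, Polynomial.eval_X]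
  refine (Finset.sum_le_card_nsmul _ _ (b.eval (n + m)) fun t _ =>
    P.steps_le_stepBound (V := S.view t) _ hb).trans ?_
  rw [Finset.card_univ, Fintype.card_fin, smul_eq_mul]
  exact Nat.mul_le_mul_right _ (Nat.le_add_left m n)

theorem runsWithin (hF : Prepares F S L) (hM : S.M.E = Set.univ)
    (hB : IsDirectedCertifier S.M k S.B) {b : Polynomial ℕ} (hb : b ∈ (roundProg F).stepBound) :
    S.RunsWithin (roundProg F) (Polynomial.X * b) := by
  refine ⟨?_, totalSteps_le _ hb S⟩
  rw [result_eq hF hM]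
  exact L.feasible hM hB S.order

end

/-! ### Preparation of the rounds -/

notation "nBase" => (24 : ℕ)
notation "rSum" => (5 : ℕ)
notation "rProd" => (6 : ℕ)
notation "rBest" => (7 : ℕ)

/-- Load one sample for every agent, beginning with the sample number `b`. -/
def sampleProg (b : Exp .nat) : Prog :=
  .loop cJ .numAgents (.loop cE .numElements
    (.setReal rW (.var cJ) (.var cE) (.sample (.add b (.var cJ)) (.var cE))))

/-- Enter the revealed weights in the row given by `nPos`. -/
def revealProg : Prog :=
  .loop cE .numElements (.setReal rW (.var nPos) (.var cE) (.weight (.var cE)))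

/-- Compute the number of samples used in earlier rounds. -/
def baseProg : Prog :=
  .setNat nBase (.lit 0) (.lit 0) (.lit 0) ;;
  .loop cT .numAgents (.ite (.lt (.var cT) .round)
    (.setNat nBase (.lit 0) (.lit 0) (.add (.var nBase) .numAgents)) .skip)

/-- Choose a random position: count the numbers `i ≥ 1` for which `i / m` does not exceed the random
number of the round. -/
def posProg : Prog :=
  .setNat nPos (.lit 0) (.lit 0) (.lit 0) ;;
  .loop cT .numAgents (.ite (.and (.le (.lit 1) (.var cT))
      (.leReal (.divReal (.cast (.var cT)) (.cast .numAgents)) (.coin .round)))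
    (.setNat nPos (.lit 0) (.lit 0) (.add (.var nPos) (.lit 1))) .skip)

/-- Preparation of a round in the IID model: the revealed weights take a random position among
fresh samples. -/
def fillIID : Prog :=
  baseProg ;; sampleProg (.var nBase) ;; posProg ;; revealProg ;;
    .setNat nThr (.lit 0) (.lit 0) (.lit 0)

/-- Preparation of a round in the models with random arrival order: the samples of the agents are
replaced by their revealed weights one by one. -/
def fillOrder (T : Prog) : Prog :=
  .ite .round .skip (sampleProg (.lit 0)) ;; .setNat nPos (.lit 0) (.lit 0) .agent ;;
    revealProg ;; T

/-- Compute the length of the observation phase that maximizes the guaranteed weight. As the machine has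
no exponential function and does not round real numbers, all lengths are tried. -/
def thrProg : Prog :=
  .setNat nThr (.lit 0) (.lit 0) (.lit 0) ;;
  .setReal rBest (.lit 0) (.lit 0) (.cast (.lit 0)) ;;
  .loop cJ .numAgents (
    .setReal rSum (.lit 0) (.lit 0) (.cast (.lit 0)) ;;
    .setReal rProd (.lit 0) (.lit 0) (.cast (.lit 1)) ;;
    .loop cL .numAgents (.ite (.le (.var cJ) (.var cL))
      (.setReal rSum (.lit 0) (.lit 0) (.addReal (.readReal rSum (.lit 0) (.lit 0))
          (.readReal rProd (.lit 0) (.lit 0))) ;;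
        .setReal rProd (.lit 0) (.lit 0) (.mulReal (.readReal rProd (.lit 0) (.lit 0))
          (.divReal (.cast (.sub (.add (.var cL) (.lit 1)) .param))
            (.cast (.add (.var cL) (.lit 1)))))) .skip) ;;
    .ite (.leReal (.readReal rSum (.lit 0) (.lit 0)) (.readReal rBest (.lit 0) (.lit 0))) .skip
      (.setReal rBest (.lit 0) (.lit 0) (.readReal rSum (.lit 0) (.lit 0)) ;;
        .setNat nThr (.lit 0) (.lit 0) (.var cJ)))
/-- A bound for the probability that the tentative certificate of round `r` does not block a given
one in the secretary model. -/
noncomputable def passRatio (k r : ℕ) : ℝ := ((r + 1 - k : ℕ) : ℝ) / ((r + 1 : ℕ) : ℝ)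

/-- `m` times the competitive ratio that is guaranteed in the secretary model with `m` agents of which
the first `N` are only observed. -/
noncomputable def observeGain (k m N : ℕ) : ℝ :=
  ∑ s ∈ Finset.range m, if N ≤ s then ∏ r ∈ Finset.Ico N s, passRatio k r else 0

open Classical in
/-- The largest gain of an observation phase of length less than the given bound, and a length for
which it is attained. -/
noncomputable def bestObserve (k m : ℕ) : ℕ → ℝ × ℕ
  | 0 => (0, 0)
  | c + 1 => if observeGain k m c ≤ (bestObserve k m c).1 then bestObserve k m c
      else (observeGain k m c, c)

theorem observeGain_le_bestObserve {k m c N : ℕ} (h : N < c) :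
    observeGain k m N ≤ (bestObserve k m c).1 := by
  induction c with
  | zero => omega
  | succ c ih =>
    rw [bestObserve]
    split_ifs with h1
    · rcases Nat.lt_succ_iff_lt_or_eq.1 h with h' | rfl
      · exact ih h'
      · exact h1
    · rcases Nat.lt_succ_iff_lt_or_eq.1 h with h' | rfl
      · exact (ih h').trans (not_le.1 h1).le
      · exact le_rfl

theorem bestObserve_spec {k m c : ℕ} (h : 0 < (bestObserve k m c).1) :
    (bestObserve k m c).2 < c ∧ observeGain k m (bestObserve k m c).2 = (bestObserve k m c).1 := by
  induction c with
  | zero => simp [bestObserve] at h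
  | succ c ih =>
    rw [bestObserve] at h ⊢
    split_ifs with h1
    · rw [if_pos h1] at h
      exact ⟨(ih h).1.trans (Nat.lt_succ_self c), (ih h).2⟩
    · exact ⟨Nat.lt_succ_self c, rfl⟩

/-- The position chosen by a random number: `i` if the number is in `[i/m, (i+1)/m)`, and `m - 1` for the
number `1`. -/
noncomputable def coinPos (m : ℕ) (u : unitInterval) : ℕ :=
  open Classical in
  ((Finset.range m).filter fun i : ℕ => 1 ≤ i ∧ (i : ℝ) / m ≤ u).card

theorem coinPos_lt {m : ℕ} (hm : 0 < m) (u : unitInterval) : coinPos m u < m := by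
  classical
  rw [coinPos]
  refine (Finset.card_le_card (t := (Finset.range m).erase 0) fun i hi => ?_).trans_lt ?_
  · simp only [Finset.mem_filter, Finset.mem_range, Finset.mem_erase] at hi ⊢
    exact ⟨by omega, hi.1⟩
  · rw [Finset.card_erase_of_mem (by simpa using hm), Finset.card_range]
    omega

section
variable {n m : ℕ} {V : View n} {s : Store}

theorem exec_sample (b : Exp .nat) (hb : ∀ t : Store, (∀ y, y ∉ [cJ, cE] → t.nat y = s.nat y) →
      b.natVal V t = b.natVal V s) (a e : ℕ) :
    ((sampleProg b).exec V s).real rW a e =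
      if h : a < V.numAgents ∧ e < n then (V.samples (b.natVal V s + a) ⟨e, h.2⟩ : ℝ)
      else s.real rW a e := by
  revert a e
  have main := Prog.exec_loop (V := V) (s := s) (x := cJ) (a := .numAgents)
    (p := .loop cE .numElements
      (.setReal rW (.var cJ) (.var cE) (.sample (.add b (.var cJ)) (.var cE))))
    (fun c t => ∀ a e, t.real rW a e =
      if h : a < c ∧ e < n then (V.samples (b.natVal V s + a) ⟨e, h.2⟩ : ℝ)
      else s.real rW a e) (by simp) ?_
  · exact main
  intro i hi t hn hr ih
  have inner := Prog.exec_loop (V := V) (s := t.setNat cJ 0 0 i) (x := cE) (a := .numElements)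
    (p := .setReal rW (.var cJ) (.var cE) (.sample (.add b (.var cJ)) (.var cE)))
    (fun c u => ∀ a e, u.real rW a e =
      if h : a = i ∧ e < c ∧ e < n then (V.samples (b.natVal V s + a) ⟨e, h.2.2⟩ : ℝ)
      else t.real rW a e) (by simp) ?_
  · intro a e
    refine (inner a e).trans ?_
    rw [ih a e]
    by_cases hai : a = i
    · by_cases hen : e < n
      · rw [dif_pos ⟨hai, hen, hen⟩, dif_pos ⟨by omega, hen⟩]
      · rw [dif_neg (by tauto), dif_neg (by tauto), dif_neg (by tauto)]
    · rw [dif_neg (by tauto)]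
      by_cases hc : a < i ∧ e < n
      · rw [dif_pos hc, dif_pos ⟨by omega, hc.2⟩]
      · rw [dif_neg hc, dif_neg (fun h => hc ⟨by omega, h.2⟩)]
  intro c hc u hnu hru ihu a e
  have hcn : c < n := hc
  have hbu : b.natVal V (u.setNat cE 0 0 c) = b.natVal V s := by
    refine hb _ fun y hy => ?_
    simp only [List.mem_cons, List.not_mem_nil, or_false, not_or] at hy
    rw [Store.nat_setNat_of_ne _ _ _ _ hy.2, hnu y (by simp [Prog.natWrites, hy]),
      Store.nat_setNat_of_ne _ _ _ _ hy.1, hn y (by simp [Prog.natWrites, hy])]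
  have hJ : (u.setNat cE 0 0 c).nat cJ 0 0 = i := by
    rw [Store.nat_setNat_of_ne _ _ _ _ (by decide), hnu _ (by simp [Prog.natWrites])]
    simp
  simp only [Prog.exec_setReal, Exp.natVal_readNat, Exp.natVal_lit, hJ, Store.nat_setNat_self,
    and_self, if_true, Exp.realVal_sample, Exp.natVal_add, hbu, Store.real_setReal_self, hcn,
    dite_true, Store.real_setNat, ihu a e]
  by_cases hai : a = i
  · subst hai
    by_cases hec : e = c
    · subst hec
      simp [hcn]
    · by_cases hlt : e < c
      · simp [hec, hlt, Nat.lt_succ_of_lt hlt]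
      · simp [hec, hlt, show ¬ e < c + 1 by omega]
  · simp [hai]

theorem exec_reveal {p : ℕ} (hp : s.nat nPos 0 0 = p) (a e : ℕ) :
    (revealProg.exec V s).real rW a e =
    if h : a = p ∧ e < n then (V.weight ⟨e, h.2⟩ : ℝ) else s.real rW a e := by
  subst hp
  revert a e
  have main := Prog.exec_loop (V := V) (s := s) (x := cE) (a := .numElements)
    (p := .setReal rW (.var nPos) (.var cE) (.weight (.var cE)))
    (fun c u => ∀ a e, u.real rW a e =
      if h : a = s.nat nPos 0 0 ∧ e < c ∧ e < n then (V.weight ⟨e, h.2.2⟩ : ℝ)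
      else s.real rW a e) (by simp) ?_
  · intro a e
    refine (main a e).trans ?_
    by_cases hc : a = s.nat nPos 0 0 ∧ e < n
    · rw [dif_pos hc, dif_pos ⟨hc.1, hc.2, hc.2⟩]
    · rw [dif_neg hc, dif_neg (fun h => hc ⟨h.1, h.2.2⟩)]
  intro c hc u hnu hru ihu a e
  have hcn : c < n := hc
  have hP : (u.setNat cE 0 0 c).nat nPos 0 0 = s.nat nPos 0 0 := by
    rw [Store.nat_setNat_of_ne _ _ _ _ (by decide), hnu _ (by decide)]
  simp only [Prog.exec_setReal, Exp.natVal_readNat, Exp.natVal_lit, hP, Store.nat_setNat_self,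
    and_self, if_true, Exp.realVal_weight, Store.real_setReal_self, hcn,
    dite_true, Store.real_setNat, ihu a e]
  by_cases hai : a = s.nat nPos 0 0
  · by_cases hec : e = c
    · subst hec
      simp [hcn, hai]
    · by_cases hlt : e < c
      · simp [hec, hai, hlt, Nat.lt_succ_of_lt hlt]
      · simp [hec, hai, hlt, show ¬ e < c + 1 by omega]
  · simp [hai]

theorem exec_base (h : V.round ≤ V.numAgents) :
    (baseProg.exec V s).nat nBase 0 0 = V.round * V.numAgents := by
  classical
  rw [baseProg, Prog.exec_seq]
  have main := Prog.exec_loop (V := V)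
    (s := (Prog.setNat nBase (.lit 0) (.lit 0) (.lit 0)).exec V s) (x := cT) (a := .numAgents)
    (p := .ite (.lt (.var cT) .round)
      (.setNat nBase (.lit 0) (.lit 0) (.add (.var nBase) .numAgents)) .skip)
    (fun c t => t.nat nBase 0 0 = min c V.round * V.numAgents) (by simp) ?_
  · rw [main, Exp.natVal_numAgents, min_eq_right h]
  intro i hi t hn hr ih
  have hcond : (Exp.lt (.var cT) .round).Holds V (t.setNat cT 0 0 i) ↔ i < V.round := by simp
  rw [Prog.exec_ite, if_congr hcond rfl rfl]
  split_ifs with hlt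
  · simp [Store.nat_setNat_of_ne, ih, min_eq_left hlt.le, min_eq_left (Nat.succ_le_of_lt hlt)]
    ring
  · rw [Prog.exec_skip, Store.nat_setNat_of_ne _ _ _ _ (by decide), ih,
      min_eq_right (not_lt.1 hlt), min_eq_right (by omega)]

theorem exec_pos : (posProg.exec V s).nat nPos 0 0 = coinPos V.numAgents (V.coins V.round) := by
  classical
  rw [posProg, Prog.exec_seq, coinPos]
  refine Prog.exec_loop (V := V) (a := .numAgents) (fun c t => t.nat nPos 0 0 =
    ((Finset.range c).filter fun i : ℕ => 1 ≤ i ∧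
      (i : ℝ) / V.numAgents ≤ V.coins V.round).card) (by simp) ?_
  intro i hi t hn hr ih
  have hcond : (Exp.and (.le (.lit 1) (.var cT))
      (.leReal (.divReal (.cast (.var cT)) (.cast .numAgents)) (.coin .round))).Holds V
        (t.setNat cT 0 0 i) ↔ 1 ≤ i ∧ (i : ℝ) / V.numAgents ≤ V.coins V.round := by
    simp
  rw [Prog.exec_ite, if_congr hcond rfl rfl, Finset.range_add_one, Finset.filter_insert]
  split_ifs with hc
  · rw [Finset.card_insert_of_notMem (by simp)]
    simp [Store.nat_setNat_of_ne, ih]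
  · rw [Prog.exec_skip, Store.nat_setNat_of_ne _ _ _ _ (by decide), ih]

theorem exec_thr : (thrProg.exec V s).nat nThr 0 0 =
    (bestObserve V.param V.numAgents V.numAgents).2 := by
  classical
  rw [thrProg, Prog.exec_seq, Prog.exec_seq]
  set s₁ := (Prog.setReal rBest (.lit 0) (.lit 0) (.cast (.lit 0))).exec V
    ((Prog.setNat nThr (.lit 0) (.lit 0) (.lit 0)).exec V s) with hs₁
  have main := Prog.exec_loop (V := V) (s := s₁) (x := cJ) (a := .numAgents)
    (p := .setReal rSum (.lit 0) (.lit 0) (.cast (.lit 0)) ;;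
    .setReal rProd (.lit 0) (.lit 0) (.cast (.lit 1)) ;;
    .loop cL .numAgents (.ite (.le (.var cJ) (.var cL))
      (.setReal rSum (.lit 0) (.lit 0) (.addReal (.readReal rSum (.lit 0) (.lit 0))
          (.readReal rProd (.lit 0) (.lit 0))) ;;
        .setReal rProd (.lit 0) (.lit 0) (.mulReal (.readReal rProd (.lit 0) (.lit 0))
          (.divReal (.cast (.sub (.add (.var cL) (.lit 1)) .param))
            (.cast (.add (.var cL) (.lit 1)))))) .skip) ;;
    .ite (.leReal (.readReal rSum (.lit 0) (.lit 0)) (.readReal rBest (.lit 0) (.lit 0))) .skip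
      (.setReal rBest (.lit 0) (.lit 0) (.readReal rSum (.lit 0) (.lit 0)) ;;
        .setNat nThr (.lit 0) (.lit 0) (.var cJ)))
    (fun c t => t.nat nThr 0 0 = (bestObserve V.param V.numAgents c).2 ∧
      t.real rBest 0 0 = (bestObserve V.param V.numAgents c).1) ?_ ?_
  · exact main.1
  · simp [hs₁, bestObserve]
  intro N hN t hn hr ⟨ih1, ih2⟩
  rw [Prog.exec_seq, Prog.exec_seq, Prog.exec_seq]
  set u := (Prog.setReal rProd (.lit 0) (.lit 0) (.cast (.lit 1))).exec V
    ((Prog.setReal rSum (.lit 0) (.lit 0) (.cast (.lit 0))).exec V (t.setNat cJ 0 0 N)) with hu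
  have huJ : u.nat cJ 0 0 = N := by simp [hu]
  have huT : u.nat nThr 0 0 = t.nat nThr 0 0 := by
    simp [hu, Store.nat_setNat_of_ne]
  have huB : u.real rBest 0 0 = t.real rBest 0 0 := by
    rw [hu, Prog.real_exec _ (by decide), Prog.real_exec _ (by decide)]; rfl
  have hsum := Prog.exec_loop (V := V) (s := u) (x := cL) (a := .numAgents)
    (p := .ite (.le (.var cJ) (.var cL))
      (.setReal rSum (.lit 0) (.lit 0) (.addReal (.readReal rSum (.lit 0) (.lit 0))
          (.readReal rProd (.lit 0) (.lit 0))) ;;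
        .setReal rProd (.lit 0) (.lit 0) (.mulReal (.readReal rProd (.lit 0) (.lit 0))
          (.divReal (.cast (.sub (.add (.var cL) (.lit 1)) .param))
            (.cast (.add (.var cL) (.lit 1)))))) .skip)
    (fun c w => w.real rSum 0 0 =
        (∑ s ∈ Finset.range c, if N ≤ s then ∏ r ∈ Finset.Ico N s, passRatio V.param r else 0) ∧
      w.real rProd 0 0 = ∏ r ∈ Finset.Ico N c, passRatio V.param r) ?_ ?_
  · set v := (Prog.loop cL .numAgents (.ite (.le (.var cJ) (.var cL))
      (.setReal rSum (.lit 0) (.lit 0) (.addReal (.readReal rSum (.lit 0) (.lit 0))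
          (.readReal rProd (.lit 0) (.lit 0))) ;;
        .setReal rProd (.lit 0) (.lit 0) (.mulReal (.readReal rProd (.lit 0) (.lit 0))
          (.divReal (.cast (.sub (.add (.var cL) (.lit 1)) .param))
            (.cast (.add (.var cL) (.lit 1)))))) .skip)).exec V u with hv
    have hvJ : v.nat cJ 0 0 = N := by rw [hv, Prog.nat_exec _ (by decide), huJ]
    have hvT : v.nat nThr 0 0 = (bestObserve V.param V.numAgents N).2 := by
      rw [hv, Prog.nat_exec _ (by decide), huT, ih1]
    have hvB : v.real rBest 0 0 = (bestObserve V.param V.numAgents N).1 := by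
      rw [hv, Prog.real_exec _ (by decide), huB, ih2]
    have hvS : v.real rSum 0 0 = observeGain V.param V.numAgents N := hsum.1
    have hcond : (Exp.leReal (.readReal rSum (.lit 0) (.lit 0))
        (.readReal rBest (.lit 0) (.lit 0))).Holds V v ↔
        observeGain V.param V.numAgents N ≤ (bestObserve V.param V.numAgents N).1 := by
      simp only [Exp.holds_leReal, Exp.realVal_readReal, Exp.natVal_lit, hvS, hvB]
    rw [Prog.exec_ite, if_congr hcond rfl rfl, bestObserve]
    split_ifs with hc
    · exact ⟨hvT, hvB⟩
    · simp [hvJ, hvS]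
  · simp [hu, Store.real_setReal_of_ne]
  intro c hc w hnw hrw ⟨ihS, ihP⟩
  have hwJ : (w.setNat cL 0 0 c).nat cJ 0 0 = N := by
    rw [Store.nat_setNat_of_ne _ _ _ _ (by decide), hnw _ (by decide), huJ]
  have hcond : (Exp.le (.var cJ) (.var cL)).Holds V (w.setNat cL 0 0 c) ↔ N ≤ c := by
    rw [Exp.holds_le, Exp.natVal_readNat, Exp.natVal_readNat, Exp.natVal_lit, hwJ]
    simp
  rw [Prog.exec_ite, if_congr hcond rfl rfl, Finset.sum_range_succ]
  split_ifs with hNc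
  · rw [Finset.prod_Ico_succ_top hNc]
    simp [Store.real_setReal_of_ne, ihS, ihP, passRatio]
  · rw [Prog.exec_skip, Finset.Ico_eq_empty (by omega)]
    rw [Finset.Ico_eq_empty (by omega)] at ihP
    exact ⟨by rw [Store.real_setNat, ihS, add_zero], ihP⟩

end

/-! ### The three algorithms -/

section
variable {n m : ℕ}

/-- The plan in the IID model: every round solves a new profile, in which the weight function of the
arriving agent takes a random position and fresh samples take the others. -/
noncomputable def planIID (S : Scenario n m) : Plan n m where
  profile := fun t a => if (a : ℕ) = coinPos m (S.coins t) then S.weights (S.order t)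
    else S.samples (t * m + a)
  pos := fun t => ⟨coinPos m (S.coins t), coinPos_lt t.pos _⟩
  thr := 0

/-- The plan in the models with random arrival order: agents that have not yet arrived are
represented by their samples. -/
noncomputable def planOrder (S : Scenario n m) (N : ℕ) : Plan n m where
  profile := fun t a => if S.order.symm a ≤ t then S.weights a else S.samples a
  pos := fun t => S.order t
  thr := N

theorem weightsBefore_of_ge {L : Plan n m} {M : Matroid (Fin n)} {t a e : ℕ}
    (h : ¬ (a < m ∧ e < n)) : L.weightsBefore M t a e = 0 := by
  rw [Plan.weightsBefore]
  split_ifs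
  · simp [market, h]
  · rfl

theorem prepares_fillIID (S : Scenario n m) : Prepares fillIID S (planIID S) := by
  have hround : ∀ t : Fin m, (S.view t).round = t := fun _ => rfl
  have hm : ∀ t : Fin m, (S.view t).numAgents = m := fun _ => rfl
  have hpos : ∀ (t : Fin m) (s : Store), (posProg.exec (S.view t) s).nat nPos 0 0 =
      coinPos m (S.coins t) := fun t s => exec_pos
  refine ⟨fun t s hs => ?_, fun t s => ?_, fun t s => ?_, by decide, by decide⟩
  · simp only [fillIID, Prog.exec_seq]
    rw [Prog.real_exec (.setNat nThr (.lit 0) (.lit 0) (.lit 0)) (by decide)]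
    funext a e
    rw [exec_reveal (hpos t _), Prog.real_exec posProg (by decide), exec_sample]
    · rw [Prog.real_exec baseProg (by decide), hs]
      have hb : (Exp.var nBase).natVal (S.view t) (baseProg.exec (S.view t) s) = t * m :=
        exec_base t.2.le
      rw [hb]
      simp only [market, planIID, hm]
      by_cases hae : a < m ∧ e < n
      · rw [dif_pos hae, dif_pos hae]
        by_cases hap : a = coinPos m (S.coins t)
        · rw [dif_pos ⟨hap, hae.2⟩, if_pos hap]; rfl
        · rw [dif_neg (fun h => hap h.1), if_neg hap]; rfl
      · rw [dif_neg hae, dif_neg hae, weightsBefore_of_ge hae, dif_neg]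
        rintro ⟨rfl, he⟩
        exact hae ⟨coinPos_lt t.pos _, he⟩
    · intro u hu
      simp only [Exp.natVal_readNat, Exp.natVal_lit]
      rw [hu nBase (by decide)]
  · simp only [fillIID, Prog.exec_seq]
    rw [Prog.nat_exec (.setNat nThr (.lit 0) (.lit 0) (.lit 0)) (by decide),
      Prog.nat_exec revealProg (by decide), hpos]
    rfl
  · simp [fillIID, planIID]

theorem prepares_fillOrder (S : Scenario n m) {T : Prog} {N : ℕ}
    (hT : ∀ (t : Fin m) (s : Store), (T.exec (S.view t) s).nat nThr 0 0 = N)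
    (hTn : ∀ y ∈ [nOwn, nCode, nHeld, nPos], y ∉ T.natWrites)
    (hTr : ∀ y ∈ [rW, rUtil, rPrice], y ∉ T.realWrites) :
    Prepares (fillOrder T) S (planOrder S N) := by
  classical
  have hm : ∀ t : Fin m, (S.view t).numAgents = m := fun _ => rfl
  refine ⟨fun t s hs => ?_, fun t s => ?_, fun t s => ?_, fun y hy => ?_, fun y hy => ?_⟩
  · simp only [fillOrder, Prog.exec_seq]
    rw [T.real_exec (hTr _ (by simp))]
    funext a e
    rw [exec_reveal (p := S.order t) (by simp [Scenario.view]), Prog.exec_setNat,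
      Store.real_setNat]
    have hcond : Exp.round.Holds (S.view t) s ↔ (t : ℕ) ≠ 0 := Iff.rfl
    rw [Prog.exec_ite, if_congr hcond rfl rfl]
    simp only [market, planOrder]
    by_cases hae : a < m ∧ e < n
    · rw [dif_pos hae]
      by_cases hat : a = S.order t
      · rw [dif_pos ⟨hat, hae.2⟩, if_pos]
        · have : (⟨a, hae.1⟩ : Fin m) = S.order t := Fin.ext hat
          rw [this]; rfl
        · have : (⟨a, hae.1⟩ : Fin m) = S.order t := Fin.ext hat
          rw [this]; simp
      · have hne : S.order.symm ⟨a, hae.1⟩ ≠ t := by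
          intro h
          apply hat
          rw [← h]; simp
        rw [dif_neg (fun h => hat h.1)]
        split_ifs with h1 h2 h2
        · rw [Prog.exec_skip, hs, Plan.weightsBefore, dif_pos ⟨by omega, t.2.le⟩]
          simp only [market, planOrder]
          rw [dif_pos hae, if_pos]
          rw [Fin.le_def]
          have := Fin.val_ne_of_ne hne
          have := Fin.le_def.1 h2
          dsimp only
          omega
        · rw [Prog.exec_skip, hs, Plan.weightsBefore, dif_pos ⟨by omega, t.2.le⟩]
          simp only [market, planOrder]
          rw [dif_pos hae, if_neg]
          rw [Fin.le_def] at h2 ⊢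
          dsimp only
          omega
        · exfalso
          have := Fin.val_ne_of_ne hne
          have := Fin.le_def.1 h2
          omega
        · rw [exec_sample _ (fun _ _ => rfl), hm, dif_pos hae]
          simp [Scenario.view]
    · rw [dif_neg hae, dif_neg (fun h : a = S.order t ∧ e < n => hae ⟨h.1 ▸ (S.order t).2, h.2⟩)]
      split_ifs
      · rw [Prog.exec_skip, hs, weightsBefore_of_ge hae]
      · rw [exec_sample _ (fun _ _ => rfl), hm, dif_neg hae, hs, weightsBefore_of_ge hae]
  · simp only [fillOrder, Prog.exec_seq]
    rw [T.nat_exec (hTn _ (by simp)), Prog.nat_exec revealProg (by decide)]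
    simp [planOrder, Scenario.view]
  · simp only [fillOrder, Prog.exec_seq]
    exact hT t _
  · have h1 := hTn y (by simp only [List.mem_cons, List.not_mem_nil, or_false] at hy ⊢; tauto)
    have h2 : y ∉ ((Prog.ite .round .skip (sampleProg (.lit 0))) ;; .setNat nPos (.lit 0) (.lit 0) .agent ;;
      revealProg).natWrites := by clear h1; revert y; decide
    simp only [Prog.natWrites, List.mem_append, not_or] at h2
    simp only [fillOrder, Prog.natWrites, List.mem_append, not_or]
    exact ⟨h2.1, h2.2.1, h2.2.2, h1⟩
  · have h1 := hTr y (by simp only [List.mem_cons, List.not_mem_nil, or_false] at hy ⊢; tauto)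
    have h2 : y ∉ ((Prog.ite .round .skip (sampleProg (.lit 0))) ;; .setNat nPos (.lit 0) (.lit 0) .agent ;;
      revealProg).realWrites := by clear h1; revert y; decide
    simp only [Prog.realWrites, List.mem_append, not_or] at h2
    simp only [fillOrder, Prog.realWrites, List.mem_append, not_or]
    exact ⟨h2.1, h2.2.1, h2.2.2, h1⟩

/-- The program for the IID model. -/
def programIID : Prog := roundProg fillIID

/-- The program for the prophet-secretary model; no round is only observed. -/
def programProphetSecretary : Prog :=
  roundProg (fillOrder (.setNat nThr (.lit 0) (.lit 0) (.lit 0)))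

/-- The program for the secretary model. There the samples are zero, so that agents that have not yet
arrived do not count. -/
def programSecretary : Prog := roundProg (fillOrder thrProg)

theorem stepBound_programIID : ∃ b, b ∈ programIID.stepBound := ⟨_, rfl⟩

theorem stepBound_programProphetSecretary : ∃ b, b ∈ programProphetSecretary.stepBound := ⟨_, rfl⟩

theorem stepBound_programSecretary : ∃ b, b ∈ programSecretary.stepBound := ⟨_, rfl⟩

theorem prepares_prophetSecretary (S : Scenario n m) :
    Prepares (fillOrder (.setNat nThr (.lit 0) (.lit 0) (.lit 0))) S (planOrder S 0) :=
  prepares_fillOrder S (by simp) (by decide) (by decide)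

theorem prepares_secretary (S : Scenario n m) :
    Prepares (fillOrder thrProg) S (planOrder S (bestObserve S.k m m).2) :=
  prepares_fillOrder S (fun _ _ => exec_thr) (by decide) (by decide)

end

/-! ### Averaging over a finite sample space -/

/-- Averaging over the transformations `act r i` bounds the loss caused by the events `good r`, one
after the other: given everything that matters later, at most `k` of the transformations spoil
`good r`. -/
theorem prod_mul_sum_le {Ω ι : Type*} [Fintype Ω] {k t : ℕ} (act : ℕ → ι → Ω ≃ Ω)
    (Q : ℕ → Finset ι) (g : Ω → ℝ≥0) (good : ℕ → Ω → Prop) (N : ℕ)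
    (hg : ∀ r, N ≤ r → r < t → ∀ i ∈ Q r, ∀ x, g (act r i x) = g x)
    (hgood : ∀ r s, N ≤ r → r < s → s < t → ∀ i ∈ Q r, ∀ x, good s (act r i x) ↔ good s x)
    (hk : ∀ r, N ≤ r → r < t → ∀ x, g x ≠ 0 →
      ∃ S : Finset ι, S.card ≤ k ∧ ∀ i ∈ Q r, ¬ good r (act r i x) → i ∈ S) :
    (∏ r ∈ Finset.Ico N t, (((Q r).card - k : ℕ) : ℝ≥0) / (Q r).card) * ∑ x, g x ≤
      ∑ x, {x | ∀ r, N ≤ r → r < t → good r x}.indicator g x := by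
  classical
  induction h : t - N generalizing N with
  | zero =>
    rw [Finset.Ico_eq_empty (by omega), Finset.prod_empty, one_mul]
    refine Finset.sum_le_sum fun x _ => ?_
    rw [Set.indicator_of_mem]
    intro r hr hrt
    omega
  | succ d ih =>
    have hN : N < t := by omega
    have ih' := ih (N + 1) (fun r hr => hg r (by omega)) (fun r s hr => hgood r s (by omega))
      (fun r hr => hk r (by omega)) (by omega)
    rw [← Finset.insert_Ico_add_one_left_eq_Ico hN, Finset.prod_insert (by simp), mul_assoc]
    refine (mul_le_mul_right ih' _).trans ?_
    -- `G` contains the conditions for the rounds after `N`, and `act N i` does not affect it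
    set G : Ω → ℝ≥0 := fun x => {x | ∀ r, N + 1 ≤ r → r < t → good r x}.indicator g x with hG
    have hGact : ∀ i ∈ Q N, ∀ x, G (act N i x) = G x := fun i hi x => by
      simp only [hG, Set.indicator_apply]
      rw [hg N le_rfl hN i hi x]
      refine if_congr (forall₃_congr fun r hr hrt => ?_) rfl rfl
      exact hgood N r le_rfl hr hrt i hi x
    have hF : ∀ x, {x | ∀ r, N ≤ r → r < t → good r x}.indicator g x =
        if good N x then G x else 0 := fun x => by
      simp only [hG, Set.indicator_apply, Set.mem_ofPred_eq]
      rw [← ite_and]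
      refine if_congr ⟨fun h => ⟨h N le_rfl hN, fun r hr => h r (by omega)⟩, fun h r hr hrt => ?_⟩
        rfl rfl
      rcases eq_or_lt_of_le hr with rfl | hlt
      · exact h.1
      · exact h.2 r hlt hrt
    simp only [hF]
    rcases (Q N).card.eq_zero_or_pos with h0 | h0
    · simp [h0]
    rw [div_mul_eq_mul_div, div_le_iff₀ (by exact_mod_cast h0), mul_comm (∑ x, _) ((Q N).card : ℝ≥0)]
    have hsum : ((Q N).card : ℝ≥0) * ∑ x, (if good N x then G x else 0) =
        ∑ x, ∑ i ∈ Q N, if good N (act N i x) then G x else 0 := by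
      rw [Finset.sum_comm, ← nsmul_eq_mul, ← Finset.sum_const]
      refine Finset.sum_congr rfl fun i hi => ?_
      rw [← Equiv.sum_comp (act N i)]
      exact Finset.sum_congr rfl fun x _ => by rw [hGact i hi x]
    rw [hsum, Finset.mul_sum]
    refine Finset.sum_le_sum fun x _ => ?_
    rw [← Finset.sum_filter, Finset.sum_const, nsmul_eq_mul]
    by_cases hx : g x = 0
    · have : G x = 0 := by simp [hG, hx]
      exact (mul_eq_zero_of_right _ this).le.trans zero_le
    · refine mul_le_mul_left ?_ _
      obtain ⟨S, hS, hQS⟩ := hk N le_rfl hN x hx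
      have h1 : ((Q N).filter fun i => ¬ good N (act N i x)).card ≤ k :=
        (Finset.card_le_card fun i hi => hQS i (Finset.mem_filter.1 hi).1
          (Finset.mem_filter.1 hi).2).trans hS
      have h2 := Finset.card_filter_add_card_filter_not (s := Q N) (fun i => good N (act N i x))
      exact_mod_cast (by omega : (Q N).card - k ≤ ((Q N).filter fun i => good N (act N i x)).card)

namespace Plan

variable {n m k : ℕ} (L : Plan n m) (M : Matroid (Fin n)) (B : Pair n → Pair n → Prop)

/-- The weight of the tentative element of round `t`. -/
noncomputable def offer (t : Fin m) : ℝ≥0 :=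
  weightOf (L.profile t (L.pos t)) (solve M (L.profile t) (L.pos t))

/-- The certificate of round `r` does not block the one of round `t`; this holds in particular if one
of the rounds has no certificate. -/
def Passes (r t : Fin m) : Prop :=
  ∀ e f, solve M (L.profile t) (L.pos t) = some e → solve M (L.profile r) (L.pos r) = some f →
    ¬ B (heldSet M (L.profile r), f) (heldSet M (L.profile t), e)

/-- The weight that is collected in round `t`. -/
noncomputable def gain (t : Fin m) : ℝ≥0 :=
  weightOf (L.profile t (L.pos t)) (L.accepted M B t)

variable {L M B}

open Classical in
theorem gain_eq {t : Fin m} (ht : L.thr ≤ t) :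
    L.gain M B t = if ∀ r : Fin m, L.thr ≤ r → r < t → L.Passes M B r t then L.offer M t else 0 := by
  have h1 : L.tentative M t = solve M (L.profile t) (L.pos t) := by
    rw [tentative, if_neg (not_lt.2 ht)]
  rw [gain, accepted, offer, h1]
  by_cases hb : ∃ e, solve M (L.profile t) (L.pos t) = some e ∧ L.Blocked M B t e
  · rw [if_pos hb, if_neg]
    · rfl
    · obtain ⟨e, he, s, hst, f, hf, hB⟩ := hb
      obtain ⟨hs, hf⟩ := solve_of_tentative hf
      exact fun h => h s hs hst e f he hf hB
  · rw [if_neg hb]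
    split_ifs with hp
    · rfl
    · push Not at hp
      obtain ⟨r, hr, hrt, hpass⟩ := hp
      simp only [Passes, not_forall, not_not] at hpass
      obtain ⟨e, f, he, hf, hB⟩ := hpass
      refine absurd ⟨e, he, r, hrt, f, ?_, hB⟩ hb
      rw [tentative, if_neg (not_lt.2 hr), hf]

/-- If the position of round `r` varies, at most `k` of the certificates block a given one. -/
theorem card_not_blocking_le {ι : Type*} (hM : M.E = Set.univ) (hB : IsDirectedCertifier M k B)
    (X : Profile n m) {d : Pair n} (hd : IsCertificate M d) (Q : Finset ι) (p : ι → Fin m)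
    (hp : Set.InjOn p Q) [DecidablePred fun i => ∃ f, solve M X (p i) = some f ∧ B (heldSet M X, f) d] :
    (Q.filter fun i => ∃ f, solve M X (p i) = some f ∧ B (heldSet M X, f) d).card ≤ k := by
  classical
  have hI : M.Indep (heldSet M X : Set (Fin n)) := by
    have := (solve_feasible hM (X := X)).2
    convert this using 1
    ext f
    simp [heldSet, finalOwn_ne_zero_iff hM]
  refine le_trans ?_ (hB.directed (heldSet M X) d hI hd)
  set φ : ι → Fin n := fun i => (solve M X (p i)).getD d.2 with hφdef
  have hφ : ∀ i ∈ Q.filter fun i => ∃ f, solve M X (p i) = some f ∧ B (heldSet M X, f) d,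
      solve M X (p i) = some (φ i) ∧ B (heldSet M X, φ i) d := fun i hi => by
    obtain ⟨f, hf, hb⟩ := (Finset.mem_filter.1 hi).2
    simp only [hφdef, hf, Option.getD_some]
    exact ⟨trivial, hb⟩
  refine Finset.card_le_card_of_injOn φ (fun i hi => ?_) (fun i hi j hj hij => ?_)
  · have := hφ i hi
    simp only [Finset.coe_filter, Set.mem_ofPred_eq]
    exact ⟨(isCertificate_heldSet hM this.1).2, this.2⟩
  · have h1 := hφ i hi
    have h2 := hφ j hj
    have hi' := Finset.mem_filter.1 hi
    have hj' := Finset.mem_filter.1 hj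
    refine hp hi'.1 hj'.1 ?_
    by_contra hne
    have := (solve_feasible hM (X := X)).1 _ _ hne (by rw [h1.1, h2.1, hij])
    rw [this] at h1
    simp at h1

/-- The weight collected in round `t`, summed over a finite sample space, in terms of the tentative
weights: the transformation `act r i` leaves the rounds after `r` and the profile of round `r` alone
and gives different positions to round `r`. -/
theorem prod_mul_sum_offer_le {Ω ι : Type*} [Fintype Ω] (hM : M.E = Set.univ)
    (hB : IsDirectedCertifier M k B) (L : Ω → Plan n m) {N : ℕ} (hN : ∀ x, (L x).thr = N)
    (t : Fin m) (ht : N ≤ t) (act : ℕ → ι → Ω ≃ Ω) (Q : ℕ → Finset ι)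
    (hpro : ∀ r s : Fin m, r ≤ s → s ≤ t → ∀ i ∈ Q r, ∀ x,
      (L (act r i x)).profile s = (L x).profile s)
    (hpos : ∀ r s : Fin m, r < s → s ≤ t → ∀ i ∈ Q r, ∀ x, (L (act r i x)).pos s = (L x).pos s)
    (hinj : ∀ r : Fin m, r < t → ∀ x, Set.InjOn (fun i => (L (act r i x)).pos r) (Q r)) :
    (∏ r ∈ Finset.Ico N t, (((Q r).card - k : ℕ) : ℝ≥0) / (Q r).card) * ∑ x, (L x).offer M t ≤
      ∑ x, (L x).gain M B t := by
  classical
  have htm := t.2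
  have h := prod_mul_sum_le (k := k) (t := t) act Q (fun x => (L x).offer M t)
    (fun r x => ∀ h : r < m, (L x).Passes M B ⟨r, h⟩ t) N ?_ ?_ ?_
  · refine h.trans (le_of_eq (Finset.sum_congr rfl fun x _ => ?_))
    rw [gain_eq (by rw [hN]; exact ht), Set.indicator_apply]
    refine if_congr ?_ rfl rfl
    rw [hN]
    exact ⟨fun h r hr hrt => h r hr hrt r.2, fun h r hr hrt hrm => h ⟨r, hrm⟩ hr hrt⟩
  · intro r hr hrt i hi x
    have hr' : r < m := hrt.trans t.2
    simp only [offer]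
    rw [hpro ⟨r, hr'⟩ t hrt.le le_rfl i hi x, hpos ⟨r, hr'⟩ t hrt le_rfl i hi x]
  · intro r s hr hrs hst i hi x
    have hs : s < m := hst.trans htm
    have hr' : r < m := hrs.trans hs
    refine forall_congr' fun _ => ?_
    simp only [Passes]
    rw [hpro ⟨r, hr'⟩ t (hrs.trans hst).le le_rfl i hi x,
      hpos ⟨r, hr'⟩ t (hrs.trans hst) le_rfl i hi x,
      hpro ⟨r, hr'⟩ ⟨s, hs⟩ hrs.le hst.le i hi x, hpos ⟨r, hr'⟩ ⟨s, hs⟩ hrs hst.le i hi x]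
  · intro r hr hrt x hx
    have hr' : r < m := hrt.trans t.2
    cases hsol : solve M ((L x).profile t) ((L x).pos t) with
    | none => simp [offer, hsol, weightOf] at hx
    | some e =>
      refine ⟨_, card_not_blocking_le hM hB
        ((L x).profile ⟨r, hr'⟩) (isCertificate_heldSet hM hsol) (Q r)
        (fun i => (L (act r i x)).pos ⟨r, hr'⟩) (hinj ⟨r, hr'⟩ hrt x), fun i hi hnot => ?_⟩
      rw [Finset.mem_filter]
      refine ⟨hi, ?_⟩
      simp only [Passes, not_forall, not_not] at hnot
      obtain ⟨_, e', f, he', hf, hb⟩ := hnot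
      rw [hpro ⟨r, hr'⟩ t hrt.le le_rfl i hi x, hpos ⟨r, hr'⟩ t hrt le_rfl i hi x, hsol] at he'
      obtain rfl := Option.some_injective _ he'
      rw [hpro ⟨r, hr'⟩ ⟨r, hr'⟩ le_rfl hrt.le i hi x] at hf hb
      rw [hpro ⟨r, hr'⟩ t hrt.le le_rfl i hi x] at hb
      exact ⟨f, hf, hb⟩

/-- The position of round `t` itself is averaged out: over all positions, the tentative weights add up
to the value of the offline solution. -/
theorem card_mul_sum_offer {Ω ι : Type*} [Fintype Ω] (L : Ω → Plan n m) (t : Fin m)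
    (act : ι → Ω ≃ Ω) (Q : Finset ι)
    (hpro : ∀ i ∈ Q, ∀ x, (L (act i x)).profile t = (L x).profile t) :
    (Q.card : ℝ≥0) * ∑ x, (L x).offer M t = ∑ x, ∑ i ∈ Q,
      weightOf ((L x).profile t ((L (act i x)).pos t))
        (solve M ((L x).profile t) ((L (act i x)).pos t)) := by
  rw [Finset.sum_comm, ← nsmul_eq_mul, ← Finset.sum_const]
  refine Finset.sum_congr rfl fun i hi => ?_
  rw [← Equiv.sum_comp (act i)]
  exact Finset.sum_congr rfl fun x _ => by rw [offer, hpro i hi x]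

end Plan

/-! ### Random arrival order -/

section
variable {n m k : ℕ} {M : Matroid (Fin n)} {B : Pair n → Pair n → Prop}

/-- In the arrival order, the agents of the rounds `r` and `i` change places. -/
def swapRound (r : ℕ) (i : Fin m) : Equiv.Perm (Fin m) ≃ Equiv.Perm (Fin m) :=
  if h : r < m then Equiv.mulRight (Equiv.swap ⟨r, h⟩ i) else Equiv.refl _

theorem swapRound_apply (r i : Fin m) (π : Equiv.Perm (Fin m)) (s : Fin m) :
    swapRound r i π s = π (Equiv.swap r i s) := by
  simp [swapRound]

theorem swapRound_symm_apply (r i : Fin m) (π : Equiv.Perm (Fin m)) (a : Fin m) :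
    (swapRound r i π).symm a = Equiv.swap r i (π.symm a) := by
  rw [Equiv.symm_apply_eq, swapRound_apply, Equiv.swap_apply_self, Equiv.apply_symm_apply]

theorem sum_offer_eq (X : Profile n m) (hM : M.E = Set.univ) :
    ∑ a, weightOf (X a) (solve M X a) = opt M X := value_solve hM

/-- The plan of the models with random arrival order, as a function of that order. The profile of
round `r` contains the weights `Y` of an agent, or `Y'` if the agent arrives in one of the rounds
described by `late r`. -/
noncomputable def orderPlan (Y Y' : Profile n m) (late : Fin m → Fin m → Prop) (N : ℕ)
    (π : Equiv.Perm (Fin m)) : Plan n m where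
  profile := fun r a => open Classical in if late r (π.symm a) then Y' a else Y a
  pos := fun r => π r
  thr := N

/-- Averaging over the arrival order: the agent of round `r` changes places with the agents of
rounds that are on the same side as `r` for all later decisions. -/
theorem prod_mul_sum_orderPlan_le (hM : M.E = Set.univ) (hB : IsDirectedCertifier M k B)
    (Y Y' : Profile n m) (late : Fin m → Fin m → Prop) (N : ℕ) (t : Fin m) (ht : N ≤ t)
    (Q : ℕ → Finset (Fin m))
    (hlate : ∀ r s : Fin m, r ≤ s → s ≤ t → ∀ i ∈ Q r, (late s r ↔ late s i))
    (hQ : ∀ r s : Fin m, r < s → s ≤ t → s ∉ Q r) :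
    (∏ r ∈ Finset.Ico N t, (((Q r).card - k : ℕ) : ℝ≥0) / (Q r).card) *
      ∑ π, (orderPlan Y Y' late N π).offer M t ≤ ∑ π, (orderPlan Y Y' late N π).gain M B t := by
  classical
  refine Plan.prod_mul_sum_offer_le hM hB (orderPlan Y Y' late N) (fun _ => rfl) t ht swapRound Q
    ?_ ?_ ?_
  · intro r s hrs hst i hi π
    funext a
    simp only [orderPlan]
    refine if_congr ?_ rfl rfl
    rw [swapRound_symm_apply]
    by_cases h1 : π.symm a = r
    · rw [h1, Equiv.swap_apply_left]; exact (hlate r s hrs hst i hi).symm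
    · by_cases h2 : π.symm a = i
      · rw [h2, Equiv.swap_apply_right]; exact hlate r s hrs hst i hi
      · rw [Equiv.swap_apply_of_ne_of_ne h1 h2]
  · intro r s hrs hst i hi π
    simp only [orderPlan]
    rw [swapRound_apply, Equiv.swap_apply_of_ne_of_ne hrs.ne']
    rintro rfl
    exact hQ r s hrs hst hi
  · intro r hr π i _ j _ hij
    simp only [orderPlan, swapRound_apply, Equiv.swap_apply_left] at hij
    exact π.injective hij

/-- Averaging the weight of the tentative element of round `t` over the arrival order. -/
theorem card_mul_sum_orderPlan_offer (Y Y' : Profile n m) (late : Fin m → Fin m → Prop) (N : ℕ)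
    (t : Fin m) (Q : Finset (Fin m)) (hlate : ∀ i ∈ Q, (late t t ↔ late t i)) :
    (Q.card : ℝ≥0) * ∑ π, (orderPlan Y Y' late N π).offer M t = ∑ π, ∑ i ∈ Q,
      weightOf ((orderPlan Y Y' late N π).profile t (π i))
        (solve M ((orderPlan Y Y' late N π).profile t) (π i)) := by
  classical
  rw [Plan.card_mul_sum_offer (orderPlan Y Y' late N) t (swapRound t) Q]
  · refine Finset.sum_congr rfl fun π _ => Finset.sum_congr rfl fun i _ => ?_
    have : (orderPlan Y Y' late N (swapRound t i π)).pos t = π i := by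
      simp only [orderPlan, swapRound_apply, Equiv.swap_apply_left]
    rw [this]
  · intro i hi π
    funext a
    simp only [orderPlan]
    refine if_congr ?_ rfl rfl
    rw [swapRound_symm_apply]
    by_cases h1 : π.symm a = t
    · rw [h1, Equiv.swap_apply_left]; exact (hlate i hi).symm
    · by_cases h2 : π.symm a = i
      · rw [h2, Equiv.swap_apply_right]; exact hlate i hi
      · rw [Equiv.swap_apply_of_ne_of_ne h1 h2]

/-! ### The secretary model -/

/-- The round in which an agent arrives is uniformly distributed. -/
theorem mul_sum_perm_symm (f : Fin m → ℝ≥0) (a : Fin m) :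
    (m : ℝ≥0) * ∑ π : Equiv.Perm (Fin m), f (π.symm a) = m.factorial * ∑ i, f i := by
  have h : ∀ b, ∑ π : Equiv.Perm (Fin m), f (π.symm a) = ∑ π : Equiv.Perm (Fin m), f (π.symm b) := by
    intro b
    rw [← Equiv.sum_comp (Equiv.mulLeft (Equiv.swap a b))
      fun π : Equiv.Perm (Fin m) => f (π.symm a)]
    refine Finset.sum_congr rfl fun π _ => ?_
    congr 1
    rw [Equiv.symm_apply_eq]
    simp
  calc (m : ℝ≥0) * ∑ π : Equiv.Perm (Fin m), f (π.symm a)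
      = ∑ _b : Fin m, ∑ π : Equiv.Perm (Fin m), f (π.symm a) := by simp
    _ = ∑ b : Fin m, ∑ π : Equiv.Perm (Fin m), f (π.symm b) := Finset.sum_congr rfl fun b _ => h b
    _ = ∑ π : Equiv.Perm (Fin m), ∑ b : Fin m, f (π.symm b) := Finset.sum_comm
    _ = ∑ _π : Equiv.Perm (Fin m), ∑ i, f i :=
        Finset.sum_congr rfl fun π _ => Equiv.sum_comp π.symm f
    _ = _ := by simp [Fintype.card_perm]

/-- The profile of the agents that have arrived up to round `t` contains in expectation a fraction
`(t + 1) / m` of the optimum. -/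
theorem sum_opt_arrived_ge (hM : M.E = Set.univ) (w : Profile n m) (N : ℕ) (t : Fin m) :
    (m.factorial : ℝ≥0) * ((t + 1 : ℕ) : ℝ≥0) * opt M w ≤
      m * ∑ π, opt M ((orderPlan w 0 (fun r s => r < s) N π).profile t) := by
  classical
  have h1 : ∀ π : Equiv.Perm (Fin m),
      ∑ a, (if t < π.symm a then 0 else weightOf (w a) (solve M w a)) ≤
        opt M ((orderPlan w 0 (fun r s => r < s) N π).profile t) := fun π => by
    refine le_trans (le_of_eq ?_) (value_le_opt (solve_feasible hM (X := w)))
    refine Finset.sum_congr rfl fun a _ => ?_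
    simp only [orderPlan]
    split_ifs
    · cases solve M w a <;> rfl
    · rfl
  refine le_trans (le_of_eq ?_) (mul_le_mul_right (Finset.sum_le_sum fun π _ => h1 π) _)
  rw [Finset.sum_comm, Finset.mul_sum]
  have h2 : ∀ a, (m : ℝ≥0) * ∑ π : Equiv.Perm (Fin m),
      (if t < π.symm a then 0 else weightOf (w a) (solve M w a)) =
      m.factorial * ((t + 1 : ℕ) : ℝ≥0) * weightOf (w a) (solve M w a) := fun a => by
    rw [mul_sum_perm_symm (fun s => if t < s then 0 else weightOf (w a) (solve M w a)) a, mul_assoc]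
    congr 1
    rw [Finset.sum_ite, Finset.sum_const_zero, zero_add, Finset.sum_const, nsmul_eq_mul]
    congr 2
    rw [← Fin.card_Iic]
    congr 1
    ext s
    simp
  simp only [h2]
  rw [← Finset.mul_sum, sum_offer_eq w hM]

/-- The weight that is collected in a single round, summed over all arrival orders. Given the rounds
after `r`, the agent of round `r` is uniformly distributed on the first `r + 1` agents. -/
theorem sum_gain_secretary_ge (hM : M.E = Set.univ) (hB : IsDirectedCertifier M k B)
    (w : Profile n m) (N : ℕ) (t : Fin m) (ht : N ≤ t) :
    (m.factorial : ℝ≥0) * (∏ r ∈ Finset.Ico N t, (((r + 1 - k : ℕ) : ℝ≥0) / ((r + 1 : ℕ) : ℝ≥0))) *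
      opt M w ≤ m * ∑ π, (orderPlan w 0 (fun r s => r < s) N π).gain M B t := by
  classical
  let Q : ℕ → Finset (Fin m) := fun r => Finset.univ.filter fun i => (i : ℕ) ≤ r
  have hQ : ∀ r < m, (Q r).card = r + 1 := fun r hr => by
    rw [← Fin.card_Iic ⟨r, hr⟩]
    congr 1
    ext i
    simp [Q, Fin.le_def]
  have h1 := prod_mul_sum_orderPlan_le hM hB w 0 (fun r s => r < s) N t ht Q ?_ ?_
  · have h2 := card_mul_sum_orderPlan_offer (M := M) w 0 (fun r s => r < s) N t (Q t) ?_
    · have h3 : ∀ π : Equiv.Perm (Fin m), ∑ i ∈ Q t,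
          weightOf ((orderPlan w 0 (fun r s => r < s) N π).profile t (π i))
            (solve M ((orderPlan w 0 (fun r s => r < s) N π).profile t) (π i)) =
          opt M ((orderPlan w 0 (fun r s => r < s) N π).profile t) := fun π => by
        rw [← sum_offer_eq _ hM, ← Equiv.sum_comp π]
        refine Finset.sum_subset (Finset.subset_univ _) fun i _ hi => ?_
        have hti : t < i := by
          refine not_le.1 fun h => hi ?_
          simp only [Q, Finset.mem_filter, Finset.mem_univ, true_and]
          exact h
        have : (orderPlan w 0 (fun r s => r < s) N π).profile t (π i) = 0 := by
          funext e
          simp only [orderPlan, Equiv.symm_apply_apply, if_pos hti]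
          rfl
        rw [this]
        cases solve M ((orderPlan w 0 (fun r s => r < s) N π).profile t) (π i) <;> rfl
      simp only [h3] at h2
      have h4 := sum_opt_arrived_ge hM w N t
      rw [← h2, hQ t t.2] at h4
      have h5 : (m.factorial : ℝ≥0) * opt M w ≤
          m * ∑ π, (orderPlan w 0 (fun r s => r < s) N π).offer M t := by
        have hpos : (0 : ℝ≥0) < ((t + 1 : ℕ) : ℝ≥0) := by exact_mod_cast Nat.succ_pos _
        refine le_of_mul_le_mul_left ?_ hpos
        calc _ = (m.factorial : ℝ≥0) * ((t + 1 : ℕ) : ℝ≥0) * opt M w := by ring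
          _ ≤ _ := h4
          _ = _ := by ring
      have h6 : ∏ r ∈ Finset.Ico N t, (((Q r).card - k : ℕ) : ℝ≥0) / (Q r).card =
          ∏ r ∈ Finset.Ico N t, (((r + 1 - k : ℕ) : ℝ≥0) / ((r + 1 : ℕ) : ℝ≥0)) :=
        Finset.prod_congr rfl fun r hr => by
          rw [hQ r ((Finset.mem_Ico.1 hr).2.trans t.2)]
      rw [h6] at h1
      calc _ = (∏ r ∈ Finset.Ico N t, (((r + 1 - k : ℕ) : ℝ≥0) / ((r + 1 : ℕ) : ℝ≥0))) *
            (m.factorial * opt M w) := by ring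
        _ ≤ _ := mul_le_mul_right h5 _
        _ = m * ((∏ r ∈ Finset.Ico N t, (((r + 1 - k : ℕ) : ℝ≥0) / ((r + 1 : ℕ) : ℝ≥0))) *
          ∑ π, (orderPlan w 0 (fun r s => r < s) N π).offer M t) := by ring
        _ ≤ _ := mul_le_mul_right h1 _
    · intro i hi
      simp only [Q, Finset.mem_filter, Finset.mem_univ, true_and] at hi
      simp only [lt_irrefl, false_iff, not_lt]
      exact hi
  · intro r s hrs hst i hi
    simp only [Q, Finset.mem_filter, Finset.mem_univ, true_and] at hi
    have : i ≤ r := hi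
    exact iff_of_false (not_lt.2 hrs) (not_lt.2 (this.trans hrs))
  · intro r s hrs hst hs
    simp only [Q, Finset.mem_filter, Finset.mem_univ, true_and] at hs
    exact absurd hs (not_le.2 hrs)

/-- The total weight in the secretary model, summed over all arrival orders. -/
theorem sum_gain_secretary_total (hM : M.E = Set.univ) (hB : IsDirectedCertifier M k B)
    (w : Profile n m) (N : ℕ) :
    m.factorial * observeGain k m N * opt M w ≤
      m * ∑ π, ∑ t, ((orderPlan w 0 (fun r s => r < s) N π).gain M B t : ℝ) := by
  rw [Finset.sum_comm, Finset.mul_sum, observeGain, Finset.sum_range, Finset.mul_sum, Finset.sum_mul]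
  refine Finset.sum_le_sum fun t _ => ?_
  split_ifs with h
  · have := sum_gain_secretary_ge hM hB w N t h
    have h' := NNReal.coe_le_coe.2 this
    simp only [NNReal.coe_mul, NNReal.coe_natCast, NNReal.coe_prod, NNReal.coe_div,
      NNReal.coe_sum] at h'
    exact h'
  · rw [mul_zero, zero_mul]
    positivity

end

/-! ### Lower bounds for the competitive ratios -/

section
open Polynomial

theorem passRatio_nonneg (k r : ℕ) : 0 ≤ passRatio k r := by
  unfold passRatio; positivity

theorem le_passRatio (k r : ℕ) : 1 - (k : ℝ) / (r + 1) ≤ passRatio k r := by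
  have hr : (0 : ℝ) < r + 1 := by positivity
  rw [passRatio, one_sub_div hr.ne']
  push_cast
  refine div_le_div_of_nonneg_right ?_ hr.le
  rcases le_or_gt k (r + 1) with h | h
  · rw [Nat.cast_sub h]; push_cast; linarith
  · have : ((r + 1 : ℕ) : ℝ) < k := by exact_mod_cast h
    push_cast at this
    refine le_trans ?_ (Nat.cast_nonneg _)
    linarith

theorem observeGain_nonneg (k m N : ℕ) : 0 ≤ observeGain k m N := by
  refine Finset.sum_nonneg fun s _ => ?_
  split_ifs
  · exact Finset.prod_nonneg fun r _ => passRatio_nonneg k r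
  · exact le_rfl

theorem observeGain_self (k m : ℕ) : observeGain k m m = 0 := by
  refine Finset.sum_eq_zero fun s hs => ?_
  rw [if_neg]
  rw [Finset.mem_range] at hs
  omega

theorem observeGain_succ (k : ℕ) {m N : ℕ} (h : N < m) :
    observeGain k m N = 1 + passRatio k N * observeGain k m (N + 1) := by
  rw [observeGain, observeGain, Finset.mul_sum,
    ← Finset.add_sum_erase _ _ (Finset.mem_range.2 h), if_pos le_rfl]
  congr 1
  · simp
  · rw [← Finset.add_sum_erase (Finset.range m)
      (fun s => passRatio k N * if N + 1 ≤ s then _ else _) (Finset.mem_range.2 h), if_neg (by omega),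
      mul_zero, zero_add]
    refine Finset.sum_congr rfl fun s hs => ?_
    rw [Finset.mem_erase] at hs
    by_cases hNs : N ≤ s
    · have : N < s := by omega
      rw [if_pos hNs, if_pos (by omega), ← Finset.insert_Ico_add_one_left_eq_Ico this,
        Finset.prod_insert (by simp)]
    · rw [if_neg hNs, if_neg (by omega), mul_zero]

/-- The expected gain if the length of the observation phase has a binomial distribution, as a polynomial
in the success probability. This is the gain of the algorithm that observes the agents that arrive up to
a fixed time, if the arrival times are independent and uniformly distributed. -/
noncomputable def mixedGain (k m : ℕ) : ℝ[X] :=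
  ∑ N ∈ Finset.range (m + 1), C (observeGain k m N) * bernsteinPolynomial ℝ m N

theorem bernstein_eval_nonneg (m N : ℕ) {p : ℝ} (hp : 0 ≤ p) (hp1 : p ≤ 1) :
    0 ≤ (bernsteinPolynomial ℝ m N).eval p := by
  simp only [bernsteinPolynomial, eval_mul, eval_pow, eval_sub, eval_one, eval_X, eval_natCast]
  have : 0 ≤ 1 - p := by linarith
  positivity

theorem derivative_mixedGain (k m : ℕ) : (mixedGain k (m + 1)).derivative =
    ((m + 1 : ℕ) : ℝ[X]) * ∑ N ∈ Finset.range (m + 1),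
      C (observeGain k (m + 1) (N + 1) - observeGain k (m + 1) N) * bernsteinPolynomial ℝ m N := by
  have h0 : bernsteinPolynomial ℝ m (m + 1) = 0 := bernsteinPolynomial.eq_zero_of_lt _ (by omega)
  rw [mixedGain, Finset.sum_range_succ', derivative_add, derivative_sum]
  simp only [derivative_C_mul, bernsteinPolynomial.derivative_succ, bernsteinPolynomial.derivative_zero,
    Nat.add_sub_cancel]
  have h1 := Finset.sum_range_succ' (fun N => C (observeGain k (m + 1) N) * bernsteinPolynomial ℝ m N)
    (m + 1)
  rw [Finset.sum_range_succ, h0, mul_zero, add_zero] at h1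
  have h2 : ∑ N ∈ Finset.range (m + 1),
      C (observeGain k (m + 1) (N + 1) - observeGain k (m + 1) N) * bernsteinPolynomial ℝ m N =
      ∑ N ∈ Finset.range (m + 1), C (observeGain k (m + 1) (N + 1)) * bernsteinPolynomial ℝ m N -
        ∑ N ∈ Finset.range (m + 1), C (observeGain k (m + 1) N) * bernsteinPolynomial ℝ m N := by
    rw [← Finset.sum_sub_distrib]
    exact Finset.sum_congr rfl fun N _ => by rw [C_sub, sub_mul]
  rw [h2, h1, mul_sub, mul_add, Finset.mul_sum, Finset.mul_sum, ← sub_sub, ← Finset.sum_sub_distrib,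
    sub_eq_add_neg]
  refine congr_arg₂ _ (Finset.sum_congr rfl fun N _ => by ring) (by ring)

/-- A differential inequality for the mixed gain, which comes from the recursion `observeGain_succ`. -/
theorem eval_derivative_mixedGain_le (k m : ℕ) {p : ℝ} (hp : 0 < p) (hp1 : p ≤ 1) :
    (mixedGain k (m + 1)).derivative.eval p ≤
      -((m : ℝ) + 1) + (k / p) * (mixedGain k (m + 1)).eval p := by
  set T := observeGain k (m + 1) with hT
  have hb := fun N => bernstein_eval_nonneg m N hp.le hp1
  have h1 : ∀ N ∈ Finset.range (m + 1), T (N + 1) - T N ≤ k / (N + 1) * T (N + 1) - 1 := by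
    intro N hN
    rw [Finset.mem_range] at hN
    have h2 := observeGain_succ k hN
    have h3 := mul_le_mul_of_nonneg_right (le_passRatio k N) (observeGain_nonneg k (m + 1) (N + 1))
    rw [hT]
    linarith
  have hsum : ∑ N ∈ Finset.range (m + 1), (bernsteinPolynomial ℝ m N).eval p = 1 := by
    rw [← eval_finsetSum, bernsteinPolynomial.sum, eval_one]
  have h4 : ∀ N, ((m : ℝ) + 1) * (1 / (N + 1) * (bernsteinPolynomial ℝ m N).eval p) =
      1 / p * (bernsteinPolynomial ℝ (m + 1) (N + 1)).eval p := by
    intro N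
    simp only [bernsteinPolynomial, eval_mul, eval_pow, eval_sub, eval_one, eval_X, eval_natCast]
    have hc : ((m : ℝ) + 1) * m.choose N = (m + 1).choose (N + 1) * (N + 1) := by
      exact_mod_cast Nat.add_one_mul_choose_eq m N
    have hN : (N : ℝ) + 1 ≠ 0 := by positivity
    rw [Nat.add_sub_add_right, pow_succ]
    field_simp
    linear_combination ((1 - p) ^ (m - N)) * hc
  rw [derivative_mixedGain, eval_mul, eval_finsetSum, eval_natCast]
  simp only [eval_mul, eval_C]
  push_cast
  calc ((m : ℝ) + 1) * ∑ N ∈ Finset.range (m + 1), (T (N + 1) - T N) *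
        (bernsteinPolynomial ℝ m N).eval p
      ≤ ((m : ℝ) + 1) * ∑ N ∈ Finset.range (m + 1), (k / (N + 1) * T (N + 1) - 1) *
        (bernsteinPolynomial ℝ m N).eval p := by
        refine mul_le_mul_of_nonneg_left (Finset.sum_le_sum fun N hN => ?_) (by positivity)
        exact mul_le_mul_of_nonneg_right (h1 N hN) (hb N)
    _ = -((m : ℝ) + 1) + k * ∑ N ∈ Finset.range (m + 1), T (N + 1) *
        (((m : ℝ) + 1) * (1 / (N + 1) * (bernsteinPolynomial ℝ m N).eval p)) := by
        have : ∑ N ∈ Finset.range (m + 1), (k / (N + 1) * T (N + 1) - 1) *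
            (bernsteinPolynomial ℝ m N).eval p =
            ∑ N ∈ Finset.range (m + 1), k / (N + 1) * T (N + 1) *
              (bernsteinPolynomial ℝ m N).eval p - 1 := by
          simp only [sub_mul, one_mul, Finset.sum_sub_distrib, hsum]
        rw [this, mul_sub, Finset.mul_sum, Finset.mul_sum, mul_one, sub_eq_neg_add]
        congr 1
        exact Finset.sum_congr rfl fun N _ => by ring
    _ = -((m : ℝ) + 1) + k / p * ∑ N ∈ Finset.range (m + 1), T (N + 1) *
          (bernsteinPolynomial ℝ (m + 1) (N + 1)).eval p := by
        simp only [h4]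
        rw [Finset.mul_sum, Finset.mul_sum]
        congr 1
        exact Finset.sum_congr rfl fun N _ => by ring
    _ ≤ _ := by
        refine add_le_add_right (mul_le_mul_of_nonneg_left ?_ (by positivity)) _
        rw [mixedGain, eval_finsetSum, Finset.sum_range_succ' _ (m + 1)]
        simp only [eval_mul, eval_C]
        exact le_add_of_nonneg_right (mul_nonneg (observeGain_nonneg _ _ _)
          (bernstein_eval_nonneg _ _ hp.le hp1))

/-- The differential inequality for the mixed gain, integrated from `p` to `1`; the function `F` is the
integral of `x ^ (-k)` over the interval from its argument to `1`. -/
theorem le_eval_mixedGain (k m : ℕ) (F : ℝ → ℝ) (hF : ∀ x, 0 < x → HasDerivAt F (-(x ^ k)⁻¹) x)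
    (hF1 : F 1 = 0) {p : ℝ} (hp : 0 < p) (hp1 : p ≤ 1) :
    ((m : ℝ) + 1) * (p ^ k * F p) ≤ (mixedGain k (m + 1)).eval p := by
  set G := mixedGain k (m + 1) with hG
  set Φ : ℝ → ℝ := fun x => G.eval x / x ^ k - ((m : ℝ) + 1) * F x with hΦ
  have hd : ∀ x, 0 < x → HasDerivAt Φ ((G.derivative.eval x * x ^ k -
      G.eval x * (k * x ^ (k - 1))) / (x ^ k) ^ 2 - ((m : ℝ) + 1) * (-(x ^ k)⁻¹)) x := fun x hx =>
    ((G.hasDerivAt x).div (hasDerivAt_pow k x) (pow_pos hx k).ne').sub ((hF x hx).const_mul _)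
  have hanti : AntitoneOn Φ (Set.Icc p 1) := by
    refine antitoneOn_of_deriv_nonpos (convex_Icc p 1) ?_ ?_ ?_
    · exact fun x hx => (hd x (hp.trans_le hx.1)).continuousAt.continuousWithinAt
    · exact fun x hx => (hd x (hp.trans_le (interior_subset hx).1)).differentiableAt.differentiableWithinAt
    · intro x hx
      have hx' := interior_subset hx
      have hx0 : 0 < x := hp.trans_le hx'.1
      rw [(hd x hx0).deriv]
      have h1 := eval_derivative_mixedGain_le k m hx0 hx'.2
      rw [← hG] at h1
      have hxk : 0 < x ^ k := pow_pos hx0 k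
      have h2 : (k : ℝ) * x ^ (k - 1) = k / x * x ^ k := by
        rcases k with _ | k
        · simp
        · rw [Nat.add_sub_cancel, pow_succ]; field_simp
      rw [h2, mul_neg, sub_neg_eq_add, ← div_eq_mul_inv]
      have h3 : (G.derivative.eval x * x ^ k - G.eval x * (k / x * x ^ k)) / (x ^ k) ^ 2 =
          (G.derivative.eval x - k / x * G.eval x) / x ^ k := by
        field_simp
      rw [h3, ← add_div]
      exact div_nonpos_of_nonpos_of_nonneg (by linarith) hxk.le
  have h1 := hanti (Set.left_mem_Icc.2 hp1) (Set.right_mem_Icc.2 hp1) hp1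
  have hG1 : G.eval 1 = 0 := by
    rw [hG, mixedGain, eval_finsetSum]
    refine Finset.sum_eq_zero fun N hN => ?_
    rw [Finset.mem_range] at hN
    rcases Nat.lt_succ_iff_lt_or_eq.1 hN with h | rfl
    · simp [bernsteinPolynomial, show m + 1 - N ≠ 0 by omega]
    · rw [observeGain_self]; simp
  simp only [hΦ, hG1, hF1] at h1
  rw [mul_zero, zero_div, sub_zero, sub_nonneg, le_div_iff₀ (pow_pos hp k)] at h1
  linarith

/-- The best observation phase is at least as good as a binomially distributed one, whose success
probability is chosen as `1 / e` for `k = 1` and as `k ^ (-1 / (k - 1))` for `k ≥ 2`. -/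
theorem exists_observeGain_ge {k m : ℕ} (hk : 1 ≤ k) :
    secretaryRatio k * (m + 1) ≤ (bestObserve k (m + 1) (m + 1)).1 := by
  set V := (bestObserve k (m + 1) (m + 1)).1 with hV
  have hle : ∀ N < m + 1, observeGain k (m + 1) N ≤ V := fun N hN => observeGain_le_bestObserve hN
  have hV0 : 0 ≤ V := (observeGain_nonneg k (m + 1) 0).trans (hle 0 (by omega))
  have hmix : ∀ p : ℝ, 0 < p → p ≤ 1 → (mixedGain k (m + 1)).eval p ≤ V := by
    intro p hp hp1
    have hsum : ∑ N ∈ Finset.range (m + 1 + 1), (bernsteinPolynomial ℝ (m + 1) N).eval p = 1 := by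
      rw [← eval_finsetSum, bernsteinPolynomial.sum, eval_one]
    rw [mixedGain, eval_finsetSum]
    calc _ ≤ ∑ N ∈ Finset.range (m + 1 + 1), V * (bernsteinPolynomial ℝ (m + 1) N).eval p := by
          refine Finset.sum_le_sum fun N hN => ?_
          rw [eval_mul, eval_C]
          refine mul_le_mul_of_nonneg_right ?_ (bernstein_eval_nonneg _ _ hp.le hp1)
          rw [Finset.mem_range] at hN
          rcases Nat.lt_succ_iff_lt_or_eq.1 hN with h | rfl
          · exact hle N h
          · rw [observeGain_self]; exact hV0
      _ = V := by rw [← Finset.mul_sum, hsum, mul_one]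
  rw [secretaryRatio]
  split_ifs with h1
  · subst h1
    have hp : 0 < (Real.exp 1)⁻¹ := by positivity
    have hp1 : (Real.exp 1)⁻¹ ≤ 1 := inv_le_one_of_one_le₀ (Real.one_le_exp zero_le_one)
    have := le_eval_mixedGain 1 m (fun x => -Real.log x) (fun x hx => by
      rw [pow_one]; exact (Real.hasDerivAt_log hx.ne').neg) (by simp) hp hp1
    rw [Real.log_inv, Real.log_exp, neg_neg, mul_one, pow_one] at this
    linarith [hmix _ hp hp1]
  · have hk2 : 2 ≤ k := by omega
    have hk1 : (0 : ℝ) < k - 1 := by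
      have : (2 : ℝ) ≤ k := by exact_mod_cast hk2
      linarith
    have hk0 : (0 : ℝ) < k := by linarith
    set p : ℝ := (k : ℝ) ^ (-(1 / ((k : ℝ) - 1))) with hpdef
    have hp : 0 < p := Real.rpow_pos_of_pos hk0 _
    have hp1 : p ≤ 1 := Real.rpow_le_one_of_one_le_of_nonpos (by linarith)
      (neg_nonpos.2 (by positivity))
    have hpk : p ^ (k - 1) = (k : ℝ)⁻¹ := by
      rw [hpdef, ← Real.rpow_natCast, ← Real.rpow_mul hk0.le, Nat.cast_sub hk, Nat.cast_one,
        neg_mul, one_div_mul_cancel hk1.ne', Real.rpow_neg_one]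
    have hratio : (k : ℝ) ^ (-((k : ℝ) / ((k : ℝ) - 1))) = p * (k : ℝ)⁻¹ := by
      rw [hpdef, ← Real.rpow_neg_one (k : ℝ), ← Real.rpow_add hk0]
      congr 1
      field_simp
      ring
    have := le_eval_mixedGain k m (fun x => ((x ^ (k - 1))⁻¹ - 1) / ((k : ℝ) - 1)) (fun x hx => by
      have h := (((hasDerivAt_pow (k - 1) x).inv (pow_pos hx _).ne').sub_const 1).div_const
        ((k : ℝ) - 1)
      refine h.congr_deriv ?_
      rw [Nat.cast_sub hk, Nat.cast_one]
      obtain ⟨l, rfl⟩ : ∃ l, k = l + 2 := ⟨k - 2, by omega⟩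
      simp only [show l + 2 - 1 = l + 1 by omega, show l + 1 - 1 = l by omega]
      have hx0 := hx.ne'
      field_simp
      try ring) (by simp) hp hp1
    have hval : p ^ k * (((p ^ (k - 1))⁻¹ - 1) / ((k : ℝ) - 1)) = p * (k : ℝ)⁻¹ := by
      have : p ^ k = p * p ^ (k - 1) := by
        rw [← pow_succ']; congr 1; omega
      rw [this, hpk, inv_inv]
      field_simp
    rw [hval] at this
    rw [hratio]
    linarith [hmix _ hp hp1]

theorem secretaryRatio_nonneg (k : ℕ) : 0 ≤ secretaryRatio k := by
  rw [secretaryRatio]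
  split_ifs
  · positivity
  · exact Real.rpow_nonneg (Nat.cast_nonneg k) _

theorem secretaryRatio_pos {k : ℕ} (hk : 1 ≤ k) : 0 < secretaryRatio k := by
  rw [secretaryRatio]
  split_ifs
  · positivity
  · exact Real.rpow_pos_of_pos (by exact_mod_cast hk) _

/-- The observation phase that the secretary program chooses is long enough. -/
theorem secretaryRatio_mul_le_observeGain {k m : ℕ} (hk : 1 ≤ k) (hm : 0 < m) :
    secretaryRatio k * m ≤ observeGain k m (bestObserve k m m).2 := by
  obtain ⟨m, rfl⟩ : ∃ l, m = l + 1 := ⟨m - 1, by omega⟩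
  have h := exists_observeGain_ge (m := m) hk
  have hpos : 0 < (bestObserve k (m + 1) (m + 1)).1 :=
    lt_of_lt_of_le (mul_pos (secretaryRatio_pos hk) (by positivity)) h
  rw [(bestObserve_spec hpos).2]
  push_cast
  exact h

end

/-- The sum of the guarantees for the single rounds in the prophet-secretary model satisfies a recursion
in the number of agents. -/
theorem prophetSecretary_sum_ge (k m : ℕ) :
    (m : ℝ≥0) / (k + 1) ≤ ∑ t ∈ Finset.range m, ∏ r ∈ Finset.range t,
      (((m - t + r) - k : ℕ) : ℝ≥0) / ((m - t + r : ℕ) : ℝ≥0) := by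
  induction m with
  | zero => simp
  | succ m ih =>
    have hS : ∑ t ∈ Finset.range (m + 1), ∏ r ∈ Finset.range t,
        (((m + 1 - t + r) - k : ℕ) : ℝ≥0) / ((m + 1 - t + r : ℕ) : ℝ≥0) =
        1 + (((m - k : ℕ) : ℝ≥0) / m) * ∑ t ∈ Finset.range m, ∏ r ∈ Finset.range t,
          (((m - t + r) - k : ℕ) : ℝ≥0) / ((m - t + r : ℕ) : ℝ≥0) := by
      rw [Finset.sum_range_succ', Finset.mul_sum, add_comm]
      congr 1
      refine Finset.sum_congr rfl fun t ht => ?_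
      rw [Finset.mem_range] at ht
      rw [Finset.prod_range_succ, mul_comm, show m + 1 - (t + 1) + t = m by omega]
      congr 1
      refine Finset.prod_congr rfl fun r _ => ?_
      rw [show m + 1 - (t + 1) + r = m - t + r by omega]
    rw [hS]
    refine le_trans ?_ (add_le_add_right (mul_le_mul_right ih _) 1)
    rw [← NNReal.coe_le_coe]
    simp only [NNReal.coe_add, NNReal.coe_mul, NNReal.coe_div, NNReal.coe_natCast, NNReal.coe_one]
    have hk : (0 : ℝ) < k + 1 := by positivity
    rw [div_le_iff₀ hk]
    rcases le_or_gt m k with h | h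
    · have h0 : (m : ℝ) ≤ k := by exact_mod_cast h
      have : 0 ≤ ((m - k : ℕ) : ℝ) / (m : ℝ) * ((m : ℝ) / (k + 1)) * (k + 1) := by positivity
      push_cast
      linarith
    · have hm : (0 : ℝ) < m := by
        have : 0 < m := by omega
        exact_mod_cast this
      have : ((m - k : ℕ) : ℝ) = m - k := Nat.cast_sub h.le
      rw [this]
      field_simp
      push_cast
      linarith

/-- The average of the guarantees for the single rounds in the IID model, a geometric sum. -/
theorem iid_sum_ge {k m : ℕ} (hk : 1 ≤ k) (hm : 0 < m) :
    (1 - Real.exp (-(k : ℝ))) / k ≤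
      (m : ℝ)⁻¹ * ∑ t ∈ Finset.range m, (((m - k : ℕ) : ℝ) / m) ^ t := by
  have hm' : (0 : ℝ) < m := by exact_mod_cast hm
  have hk' : (0 : ℝ) < k := by exact_mod_cast hk
  have hexp : 0 < Real.exp (-(k : ℝ)) := Real.exp_pos _
  rcases le_or_gt m k with h | h
  · have h1 : (1 : ℝ) ≤ ∑ t ∈ Finset.range m, (((m - k : ℕ) : ℝ) / m) ^ t := by
      refine le_trans (le_of_eq ?_) (Finset.single_le_sum (f := fun t => (((m - k : ℕ) : ℝ) / m) ^ t)
        (fun t _ => by positivity) (Finset.mem_range.2 hm))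
      simp
    have h2 : (m : ℝ) ≤ k := by exact_mod_cast h
    calc (1 - Real.exp (-(k : ℝ))) / k ≤ 1 / k := by
          refine div_le_div_of_nonneg_right ?_ hk'.le
          linarith
      _ ≤ 1 / m := one_div_le_one_div_of_le hm' h2
      _ ≤ _ := by rw [one_div]; exact le_mul_of_one_le_right (by positivity) h1
  · have h1 : ((m - k : ℕ) : ℝ) / m = 1 - k / m := by
      rw [Nat.cast_sub h.le]; field_simp
    have hkm : (k : ℝ) / m ≤ 1 := by
      rw [div_le_one hm']; exact_mod_cast h.le
    have hpos : 0 < (k : ℝ) / m := by positivity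
    have h2 := Real.one_sub_div_pow_le_exp_neg (n := m) (t := k) (by exact_mod_cast h.le)
    rw [h1, geom_sum_eq (by linarith)]
    have h3 : (m : ℝ)⁻¹ * (((1 - (k : ℝ) / m) ^ m - 1) / (1 - k / m - 1)) =
        (1 - (1 - (k : ℝ) / m) ^ m) / k := by
      have : (1 - (k : ℝ) / m - 1) = -(k / m) := by ring
      rw [this]
      field_simp
      ring
    rw [h3]
    exact div_le_div_of_nonneg_right (by linarith) hk'.le

/-! ### Measurability of the offline solution -/

open MeasureTheory

section
variable {n m k : ℕ} {M : Matroid (Fin n)} {B : Pair n → Pair n → Prop}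
variable {Z : Type*} [MeasurableSpace Z]

/-- The offline solution is computed by a program, hence it depends measurably on the weights. -/
theorem measurableSet_solve_eq (hM : M.E = Set.univ) {X : Z → Profile n m}
    (hX : ∀ a e, Measurable fun z => X z a e) (A : Assignment n m) :
    MeasurableSet {z | solve M (X z) = A} := by
  let V : View n := ⟨m, 0, fun I => M.Indep (I : Set (Fin n)), fun _ _ => False, fun _ _ => 0,
    fun _ => 0, 0, 0, fun _ => 0⟩
  let s : Z → Store := fun z => ⟨fun _ _ _ => 0, fun x a e =>
    if x = rW then (market M (X z)).wt a e else 0⟩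
  have hV : View.IsMeasurable fun _ : Z => V :=
    ⟨⟨V, fun _ => ⟨rfl, rfl, rfl, rfl, rfl, rfl⟩⟩, fun _ _ => measurable_const,
      fun _ => measurable_const, fun _ => measurable_const⟩
  have hs : Store.IsMeasurable s := by
    refine ⟨fun _ _ _ => measurable_const, fun x a e => ?_⟩
    simp only [s, market]
    split_ifs
    · exact (hX _ _).coe_nnreal_real
    · exact measurable_const
    · exact measurable_const
  have hown : ∀ z, (solveProg.exec V (s z)).nat nOwn 0 = finalOwn M (X z) := fun z => by
    have hready : Ready V (market M (X z)) m (s z) :=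
      ⟨rfl, rfl, by funext a e; simp [s], fun _ _ => rfl, fun _ _ => by simp [s],
        fun _ _ => by simp [s]⟩
    exact (exec_solve hready (market_isFree M hM (X z)) (market_wt_nonneg M (X z))
      (fun a e ha => by simp [market, not_lt.2 ha])).1.own
  have hmeas : ∀ e, Measurable fun z => finalOwn M (X z) e := fun e => by
    simp only [← hown]
    exact (Prog.measurable_exec hV solveProg hs).nat nOwn 0 e
  have hset : {z | solve M (X z) = A} = ⋂ (a : Fin m) (e : Fin n),
      {z | finalOwn M (X z) e = a + 1 ↔ A a = some e} := by
    ext z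
    simp only [Set.mem_ofPred_eq, Set.mem_iInter, ← solve_eq_some_iff hM]
    constructor
    · rintro rfl a e
      rfl
    · intro h
      funext a
      exact Option.ext fun e => h a e
  rw [hset]
  refine MeasurableSet.iInter fun a => MeasurableSet.iInter fun e => ?_
  exact hmeas e (Set.to_countable {v : ℕ | v = (a : ℕ) + 1 ↔ A a = some e}).measurableSet

theorem measurable_opt (hM : M.E = Set.univ) {X : Z → Profile n m}
    (hX : ∀ a e, Measurable fun z => X z a e) : Measurable fun z => opt M (X z) := by
  classical
  have : (fun z => opt M (X z)) = fun z => ∑ a, ∑ A : Assignment n m,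
      if solve M (X z) = A then weightOf (X z a) (A a) else 0 := by
    funext z
    simp [← sum_offer_eq _ hM]
  rw [this]
  refine Finset.measurable_sum _ fun a _ => Finset.measurable_sum _ fun A _ => ?_
  refine Measurable.ite (measurableSet_solve_eq hM hX A) ?_ measurable_const
  cases A a with
  | none => exact measurable_const
  | some e => exact hX a e

theorem heldSet_eq (hM : M.E = Set.univ) (X : Profile n m) :
    heldSet M X = open Classical in Finset.univ.filter fun e => ∃ a, solve M X a = some e := by
  ext e
  simp [heldSet, finalOwn_ne_zero_iff hM]

/-- The decision in round `t` depends on the offline solutions of the rounds up to `t` only. -/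
theorem Plan.accepted_congr (hM : M.E = Set.univ) {L L' : Plan n m} {t : Fin m}
    (hthr : L.thr = L'.thr) (hpos : ∀ r ≤ t, L.pos r = L'.pos r)
    (hsol : ∀ r ≤ t, solve M (L.profile r) = solve M (L'.profile r)) :
    L.accepted M B t = L'.accepted M B t := by
  classical
  have h1 : ∀ r ≤ t, L.tentative M r = L'.tentative M r := fun r hr => by
    rw [tentative, tentative, hthr, hpos r hr, hsol r hr]
  have h2 : ∀ r ≤ t, heldSet M (L.profile r) = heldSet M (L'.profile r) := fun r hr => by
    rw [heldSet_eq hM, heldSet_eq hM, hsol r hr]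
  have h3 : ∀ e, L.Blocked M B t e ↔ L'.Blocked M B t e := fun e => by
    refine exists_congr fun r => and_congr_right fun hr => ?_
    rw [h1 r hr.le, h2 r hr.le, h2 t le_rfl]
  rw [accepted, accepted, h1 t le_rfl]
  exact if_congr (exists_congr fun e => and_congr_right fun _ => h3 e) rfl rfl

theorem Plan.gain_congr (hM : M.E = Set.univ) {L L' : Plan n m} {t : Fin m}
    (hthr : L.thr = L'.thr) (hpos : ∀ r ≤ t, L.pos r = L'.pos r)
    (hpro : ∀ r ≤ t, L.profile r = L'.profile r) : L.gain M B t = L'.gain M B t := by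
  rw [gain, gain, accepted_congr hM hthr hpos fun r hr => by rw [hpro r hr], hpro t le_rfl,
    hpos t le_rfl]

theorem Plan.measurable_gain (hM : M.E = Set.univ) {X : Z → Fin m → Profile n m}
    (hX : ∀ r a e, Measurable fun z => X z r a e) (p : Fin m → Fin m) (N : ℕ) (t : Fin m) :
    Measurable fun z => (Plan.mk (X z) p N).gain M B t := by
  classical
  have hset : ∀ o, MeasurableSet {z | (Plan.mk (X z) p N).accepted M B t = o} := fun o => by
    have : {z | (Plan.mk (X z) p N).accepted M B t = o} =
        ⋃ (d : Fin m → Assignment n m) (_ : ∃ z, (Plan.mk (X z) p N).accepted M B t = o ∧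
          ∀ r, solve M (X z r) = d r), ⋂ r, {z | solve M (X z r) = d r} := by
      ext z
      simp only [Set.mem_ofPred_eq, Set.mem_iUnion, Set.mem_iInter, exists_prop]
      constructor
      · exact fun h => ⟨fun r => solve M (X z r), ⟨z, h, fun _ => rfl⟩, fun _ => rfl⟩
      · rintro ⟨d, ⟨z', h, hz'⟩, hz⟩
        rw [← h]
        exact accepted_congr hM rfl (fun _ _ => rfl) fun r _ => (hz r).trans (hz' r).symm
    rw [this]
    exact MeasurableSet.iUnion fun d => MeasurableSet.iUnion fun _ =>
      MeasurableSet.iInter fun r => measurableSet_solve_eq hM (hX r) _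
  have : (fun z => (Plan.mk (X z) p N).gain M B t) = fun z => ∑ o : Option (Fin n),
      if (Plan.mk (X z) p N).accepted M B t = o then weightOf (X z t (p t)) o else 0 := by
    funext z
    simp [gain]
  rw [this]
  refine Finset.measurable_sum _ fun o _ => Measurable.ite (hset o) ?_ measurable_const
  cases o with
  | none => exact measurable_const
  | some e => exact hX _ _ e

/-! ### The guarantee in the secretary model -/

instance : IsProbabilityMeasure coinLaw := by
  unfold coinLaw
  infer_instance

theorem planOrder_eq (S : Scenario n m) (N : ℕ) : planOrder S N =
    orderPlan S.weights (fun a => S.samples a) (fun r s => r < s) N S.order := by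
  classical
  simp only [planOrder, orderPlan, Plan.mk.injEq, and_true]
  funext r a
  by_cases h : S.order.symm a ≤ r
  · rw [if_pos h, if_neg (not_lt.2 h)]
  · rw [if_neg h, if_pos (not_le.1 h)]

theorem weightOf_eq_gain_orderPlan (S : Scenario n m) (N : ℕ) (t : Fin m) :
    weightOf (S.weights (S.order t)) ((planOrder S N).accepted S.M S.B t) =
      (orderPlan S.weights (fun a => S.samples a) (fun r s => r < s) N S.order).gain S.M S.B t := by
  rw [← planOrder_eq, Plan.gain]
  simp [planOrder]

theorem opt_eq_zero_of_isEmpty (hM : M.E = Set.univ) (w : Profile n 0) : opt M w = 0 := by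
  rw [← sum_offer_eq w hM]
  simp

theorem competitive_programSecretary (hM : M.E = Set.univ) (hk : 1 ≤ k)
    (hB : IsDirectedCertifier M k B) {b : Polynomial ℕ} (hb : b ∈ programSecretary.stepBound) :
    CompetitiveSecretary M k B m programSecretary (Polynomial.X * b) (secretaryRatio k) := by
  intro w
  refine ⟨fun π ω => runsWithin (prepares_secretary _) hM hB hb, ?_⟩
  rcases m.eq_zero_or_pos with rfl | hm
  · simp [opt_eq_zero_of_isEmpty hM w]
  set N := (bestObserve k m m).2 with hN
  have hcol : ∀ (π : Equiv.Perm (Fin m)) (ω : ℕ → unitInterval),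
      (Scenario.mk M k B π w (fun _ => 0) ω).collected programSecretary =
        ∑ t, (orderPlan w 0 (fun r s => r < s) N π).gain M B t := fun π ω => by
    rw [programSecretary, collected_eq (prepares_secretary _) hM]
    exact Finset.sum_congr rfl fun t _ => weightOf_eq_gain_orderPlan _ _ t
  simp only [hcol, lintegral_const, measure_univ, mul_one]
  have hfac : (m.factorial : ℝ≥0∞) ≠ 0 := by exact_mod_cast m.factorial_ne_zero
  rw [← ENNReal.mul_le_iff_le_inv hfac (ENNReal.natCast_ne_top _)]
  have key : (m.factorial : ℝ≥0) * ((secretaryRatio k).toNNReal * opt M w) ≤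
      ∑ π, ∑ t, (orderPlan w 0 (fun r s => r < s) N π).gain M B t := by
    rw [← NNReal.coe_le_coe]
    simp only [NNReal.coe_mul, NNReal.coe_natCast, NNReal.coe_sum,
      Real.coe_toNNReal _ (secretaryRatio_nonneg k)]
    have hm' : (0 : ℝ) < m := by exact_mod_cast hm
    refine le_of_mul_le_mul_left ?_ hm'
    refine le_trans ?_ (sum_gain_secretary_total hM hB w N)
    have := mul_le_mul_of_nonneg_left (secretaryRatio_mul_le_observeGain hk hm)
      (by positivity : (0 : ℝ) ≤ m.factorial * opt M w)
    linarith
  have := ENNReal.coe_le_coe.2 key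
  push_cast at this
  rw [ENNReal.ofReal]
  exact_mod_cast key

end

/-! ### The guarantee in the prophet-secretary model -/

open MeasureTheory

section
variable {n m k : ℕ} {M : Matroid (Fin n)} {B : Pair n → Pair n → Prop}

/-- For the decision of round `t` let `Y` be the profile that this round solves. In an earlier round
`r`, the agents that arrive after `r` and not after `t` are represented by independent copies. So
the agent of round `r` is, given all later rounds, uniformly distributed on the `m - t + r` agents
that have arrived up to round `r` or arrive after round `t`. -/
theorem sum_gain_prophetSecretary_ge (hM : M.E = Set.univ) (hB : IsDirectedCertifier M k B)
    (Y Y' : Profile n m) (t : Fin m) :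
    (m.factorial : ℝ≥0) * (∏ r ∈ Finset.range t,
      (((m - t + r) - k : ℕ) : ℝ≥0) / ((m - t + r : ℕ) : ℝ≥0)) * opt M Y ≤
      m * ∑ π, (orderPlan Y Y' (fun r s => r < s ∧ s ≤ t) 0 π).gain M B t := by
  classical
  let Q : ℕ → Finset (Fin m) := fun r => Finset.univ.filter fun i => (i : ℕ) ≤ r ∨ t < i
  have hQ : ∀ r < (t : ℕ), (Q r).card = m - t + r := fun r hr => by
    have hrm : r < m := hr.trans t.2
    have : Q r = Finset.Iic ⟨r, hrm⟩ ∪ Finset.Ioi t := by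
      ext i
      simp [Q, Fin.le_def]
    rw [this, Finset.card_union_of_disjoint, Fin.card_Iic, Fin.card_Ioi]
    · have := t.2
      dsimp only
      omega
    · rw [Finset.disjoint_left]
      intro i hi hi'
      have h1 : (i : ℕ) ≤ r := Fin.le_def.1 (Finset.mem_Iic.1 hi)
      have h2 : (t : ℕ) < i := Fin.lt_def.1 (Finset.mem_Ioi.1 hi')
      omega
  have h1 := prod_mul_sum_orderPlan_le hM hB Y Y' (fun r s => r < s ∧ s ≤ t) 0 t (Nat.zero_le _)
    Q ?_ ?_
  · have h2 := card_mul_sum_orderPlan_offer (M := M) Y Y' (fun r s => r < s ∧ s ≤ t) 0 t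
      Finset.univ fun i _ => iff_of_false (by simp) fun h => (not_lt.2 h.2) h.1
    have hpro : ∀ π, (orderPlan Y Y' (fun r s => r < s ∧ s ≤ t) 0 π).profile t = Y := fun π => by
      funext a
      simp only [orderPlan]
      exact if_neg fun h => (not_lt.2 h.2) h.1
    simp only [hpro] at h2
    have h3 : ∀ π : Equiv.Perm (Fin m), ∑ i, weightOf (Y (π i)) (solve M Y (π i)) = opt M Y :=
      fun π => by
        rw [← sum_offer_eq Y hM]
        exact Equiv.sum_comp π fun a => weightOf (Y a) (solve M Y a)
    simp only [h3, Finset.sum_const, Finset.card_univ, Fintype.card_perm, Fintype.card_fin,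
      nsmul_eq_mul] at h2
    have h4 : ∏ r ∈ Finset.Ico 0 (t : ℕ), (((Q r).card - k : ℕ) : ℝ≥0) / (Q r).card =
        ∏ r ∈ Finset.range t, (((m - t + r) - k : ℕ) : ℝ≥0) / ((m - t + r : ℕ) : ℝ≥0) := by
      rw [← Finset.range_eq_Ico]
      exact Finset.prod_congr rfl fun r hr => by rw [hQ r (Finset.mem_range.1 hr)]
    rw [h4] at h1
    calc _ = (∏ r ∈ Finset.range t, (((m - t + r) - k : ℕ) : ℝ≥0) / ((m - t + r : ℕ) : ℝ≥0)) *
          (m.factorial * opt M Y) := by ring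
      _ = m * ((∏ r ∈ Finset.range t,
          (((m - t + r) - k : ℕ) : ℝ≥0) / ((m - t + r : ℕ) : ℝ≥0)) *
          ∑ π, (orderPlan Y Y' (fun r s => r < s ∧ s ≤ t) 0 π).offer M t) := by rw [← h2]; ring
      _ ≤ _ := mul_le_mul_right h1 _
  · intro r s hrs hst i hi
    simp only [Q, Finset.mem_filter, Finset.mem_univ, true_and] at hi
    refine iff_of_false (fun h => not_lt.2 hrs h.1) fun h => ?_
    rcases hi with hi | hi
    · exact not_lt.2 ((Fin.le_def.2 hi).trans hrs) h.1
    · exact not_lt.2 h.2 hi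
  · intro r s hrs hst hs
    simp only [Q, Finset.mem_filter, Finset.mem_univ, true_and] at hs
    rcases hs with hs | hs
    · exact not_le.2 hrs (Fin.le_def.2 hs)
    · exact not_lt.2 hst hs

open Classical in
/-- Exchange the weights and the samples of the agents in `P`. -/
noncomputable def exchange (P : Fin m → Prop) (z : Profile n m × Profile n m) :
    Profile n m × Profile n m :=
  (fun a => if P a then z.2 a else z.1 a, fun a => if P a then z.1 a else z.2 a)

theorem measurePreserving_exchange (D : Fin m → Measure (Fin n → ℝ≥0))
    [∀ a, IsProbabilityMeasure (D a)] (P : Fin m → Prop) :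
    MeasurePreserving (exchange P) ((Measure.pi D).prod (Measure.pi D))
      ((Measure.pi D).prod (Measure.pi D)) := by
  classical
  have h1 := measurePreserving_arrowProdEquivProdArrow (Fin n → ℝ≥0) (Fin n → ℝ≥0) (Fin m) D D
  have h2 : MeasurePreserving
      (fun (z : Fin m → (Fin n → ℝ≥0) × (Fin n → ℝ≥0)) a => if P a then (z a).swap else z a)
      (Measure.pi fun a => (D a).prod (D a)) (Measure.pi fun a => (D a).prod (D a)) := by
    refine measurePreserving_pi (f := fun (a : Fin m) (z : (Fin n → ℝ≥0) × (Fin n → ℝ≥0)) => if P a then z.swap else z) _ _ fun a => ?_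
    by_cases h : P a
    · simp only [h, if_true]
      exact Measure.measurePreserving_swap
    · simp only [h, if_false]
      exact MeasurePreserving.id _
  have h3 := (h1.comp h2).comp (h1.symm _)
  convert h3 using 1
  funext z
  simp only [exchange, Function.comp_apply, MeasurableEquiv.arrowProdEquivProdArrow]
  refine Prod.ext (funext fun a => ?_) (funext fun a => ?_)
  · by_cases h : P a <;> simp [h, Equiv.arrowProdEquivProdArrow]
  · by_cases h : P a <;> simp [h, Equiv.arrowProdEquivProdArrow]

theorem measurable_gain_orderPlan (hM : M.E = Set.univ) (late : Fin m → Fin m → Prop) (N : ℕ)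
    (π : Equiv.Perm (Fin m)) (t : Fin m) : Measurable fun z : Profile n m × Profile n m =>
      (orderPlan z.1 z.2 late N π).gain M B t := by
  classical
  refine Plan.measurable_gain hM (fun r a e => ?_) _ _ _
  by_cases h : late r (π.symm a)
  · simp only [h, if_true]
    exact (measurable_pi_apply e).comp ((measurable_pi_apply a).comp measurable_snd)
  · simp only [h, if_false]
    exact (measurable_pi_apply e).comp ((measurable_pi_apply a).comp measurable_fst)

/-- Weights and samples of the agents that arrive after round `t` are exchangeable. -/
theorem lintegral_gain_exchange (hM : M.E = Set.univ) (D : Fin m → Measure (Fin n → ℝ≥0))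
    [∀ a, IsProbabilityMeasure (D a)] (π : Equiv.Perm (Fin m)) (t : Fin m) :
    ∫⁻ z, ((orderPlan z.1 z.2 (fun r s => r < s) 0 π).gain M B t : ℝ≥0∞)
        ∂((Measure.pi D).prod (Measure.pi D)) =
      ∫⁻ z, ((orderPlan z.1 z.2 (fun r s => r < s ∧ s ≤ t) 0 π).gain M B t : ℝ≥0∞)
        ∂((Measure.pi D).prod (Measure.pi D)) := by
  classical
  rw [← (measurePreserving_exchange D fun a => t < π.symm a).lintegral_comp
    (measurable_gain_orderPlan hM _ 0 π t).coe_nnreal_ennreal]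
  refine lintegral_congr fun z => ?_
  congr 1
  refine Plan.gain_congr hM rfl (fun _ _ => rfl) fun r hr => ?_
  funext a
  simp only [orderPlan, exchange]
  by_cases h1 : t < π.symm a
  · simp [h1, hr.trans_lt h1, not_le.2 h1]
  · by_cases h2 : r < π.symm a <;> simp [h1, h2, not_lt.1 h1]

theorem lintegral_fst_prod {α β : Type*} [MeasurableSpace α] [MeasurableSpace β] (μ : Measure α)
    (ν : Measure β) [SFinite μ] [IsProbabilityMeasure ν] {f : α → ℝ≥0∞} (hf : Measurable f) :
    ∫⁻ z, f z.1 ∂(μ.prod ν) = ∫⁻ x, f x ∂μ :=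
  measurePreserving_fst.lintegral_comp hf

theorem competitive_programProphetSecretary (hM : M.E = Set.univ)
    (hB : IsDirectedCertifier M k B) {b : Polynomial ℕ}
    (hb : b ∈ programProphetSecretary.stepBound) :
    CompetitiveProphetSecretary M k B m programProphetSecretary (Polynomial.X * b)
      (1 / ((k : ℝ) + 1)) := by
  refine ⟨fun π r s ω => runsWithin (prepares_prophetSecretary _) hM hB hb, fun D hD => ?_⟩
  rcases m.eq_zero_or_pos with rfl | hm
  · simp [opt_eq_zero_of_isEmpty hM]
  set μ := (Measure.pi D).prod (Measure.pi D) with hμ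
  have hcol : ∀ (π : Equiv.Perm (Fin m)) (r s : Profile n m) (ω : ℕ → unitInterval),
      (Scenario.mk M k B π r (samplePerAgent s) ω).collected programProphetSecretary =
        ∑ t, (orderPlan r s (fun r s => r < s) 0 π).gain M B t := fun π r s ω => by
    rw [programProphetSecretary, collected_eq (prepares_prophetSecretary _) hM]
    refine Finset.sum_congr rfl fun t _ => ?_
    rw [weightOf_eq_gain_orderPlan]
    have : (fun a : Fin m => samplePerAgent s a) = s := by
      funext a
      simp [samplePerAgent]
    simp only [this]
  have hgain : ∀ (late : Fin m → Fin m → Prop) (π : Equiv.Perm (Fin m)) (t : Fin m),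
      Measurable fun z : Profile n m × Profile n m =>
        ((orderPlan z.1 z.2 late 0 π).gain M B t : ℝ≥0∞) :=
    fun late π t => (measurable_gain_orderPlan hM late 0 π t).coe_nnreal_ennreal
  have hint : ∀ π : Equiv.Perm (Fin m), ∫⁻ z : (Profile n m × Profile n m) × (ℕ → unitInterval),
      ((Scenario.mk M k B π z.1.1 (samplePerAgent z.1.2) z.2).collected
        programProphetSecretary : ℝ≥0∞) ∂(μ.prod coinLaw) =
      ∑ t, ∫⁻ z, ((orderPlan z.1 z.2 (fun r s => r < s ∧ s ≤ t) 0 π).gain M B t : ℝ≥0∞) ∂μ :=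
      fun π => by
    simp only [hcol, ENNReal.ofNNReal_finsetSum]
    rw [lintegral_fst_prod μ coinLaw (Finset.measurable_sum Finset.univ fun t _ => hgain _ π t),
      lintegral_finsetSum _ fun t _ => hgain _ π t]
    exact Finset.sum_congr rfl fun t _ => lintegral_gain_exchange hM D π t
  simp only [hint]
  have hfac : (m.factorial : ℝ≥0∞) ≠ 0 := by exact_mod_cast m.factorial_ne_zero
  rw [← ENNReal.mul_le_iff_le_inv hfac (ENNReal.natCast_ne_top _), Finset.sum_comm]
  set c : ℕ → ℝ≥0 := fun t => ∏ r ∈ Finset.range t,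
    (((m - t + r) - k : ℕ) : ℝ≥0) / ((m - t + r : ℕ) : ℝ≥0) with hc
  set O : ℝ≥0∞ := ∫⁻ r, (opt M r : ℝ≥0∞) ∂(Measure.pi D) with hO
  have hopt : Measurable fun r : Profile n m => (opt M r : ℝ≥0∞) :=
    (measurable_opt hM fun a e => (measurable_pi_apply e).comp (measurable_pi_apply a)
      ).coe_nnreal_ennreal
  have hround : ∀ t : Fin m, (m.factorial : ℝ≥0∞) * c t * O ≤ m * ∑ π : Equiv.Perm (Fin m),
      ∫⁻ z, ((orderPlan z.1 z.2 (fun r s => r < s ∧ s ≤ t) 0 π).gain M B t : ℝ≥0∞) ∂μ :=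
      fun t => by
    rw [← lintegral_finsetSum _ fun π _ => hgain _ π t, ← lintegral_const_mul _
      (Finset.measurable_sum _ fun π _ => hgain _ π t), hO,
      ← lintegral_fst_prod (Measure.pi D) (Measure.pi D) hopt, ← hμ,
      ← lintegral_const_mul' _ _ (ENNReal.mul_ne_top (ENNReal.natCast_ne_top _)
        ENNReal.coe_ne_top)]
    refine lintegral_mono fun z => ?_
    have := ENNReal.coe_le_coe.2 (sum_gain_prophetSecretary_ge hM hB z.1 z.2 t)
    simpa only [ENNReal.coe_mul, ENNReal.coe_natCast, ENNReal.ofNNReal_finsetSum] using this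
  have hmne : (m : ℝ≥0∞) ≠ 0 := by exact_mod_cast hm.ne'
  refine (ENNReal.mul_le_mul_iff_right hmne (ENNReal.natCast_ne_top _)).1 ?_
  rw [Finset.mul_sum]
  refine le_trans ?_ (Finset.sum_le_sum fun t _ => hround t)
  rw [← Finset.sum_mul, ← Finset.mul_sum]
  have hnum : (m : ℝ≥0∞) * ENNReal.ofReal (1 / ((k : ℝ) + 1)) ≤ ∑ t : Fin m, (c t : ℝ≥0∞) := by
    rw [← ENNReal.ofNNReal_finsetSum, ← Finset.sum_range c]
    refine le_trans (le_of_eq ?_) (ENNReal.coe_le_coe.2 (prophetSecretary_sum_ge k m))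
    have : (1 / ((k : ℝ) + 1)) = ((((k : ℝ≥0) + 1)⁻¹ : ℝ≥0) : ℝ) := by
      push_cast
      rw [one_div]
    rw [this, ENNReal.ofReal_coe_nnreal, div_eq_mul_inv]
    push_cast
    rfl
  calc (m : ℝ≥0∞) * (m.factorial * (ENNReal.ofReal (1 / ((k : ℝ) + 1)) * O))
      = m.factorial * (m * ENNReal.ofReal (1 / ((k : ℝ) + 1))) * O := by ring
    _ ≤ _ := by gcongr

end

/-! ### The guarantee in the IID model -/

open MeasureTheory

section
variable {n m k : ℕ} {M : Matroid (Fin n)} {B : Pair n → Pair n → Prop}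

/-- The position of the arriving agent in the offline problem is averaged out: as it is uniformly
distributed, at most a fraction `k / m` of the positions leads to a blocking certificate in a single
round. -/
theorem sum_gain_iid_ge (hM : M.E = Set.univ) (hB : IsDirectedCertifier M k B)
    (X : Fin m → Profile n m) (t : Fin m) :
    (m : ℝ≥0) ^ m * (((m - k : ℕ) : ℝ≥0) / m) ^ (t : ℕ) * opt M (X t) ≤
      m * ∑ j : Fin m → Fin m, (Plan.mk X j 0).gain M B t := by
  classical
  have : NeZero m := ⟨t.pos.ne'⟩
  let act : ℕ → Fin m → (Fin m → Fin m) ≃ (Fin m → Fin m) := fun r i =>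
    if h : r < m then Equiv.addRight (Pi.single ⟨r, h⟩ i) else Equiv.refl _
  have hact : ∀ (r i : Fin m) (j : Fin m → Fin m), act r i j = j + Pi.single r i := fun r i j => by
    simp [act]
  have h1 := Plan.prod_mul_sum_offer_le hM hB (fun j : Fin m → Fin m => Plan.mk X j 0)
    (fun _ => rfl) t (Nat.zero_le _) act (fun _ => Finset.univ) (fun _ _ _ _ _ _ _ => rfl) ?_ ?_
  · have h2 := Plan.card_mul_sum_offer (M := M) (fun j : Fin m → Fin m => Plan.mk X j 0) t (act t)
      Finset.univ fun _ _ _ => rfl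
    have h3 : ∀ j : Fin m → Fin m, ∑ i : Fin m,
        weightOf (X t (act t i j t)) (solve M (X t) (act t i j t)) = opt M (X t) := fun j => by
      rw [← sum_offer_eq (X t) hM]
      simp only [hact, Pi.add_apply, Pi.single_eq_same]
      exact Equiv.sum_comp (Equiv.addLeft (j t)) fun a => weightOf (X t a) (solve M (X t) a)
    simp only [h3, Finset.sum_const, Finset.card_univ, Fintype.card_pi, Fintype.card_fin,
      nsmul_eq_mul, Finset.prod_const, Nat.cast_pow] at h1 h2
    simp only [Nat.card_Ico, Nat.sub_zero] at h1
    calc _ = (((m - k : ℕ) : ℝ≥0) / m) ^ (t : ℕ) * ((m : ℝ≥0) ^ m * opt M (X t)) := by ring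
      _ = m * ((((m - k : ℕ) : ℝ≥0) / m) ^ (t : ℕ) *
          ∑ j : Fin m → Fin m, (Plan.mk X j 0).offer M t) := by rw [← h2]; ring
      _ ≤ _ := mul_le_mul_right h1 _
  · intro r s hrs _ i _ j
    simp [hact, hrs.ne']
  · intro r _ j i _ i' _ h
    simpa [hact] using h

/-- Distinct members of an independent and identically distributed family. -/
theorem measurePreserving_comp_injective {α ι E : Type*} [Fintype α] [MeasurableSpace E]
    (D : Measure E) [IsProbabilityMeasure D] {φ : α → ι} (hφ : Function.Injective φ) :
    MeasurePreserving (fun (x : ι → E) a => x (φ a)) (Measure.infinitePi fun _ : ι => D)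
      (Measure.pi fun _ : α => D) := by
  classical
  have hmeas : Measurable fun (x : ι → E) a => x (φ a) :=
    measurable_pi_lambda _ fun a => measurable_pi_apply _
  refine ⟨hmeas, (Measure.pi_eq fun S hS => ?_).symm⟩
  rw [Measure.map_apply hmeas (MeasurableSet.univ_pi hS)]
  have : (fun (x : ι → E) a => x (φ a)) ⁻¹' Set.univ.pi S =
      Set.pi (Finset.univ.image φ : Finset ι) (Function.extend φ S fun _ => Set.univ) := by
    ext x
    simp [hφ.extend_apply]
  rw [this, Measure.infinitePi_pi, Finset.prod_image fun a _ b _ h => hφ h]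
  · simp [hφ.extend_apply]
  · intro i hi
    obtain ⟨a, -, rfl⟩ := Finset.mem_image.1 hi
    rw [hφ.extend_apply]
    exact hS a

/-- The profiles that the rounds of the IID model solve, if the arriving agents take the
positions `j`. -/
noncomputable def mergedProfiles (order : Equiv.Perm (Fin m)) (j : Fin m → Fin m)
    (z : Profile n m × (ℕ → Fin n → ℝ≥0)) (p : Fin m × Fin m) : Fin n → ℝ≥0 :=
  if p.2 = j p.1 then z.1 (order p.1) else z.2 (p.1 * m + p.2)

/-- For fixed positions, all weight functions in all profiles are independent. -/
theorem measurePreserving_mergedProfiles (order : Equiv.Perm (Fin m)) (j : Fin m → Fin m)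
    (D : Measure (Fin n → ℝ≥0)) [IsProbabilityMeasure D] :
    MeasurePreserving (mergedProfiles order j)
      ((Measure.pi fun _ : Fin m => D).prod (Measure.infinitePi fun _ : ℕ => D))
      (Measure.pi fun _ : Fin m × Fin m => D) := by
  classical
  have hmeas : Measurable (mergedProfiles (n := n) order j) := by
    refine measurable_pi_lambda _ fun p => ?_
    by_cases h : p.2 = j p.1
    · simp only [mergedProfiles, h, if_true]
      exact (measurable_pi_apply _).comp measurable_fst
    · simp only [mergedProfiles, h, if_false]
      exact (measurable_pi_apply _).comp measurable_snd
  refine ⟨hmeas, (Measure.pi_eq fun S hS => ?_).symm⟩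
  rw [Measure.map_apply hmeas (MeasurableSet.univ_pi hS)]
  have hinj : Function.Injective fun p : Fin m × Fin m => (p.1 * m + p.2 : ℕ) := fun p q h => by
    have hp : p = finProdFinEquiv.symm (finProdFinEquiv p) := by simp
    have : finProdFinEquiv p = finProdFinEquiv q := by
      refine Fin.ext ?_
      simp only [finProdFinEquiv_apply_val]
      dsimp only at h
      rw [mul_comm m, mul_comm m]
      omega
    exact finProdFinEquiv.injective this
  have h1 := measurePreserving_comp_injective D order.injective
  rw [Measure.infinitePi_eq_pi] at h1
  have h2 := measurePreserving_comp_injective D hinj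
  let T : Fin m × Fin m → Set (Fin n → ℝ≥0) := fun p => if p.2 = j p.1 then Set.univ else S p
  have hT : ∀ p, MeasurableSet (T p) := fun p => by
    simp only [T]
    split_ifs
    · exact MeasurableSet.univ
    · exact hS p
  have hpre : mergedProfiles order j ⁻¹' Set.univ.pi S =
      ((fun (x : Profile n m) t => x (order t)) ⁻¹' Set.univ.pi fun t => S (t, j t)) ×ˢ
      ((fun (x : ℕ → Fin n → ℝ≥0) (p : Fin m × Fin m) => x (p.1 * m + p.2)) ⁻¹' Set.univ.pi T) := by
    ext z
    simp only [Set.mem_preimage, Set.mem_pi, Set.mem_univ, true_imp_iff, Set.mem_prod,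
      mergedProfiles, T]
    constructor
    · refine fun h => ⟨fun t => by simpa using h (t, j t), fun p => ?_⟩
      by_cases hp : p.2 = j p.1
      · simp [hp]
      · have := h p
        rw [if_neg hp] at this ⊢
        exact this
    · rintro ⟨h, h'⟩ p
      by_cases hp : p.2 = j p.1
      · rw [if_pos hp]
        have := h p.1
        rw [← hp] at this
        exact this
      · have := h' p
        rw [if_neg hp] at this ⊢
        exact this
  rw [hpre, Measure.prod_prod, h1.measure_preimage (MeasurableSet.univ_pi fun t =>
      hS _).nullMeasurableSet, h2.measure_preimage (MeasurableSet.univ_pi hT).nullMeasurableSet,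
    Measure.pi_pi, Measure.pi_pi, Fintype.prod_prod_type, Fintype.prod_prod_type,
    ← Finset.prod_mul_distrib]
  refine Finset.prod_congr rfl fun t _ => ?_
  have hTa : ∀ a, D (T (t, a)) = if a = j t then 1 else D (S (t, a)) := fun a => by
    simp only [T]
    split_ifs <;> simp
  -- the position `j t` contributes to the factor of the weights, the others to that of the samples
  have hsplit : ∀ a, D (S (t, a)) = (if a = j t then D (S (t, a)) else 1) *
      (if a = j t then 1 else D (S (t, a))) := fun a => by
    split_ifs <;> simp
  simp only [hTa]
  rw [Finset.prod_congr rfl fun a _ => hsplit a, Finset.prod_mul_distrib, Finset.prod_ite_eq']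
  simp

theorem coinPos_eq {i : ℕ} {u : unitInterval} (hi : i < m) (h1 : (i : ℝ) / m < u)
    (h2 : (u : ℝ) < (i + 1) / m) : coinPos m u = i := by
  classical
  have hm : (0 : ℝ) < m := by
    have : 0 < m := by omega
    exact_mod_cast this
  rw [coinPos]
  have : (Finset.range m).filter (fun i' : ℕ => 1 ≤ i' ∧ (i' : ℝ) / m ≤ u) = Finset.Icc 1 i := by
    ext l
    simp only [Finset.mem_filter, Finset.mem_range, Finset.mem_Icc]
    constructor
    · rintro ⟨-, hl, hlu⟩
      refine ⟨hl, ?_⟩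
      have := (div_lt_div_iff_of_pos_right hm).1 (hlu.trans_lt h2)
      exact Nat.lt_succ_iff.1 (by exact_mod_cast this)
    · rintro ⟨hl, hli⟩
      refine ⟨by omega, hl, le_trans ?_ h1.le⟩
      have : (l : ℝ) ≤ i := by exact_mod_cast hli
      gcongr
  have h := (congrArg Finset.card this).trans (Nat.card_Icc 1 i)
  rw [Nat.add_sub_cancel] at h
  convert h using 1

theorem measurable_coinPos (m : ℕ) : Measurable (coinPos m) := by
  classical
  have : coinPos m = fun u : unitInterval => ∑ i ∈ Finset.range m,
      if 1 ≤ i ∧ (i : ℝ) / m ≤ u then 1 else 0 := by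
    funext u
    rw [coinPos, Finset.card_filter]
  rw [this]
  refine Finset.measurable_sum _ fun i _ => measurable_ite_nat ?_
  exact (MeasurableSet.const _).inter (measurableSet_le measurable_const measurable_subtype_coe)

theorem volume_coinPos_ge {i : ℕ} (hi : i < m) :
    (m : ℝ≥0∞)⁻¹ ≤ volume {u : unitInterval | coinPos m u = i} := by
  have hm : (0 : ℝ) < m := by
    have : 0 < m := by omega
    exact_mod_cast this
  have hi' : (i : ℝ) + 1 ≤ m := by exact_mod_cast hi
  have ha : (i : ℝ) / m ∈ unitInterval :=
    ⟨by positivity, (div_le_one hm).2 (by linarith)⟩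
  have hb : ((i : ℝ) + 1) / m ∈ unitInterval :=
    ⟨by positivity, (div_le_one hm).2 hi'⟩
  have hsub : Set.Ioo (⟨_, ha⟩ : unitInterval) ⟨_, hb⟩ ⊆ {u | coinPos m u = i} := fun u hu =>
    coinPos_eq hi hu.1 hu.2
  refine le_trans (le_of_eq ?_) (measure_mono hsub)
  rw [unitInterval.volume_Ioo]
  have : ((i : ℝ) + 1) / m - i / m = (m : ℝ)⁻¹ := by
    field_simp
    ring
  simp only [this]
  rw [ENNReal.ofReal_inv_of_pos hm, ENNReal.ofReal_natCast]

/-- The positions that are drawn in the IID model. -/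
noncomputable def positions (m : ℕ) (ω : ℕ → unitInterval) (t : Fin m) : Fin m :=
  ⟨coinPos m (ω t), coinPos_lt t.pos _⟩

theorem measurable_positions (m : ℕ) : Measurable (positions m) := by
  refine measurable_pi_lambda _ fun t => ?_
  refine measurable_to_countable' fun i => ?_
  have : (fun ω => positions m ω t) ⁻¹' {i} = (fun ω : ℕ → unitInterval => coinPos m (ω t)) ⁻¹' {(i : ℕ)} := by
    ext ω
    simp [positions, Fin.ext_iff]
  rw [this]
  exact ((measurable_coinPos m).comp (measurable_pi_apply (t : ℕ))) (measurableSet_singleton _)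

/-- The positions are uniformly distributed; the lower bound for the probabilities is all that is
needed. -/
theorem one_le_coinLaw_positions (hm : 0 < m) (j : Fin m → Fin m) :
    1 ≤ (m : ℝ≥0∞) ^ m * coinLaw (positions m ⁻¹' {j}) := by
  classical
  have hset : positions m ⁻¹' {j} = (fun (ω : ℕ → unitInterval) (t : Fin m) => ω t) ⁻¹'
      Set.univ.pi fun t => {u | coinPos m u = j t} := by
    ext ω
    simp [positions, funext_iff, Fin.ext_iff]
  have h := measurePreserving_comp_injective (volume : Measure unitInterval)
    (Fin.val_injective (n := m))
  have hmeas : MeasurableSet (Set.univ.pi fun t : Fin m => {u | coinPos m u = j t}) :=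
    MeasurableSet.univ_pi fun t => measurable_coinPos m (measurableSet_singleton (j t : ℕ))
  rw [hset, coinLaw, h.measure_preimage hmeas.nullMeasurableSet, Measure.pi_pi]
  have h2 : ∏ _t : Fin m, (m : ℝ≥0∞)⁻¹ ≤
      ∏ t : Fin m, volume {u : unitInterval | coinPos m u = j t} :=
    Finset.prod_le_prod' fun t _ => volume_coinPos_ge (j t).2
  rw [Finset.prod_const, Finset.card_univ, Fintype.card_fin] at h2
  refine le_trans (le_of_eq ?_) (mul_le_mul_right h2 _)
  rw [← mul_pow, ENNReal.mul_inv_cancel (by exact_mod_cast hm.ne') (ENNReal.natCast_ne_top _),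
    one_pow]

theorem competitive_programIID (hM : M.E = Set.univ) (hk : 1 ≤ k)
    (hB : IsDirectedCertifier M k B) {b : Polynomial ℕ} (hb : b ∈ programIID.stepBound) :
    CompetitiveIID M k B m programIID (Polynomial.X * b) ((1 - Real.exp (-(k : ℝ))) / (k : ℝ)) := by
  intro order
  refine ⟨fun r s ω => runsWithin (prepares_fillIID _) hM hB hb, fun D hD => ?_⟩
  rcases m.eq_zero_or_pos with rfl | hm
  · simp [opt_eq_zero_of_isEmpty hM]
  set μ := (Measure.pi fun _ : Fin m => D).prod (Measure.infinitePi fun _ : ℕ => D) with hμ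
  set ν := Measure.pi fun _ : Fin m × Fin m => D with hν
  let G : (Fin m → Fin m) → (Fin m × Fin m → Fin n → ℝ≥0) → ℝ≥0∞ := fun j X =>
    ∑ t, ((Plan.mk (fun t a => X (t, a)) j 0).gain M B t : ℝ≥0∞)
  have hgain : ∀ j t, Measurable fun X : Fin m × Fin m → Fin n → ℝ≥0 =>
      ((Plan.mk (fun t a => X (t, a)) j 0).gain M B t : ℝ≥0∞) := fun j t =>
    (Plan.measurable_gain hM (fun r a e => (measurable_pi_apply e).comp (measurable_pi_apply (r, a)))
      j 0 t).coe_nnreal_ennreal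
  have hG : ∀ j, Measurable (G j) := fun j => Finset.measurable_sum _ fun t _ => hgain j t
  have hcol : ∀ (z : Profile n m × (ℕ → Fin n → ℝ≥0)) (ω : ℕ → unitInterval),
      ((Scenario.mk M k B order z.1 z.2 ω).collected programIID : ℝ≥0∞) =
        G (positions m ω) (mergedProfiles order (positions m ω) z) := fun z ω => by
    rw [programIID, collected_eq (prepares_fillIID _) hM, ENNReal.ofNNReal_finsetSum]
    refine Finset.sum_congr rfl fun t _ => ?_
    set S := Scenario.mk M k B order z.1 z.2 ω with hS
    have hplan : planIID S =
        Plan.mk (fun t a => mergedProfiles order (positions m ω) z (t, a)) (positions m ω) 0 := by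
      simp only [planIID, Plan.mk.injEq, and_true]
      refine ⟨?_, rfl⟩
      funext t a
      simp only [mergedProfiles, positions, Fin.ext_iff]
      rfl
    rw [← hplan, Plan.gain]
    congr 2
    simp [planIID, hS]
  have hJ := measurable_positions m
  have hint : ∫⁻ z : (Profile n m × (ℕ → Fin n → ℝ≥0)) × (ℕ → unitInterval),
      ((Scenario.mk M k B order z.1.1 z.1.2 z.2).collected programIID : ℝ≥0∞) ∂(μ.prod coinLaw) =
      ∑ j, (∫⁻ X, G j X ∂ν) * coinLaw (positions m ⁻¹' {j}) := by
    rw [lintegral_prod_symm]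
    · have : ∀ ω, ∫⁻ z, ((Scenario.mk M k B order z.1 z.2 ω).collected programIID : ℝ≥0∞) ∂μ =
          ∫⁻ X, G (positions m ω) X ∂ν := fun ω => by
        simp only [hcol]
        exact (measurePreserving_mergedProfiles order (positions m ω) D).lintegral_comp (hG _)
      simp only [this]
      rw [← lintegral_map (μ := coinLaw) (f := fun j => ∫⁻ X, G j X ∂ν) (measurable_of_finite _) hJ,
        lintegral_fintype]
      refine Finset.sum_congr rfl fun j _ => ?_
      rw [Measure.map_apply hJ (measurableSet_singleton j)]
    · refine (measurable_collected _ M k B order (measurable_fst.comp measurable_fst)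
        (fun i e => ?_) measurable_snd).coe_nnreal_ennreal.aemeasurable
      exact (measurable_pi_apply e).comp ((measurable_pi_apply i).comp
        (measurable_snd.comp measurable_fst))
  rw [hint]
  set O : ℝ≥0∞ := ∫⁻ r, (opt M r : ℝ≥0∞) ∂(Measure.pi fun _ : Fin m => D) with hO
  set c : ℝ≥0 := ((m - k : ℕ) : ℝ≥0) / m with hc
  have hopt : Measurable fun r : Profile n m => (opt M r : ℝ≥0∞) :=
    (measurable_opt hM fun a e => (measurable_pi_apply e).comp (measurable_pi_apply a)
      ).coe_nnreal_ennreal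
  have hround : ∀ t : Fin m, (m : ℝ≥0∞) ^ m * (c : ℝ≥0∞) ^ (t : ℕ) * O ≤ m * ∑ j, ∫⁻ X,
      ((Plan.mk (fun t a => X (t, a)) j 0).gain M B t : ℝ≥0∞) ∂ν := fun t => by
    have hrow := measurePreserving_comp_injective (α := Fin m) D
      (φ := fun a => (t, a)) fun a a' h => (Prod.ext_iff.1 h).2
    rw [Measure.infinitePi_eq_pi] at hrow
    rw [← lintegral_finsetSum _ fun j _ => hgain j t, ← lintegral_const_mul _
      (Finset.measurable_sum _ fun j _ => hgain j t), hO, ← hrow.lintegral_comp hopt,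
      ← lintegral_const_mul' _ _ (ENNReal.mul_ne_top (ENNReal.pow_ne_top (ENNReal.natCast_ne_top _))
        (ENNReal.pow_ne_top ENNReal.coe_ne_top))]
    refine lintegral_mono fun X => ?_
    have := ENNReal.coe_le_coe.2 (sum_gain_iid_ge hM hB (fun t a => X (t, a)) t)
    simpa only [ENNReal.coe_mul, ENNReal.coe_natCast, ENNReal.ofNNReal_finsetSum, ENNReal.coe_pow]
      using this
  have hsum : (m : ℝ≥0∞) ^ m * (∑ t : Fin m, (c : ℝ≥0∞) ^ (t : ℕ)) * O ≤
      m * ∑ j, ∫⁻ X, G j X ∂ν := by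
    have : ∑ j, ∫⁻ X, G j X ∂ν = ∑ t, ∑ j, ∫⁻ X,
        ((Plan.mk (fun t a => X (t, a)) j 0).gain M B t : ℝ≥0∞) ∂ν := by
      rw [Finset.sum_comm]
      exact Finset.sum_congr rfl fun j _ => lintegral_finsetSum _ fun t _ => hgain j t
    rw [this, Finset.mul_sum, Finset.mul_sum, Finset.sum_mul]
    exact Finset.sum_le_sum fun t _ => hround t
  have hnum : (m : ℝ≥0∞) * ENNReal.ofReal ((1 - Real.exp (-(k : ℝ))) / (k : ℝ)) ≤
      ∑ t : Fin m, (c : ℝ≥0∞) ^ (t : ℕ) := by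
    have h := iid_sum_ge hk hm
    have hm' : (0 : ℝ) < m := by exact_mod_cast hm
    rw [inv_mul_eq_div, le_div_iff₀ hm', mul_comm] at h
    have h2 : (∑ t : Fin m, (c : ℝ≥0∞) ^ (t : ℕ)) =
        ENNReal.ofReal (∑ t ∈ Finset.range m, (((m - k : ℕ) : ℝ) / m) ^ t) := by
      rw [← Finset.sum_range fun t => (c : ℝ≥0∞) ^ t]
      have : (∑ t ∈ Finset.range m, (((m - k : ℕ) : ℝ) / m) ^ t) =
          ((∑ t ∈ Finset.range m, c ^ t : ℝ≥0) : ℝ) := by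
        simp only [hc, NNReal.coe_sum, NNReal.coe_pow, NNReal.coe_div, NNReal.coe_natCast]
      rw [this, ENNReal.ofReal_coe_nnreal, ENNReal.ofNNReal_finsetSum]
      simp only [ENNReal.coe_pow]
    rw [h2, ← ENNReal.ofReal_natCast, ← ENNReal.ofReal_mul hm'.le]
    exact ENNReal.ofReal_le_ofReal h
  have hlaw : ∑ j, ∫⁻ X, G j X ∂ν ≤
      (m : ℝ≥0∞) ^ m * ∑ j, (∫⁻ X, G j X ∂ν) * coinLaw (positions m ⁻¹' {j}) := by
    rw [Finset.mul_sum]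
    refine Finset.sum_le_sum fun j _ => ?_
    calc ∫⁻ X, G j X ∂ν = (∫⁻ X, G j X ∂ν) * 1 := (mul_one _).symm
      _ ≤ (∫⁻ X, G j X ∂ν) * ((m : ℝ≥0∞) ^ m * coinLaw (positions m ⁻¹' {j})) :=
          mul_le_mul_right (one_le_coinLaw_positions hm j) _
      _ = _ := by ring
  have hmne : (m : ℝ≥0∞) ≠ 0 := by exact_mod_cast hm.ne'
  have hmm : (m : ℝ≥0∞) ^ m * m ≠ 0 := mul_ne_zero (pow_ne_zero _ hmne) hmne
  refine (ENNReal.mul_le_mul_iff_right hmm (ENNReal.mul_ne_top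
    (ENNReal.pow_ne_top (ENNReal.natCast_ne_top _)) (ENNReal.natCast_ne_top _))).1 ?_
  calc (m : ℝ≥0∞) ^ m * m * (ENNReal.ofReal ((1 - Real.exp (-(k : ℝ))) / (k : ℝ)) * O)
      = m ^ m * (m * ENNReal.ofReal ((1 - Real.exp (-(k : ℝ))) / (k : ℝ))) * O := by ring
    _ ≤ m ^ m * (∑ t : Fin m, (c : ℝ≥0∞) ^ (t : ℕ)) * O := by gcongr
    _ ≤ m * ∑ j, ∫⁻ X, G j X ∂ν := hsum
    _ ≤ m * (m ^ m * ∑ j, (∫⁻ X, G j X ∂ν) * coinLaw (positions m ⁻¹' {j})) := by gcongr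
    _ = _ := by ring

end

end OnlineAssignment

theorem theorem6 :
    (∃ (P : OnlineAssignment.Prog) (q : Polynomial ℕ),
      ∀ (n m k : ℕ) (M : Matroid (Fin n))
        (B : OnlineAssignment.Pair n → OnlineAssignment.Pair n → Prop),
        M.E = Set.univ → 1 ≤ k → OnlineAssignment.IsDirectedCertifier M k B →
        OnlineAssignment.CompetitiveIID M k B m P q ((1 - Real.exp (-(k : ℝ))) / (k : ℝ))) ∧
    (∃ (P : OnlineAssignment.Prog) (q : Polynomial ℕ),
      ∀ (n m k : ℕ) (M : Matroid (Fin n))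
        (B : OnlineAssignment.Pair n → OnlineAssignment.Pair n → Prop),
        M.E = Set.univ → 1 ≤ k → OnlineAssignment.IsDirectedCertifier M k B →
        OnlineAssignment.CompetitiveProphetSecretary M k B m P q (1 / ((k : ℝ) + 1))) ∧
    (∃ (P : OnlineAssignment.Prog) (q : Polynomial ℕ),
      ∀ (n m k : ℕ) (M : Matroid (Fin n))
        (B : OnlineAssignment.Pair n → OnlineAssignment.Pair n → Prop),
        M.E = Set.univ → 1 ≤ k → OnlineAssignment.IsDirectedCertifier M k B →
        OnlineAssignment.CompetitiveSecretary M k B m P q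
          (OnlineAssignment.secretaryRatio k)) := by
  obtain ⟨b₁, h₁⟩ := OnlineAssignment.stepBound_programIID
  obtain ⟨b₂, h₂⟩ := OnlineAssignment.stepBound_programProphetSecretary
  obtain ⟨b₃, h₃⟩ := OnlineAssignment.stepBound_programSecretary
  exact ⟨⟨OnlineAssignment.programIID, Polynomial.X * b₁, fun _ _ _ _ _ hM hk hB =>
      OnlineAssignment.competitive_programIID hM hk hB h₁⟩,
    ⟨OnlineAssignment.programProphetSecretary, Polynomial.X * b₂, fun _ _ _ _ _ hM _ hB =>
      OnlineAssignment.competitive_programProphetSecretary hM hB h₂⟩,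
    ⟨OnlineAssignment.programSecretary, Polynomial.X * b₃, fun _ _ _ _ _ hM hk hB =>
      OnlineAssignment.competitive_programSecretary hM hk hB h₃⟩⟩
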